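/- **Conventions.** C$^*$-algebras are unital and ideals are closed and two-sided. An operator system $X$ is a nonzero linear subspace (not necessarily closed) of a C$^*$-algebra $B$ that contains $1_B$ and is closed under the involution; $M_k(X)$ has the norm and positive cone inherited from $M_k(B)$. A subsystem of $X$ is an operator system $E\subset B$ with $E\subset X$. For a linear map $\phi:X\to A$ into a C$^*$-algebra, $\|\phi\|_k$ denotes the norm of the amplification $M_k(X)\to M_k(A)$, $\|\phi\|_{\mathrm{cb}}=\sup_k\|\phi\|_k$, and "u.c.p." means unital completely positive. For an ultrafilter $\omega$ on a set $I$ and a C$^*$-algebra $A$, $A_\omega=\ell^\infty(I,A)/\{(a_i)_{i\in I}:\lim_\omega\|a_i\|=0\}$. * $X$ has the *local lifting property* (LLP) if for every C$^*$-algebra $A$, every ideal $J$ of $A$, every u.c.p. map $\phi:X\to A/J$ and every finite-dimensional subsystem $E\subset X$ there is a u.c.p. map $\psi:E\to A$ with $\pi_J\circ\psi=\phi|_E$, where $\pi_J:A\to A/J$ is the quotient map. * $X$ has the *approximate local lifting property* (ALLP) if for all such $A,J,\phi,E$ and every $\varepsilon>0$ there is a linear map $\psi:E\to A$ with $\|\psi\|_{\mathrm{cb}}<1+\varepsilon$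 and $\|\pi_J\circ\psi-\phi|_E\|<\varepsilon$. * For an ultrafilter $\omega$ on a set $I$, $X$ has the *local ultrapower lifting property for $\omega$* if for every C$^*$-algebra $A$, every u.c.p. map $\phi:X\to A_\omega$ and every finite-dimensional subsystem $E\subset X$, the restriction $\phi|_E$ lifts to a u.c.p. map $E\to\ell^\infty(I,A)$. $X$ has the *local ultrapower lifting property* (LULP) if this holds for every ultrafilter on every index set. * $X$ is *CP-stable* if for every finite-dimensional subsystem $E\subset X$ and every $\delta>0$ there are a finite-dimensional subsystem $S$ with $E\subset S\subset X$, an integer $k\ge1$ and $\varepsilon>0$ such that for every C$^*$-algebra $A$ and every unital linear map $\phi:S\to A$ with $\|\phi\|_k<1+\varepsilon$ there is a u.c.p. map $\psi:E\to A$ with $\|\phi|_E-\psi\|<\delta$. **Proposition.** For an operator system $X$ the following are equivalent: 1. $X$ has the LLP; 2. $X$ has the ALLP; 3. $X$ has the LULP; 4. $X$ is CP-stable. If moreover $X$ is separable then, for each single non-principal ultrafilter $\omega$ on $\mathbb N$, these properties are also equivalent to the local ultrapower lifting property for $\omega$. -/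

import Mathlib

open scoped ENNReal CStarAlgebra Topology

attribute [local instance] CStarAlgebra.spectralOrder CStarAlgebra.spectralOrderedRing

/-! ### Quotient C⋆-algebras -/

section Quotient

variable {A : Type*} [CStarAlgebra A]

/-- For `a ∈ A` and `ε > 0` there are `b = (1 + n a⋆a)⁻¹` and `c` with `1 - b = a⋆a c`,
`b` a self-adjoint contraction, and `‖a b‖ < ε`. -/
theorem CStarAlgebra.exists_approx_cutoff (a : A) {ε : ℝ} (hε : 0 < ε) :
    ∃ b c : A, IsSelfAdjoint b ∧ ‖b‖ ≤ 1 ∧ 1 - b = star a * a * c ∧ ‖a * b‖ < ε := by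
  obtain ⟨n, hn⟩ := exists_nat_gt (1 / ε ^ 2)
  have hn0 : (0 : ℝ) < n := lt_trans (by positivity) hn
  have hsa : IsSelfAdjoint (star a * a) := .star_mul_self a
  have hspec : ∀ t ∈ spectrum ℝ (star a * a), 0 ≤ t := fun t ht =>
    spectrum_nonneg_of_nonneg (star_mul_self_nonneg a) ht
  have hpos : ∀ t ∈ spectrum ℝ (star a * a), 0 < 1 + n * t := fun t ht => by
    have := hspec t ht
    positivity
  have hc1 : ContinuousOn (fun t : ℝ => (1 + n * t)⁻¹) (spectrum ℝ (star a * a)) :=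
    ContinuousOn.inv₀ (by fun_prop) fun t ht => (hpos t ht).ne'
  have hc2 : ContinuousOn (fun t : ℝ => n * (1 + n * t)⁻¹) (spectrum ℝ (star a * a)) :=
    continuousOn_const.mul hc1
  set b := cfc (fun t : ℝ => (1 + n * t)⁻¹) (star a * a) with hb
  have hbsa : IsSelfAdjoint b := cfc_predicate _ _
  refine ⟨b, cfc (fun t : ℝ => n * (1 + n * t)⁻¹) (star a * a), hbsa, ?_, ?_, ?_⟩
  · refine norm_cfc_le zero_le_one fun t ht => ?_
    have h0 := hspec t ht
    rw [Real.norm_of_nonneg (inv_nonneg.2 (hpos t ht).le)]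
    exact inv_le_one_of_one_le₀ (by nlinarith)
  · have h1 : star a * a * cfc (fun t : ℝ => n * (1 + n * t)⁻¹) (star a * a) =
        cfc (fun t : ℝ => t * (n * (1 + n * t)⁻¹)) (star a * a) := by
      conv_lhs => enter [1]; rw [← cfc_id' ℝ (star a * a)]
      rw [← cfc_mul (fun t : ℝ => t) _ _ (by fun_prop) hc2]
    have h2 : 1 - b = cfc (fun t : ℝ => 1 - (1 + n * t)⁻¹) (star a * a) := by
      rw [hb, cfc_sub _ _ _ (by fun_prop) hc1, cfc_const_one ℝ (star a * a)]
    rw [h1, h2]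
    refine cfc_congr fun t ht => ?_
    have := (hpos t ht).ne'
    field_simp
    ring
  · have h3 : star (a * b) * (a * b) =
        cfc (fun t : ℝ => (1 + n * t)⁻¹ * (t * (1 + n * t)⁻¹)) (star a * a) := by
      rw [cfc_mul (fun t : ℝ => (1 + n * t)⁻¹) (fun t : ℝ => t * (1 + n * t)⁻¹) _ hc1
        (continuousOn_id.mul hc1),
        cfc_mul (fun t : ℝ => t) (fun t : ℝ => (1 + n * t)⁻¹) _ (by fun_prop) hc1,
        cfc_id' ℝ (star a * a), ← hb, star_mul, hbsa.star_eq]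
      simp only [mul_assoc]
    have h4 : ‖a * b‖ * ‖a * b‖ ≤ 1 / n := by
      rw [← CStarRing.norm_star_mul_self, h3]
      refine norm_cfc_le (by positivity) fun t ht => ?_
      have h0 := hspec t ht
      have hp := hpos t ht
      rw [Real.norm_of_nonneg (by positivity)]
      rw [show (1 + n * t)⁻¹ * (t * (1 + n * t)⁻¹) = t / (1 + n * t) ^ 2 by field_simp,
        div_le_div_iff₀ (by positivity) hn0]
      nlinarith [mul_nonneg hn0.le h0]
    have h5 : 1 / (n : ℝ) < ε ^ 2 := by
      rw [div_lt_iff₀ hn0]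
      rw [div_lt_iff₀ (by positivity)] at hn
      linarith
    exact lt_of_pow_lt_pow_left₀ 2 hε.le (by nlinarith)

variable (J : Ideal A) [hJ2 : J.IsTwoSided] [hJ : IsClosed (J : Set A)]

/-- A closed two-sided ideal of a C⋆-algebra is closed under the involution. -/
theorem CStarAlgebra.star_mem_ideal {j : A} (hj : j ∈ J) : star j ∈ J := by
  change star j ∈ (J : Set A)
  rw [← hJ.closure_eq, Metric.mem_closure_iff]
  intro ε hε
  obtain ⟨b, c, -, -, hbc, hlt⟩ := CStarAlgebra.exists_approx_cutoff (star j) hε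
  refine ⟨star j * (1 - b), J.mul_mem_left _ ?_, ?_⟩
  · rw [hbc, star_star]
    exact J.mul_mem_right _ (J.mul_mem_right _ hj)
  · rw [dist_eq_norm, mul_sub, mul_one, sub_sub_cancel]
    exact hlt

noncomputable instance CStarAlgebra.quotientNormedRing : NormedRing (A ⧸ J) where
  __ := (inferInstance : Ring (A ⧸ J))
  __ := Submodule.Quotient.normedAddCommGroup J
  norm_mul_le x y := by
    refine le_of_forall_pos_le_add fun ε hε => ?_
    have hcont : Filter.Tendsto (fun d : ℝ => (‖x‖ + d) * (‖y‖ + d)) (𝓝[>] 0)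
        (𝓝 ((‖x‖ + 0) * (‖y‖ + 0))) :=
      (Continuous.tendsto (by fun_prop) 0).mono_left nhdsWithin_le_nhds
    rw [add_zero, add_zero] at hcont
    obtain ⟨d, hd, hd0⟩ := ((hcont.eventually_lt_const (lt_add_of_pos_right _ hε)).and
      self_mem_nhdsWithin).exists
    obtain ⟨a, rfl, ha⟩ := Submodule.Quotient.norm_mk_lt x hd0
    obtain ⟨b, rfl, hb⟩ := Submodule.Quotient.norm_mk_lt y hd0
    calc _ ≤ ‖a * b‖ := Submodule.Quotient.norm_mk_le J (a * b)
      _ ≤ ‖a‖ * ‖b‖ := norm_mul_le a b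
      _ ≤ _ := by gcongr
      _ ≤ _ := hd.le

noncomputable instance CStarAlgebra.quotientNormedAlgebra : NormedAlgebra ℂ (A ⧸ J) where
  __ := (inferInstance : Algebra ℂ (A ⧸ J))
  norm_smul_le := (Submodule.Quotient.normedSpace J ℂ).norm_smul_le

noncomputable instance CStarAlgebra.quotientStarRing : StarRing (A ⧸ J) where
  star := Quotient.lift (fun a => Ideal.Quotient.mk J (star a)) fun a b h => by
    rw [Ideal.Quotient.eq, ← star_sub]
    exact CStarAlgebra.star_mem_ideal J ((Submodule.quotientRel_def J).1 h)
  star_involutive := by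
    rintro ⟨a⟩
    exact congrArg (Ideal.Quotient.mk J) (star_star a)
  star_mul := by
    rintro ⟨a⟩ ⟨b⟩
    exact congrArg (Ideal.Quotient.mk J) (star_mul a b)
  star_add := by
    rintro ⟨a⟩ ⟨b⟩
    exact congrArg (Ideal.Quotient.mk J) (star_add a b)

theorem CStarAlgebra.quotient_star_mk (a : A) :
    star (Ideal.Quotient.mk J a) = Ideal.Quotient.mk J (star a) := rfl

instance CStarAlgebra.quotientCStarRing : CStarRing (A ⧸ J) where
  norm_mul_self_le := by
    intro x
    obtain ⟨a, rfl⟩ := Ideal.Quotient.mk_surjective x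
    refine le_of_forall_pos_le_add fun ε hε => ?_
    obtain ⟨m, hm, hlt⟩ := Submodule.Quotient.norm_mk_lt
      (star (Ideal.Quotient.mk J a) * Ideal.Quotient.mk J a) (half_pos hε)
    have hmem : m - star a * a ∈ J := by
      rw [← Ideal.Quotient.eq, map_mul, ← CStarAlgebra.quotient_star_mk]
      exact hm
    set j := m - star a * a with hj
    obtain ⟨b, c, hbs, hb1, hbc, hb2⟩ := CStarAlgebra.exists_approx_cutoff j (half_pos hε)
    have hb : Ideal.Quotient.mk J a = Ideal.Quotient.mk J (a * b) := by
      rw [Ideal.Quotient.eq]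
      have : a - a * b = a * (1 - b) := by noncomm_ring
      rw [this, hbc]
      exact J.mul_mem_left _ (J.mul_mem_right _ (J.mul_mem_left _ hmem))
    have hle : ‖Ideal.Quotient.mk J a‖ ≤ ‖a * b‖ := by
      rw [hb]
      exact Submodule.Quotient.norm_mk_le J (a * b)
    have hexp : star (a * b) * (a * b) = b * m * b - b * (j * b) := by
      rw [star_mul, hbs.star_eq, hj]
      noncomm_ring
    calc _ ≤ ‖a * b‖ * ‖a * b‖ := by gcongr
      _ = ‖star (a * b) * (a * b)‖ := (CStarRing.norm_star_mul_self).symm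
      _ ≤ ‖b * m * b‖ + ‖b * (j * b)‖ := by rw [hexp]; exact norm_sub_le _ _
      _ ≤ ‖m‖ + ‖j * b‖ := by
        gcongr
        · calc _ ≤ ‖b‖ * ‖m‖ * ‖b‖ := norm_mul₃_le
            _ ≤ 1 * ‖m‖ * 1 := by gcongr
            _ = ‖m‖ := by ring
        · calc _ ≤ ‖b‖ * ‖j * b‖ := norm_mul_le _ _
            _ ≤ 1 * ‖j * b‖ := by gcongr
            _ = _ := one_mul _
      _ ≤ _ := by linarith

/-- The quotient `A ⧸ J` of a unital C⋆-algebra by a closed two-sided ideal, with the quotient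
norm and the induced involution, is a unital C⋆-algebra. -/
noncomputable instance CStarAlgebra.quotient : CStarAlgebra (A ⧸ J) where
  __ := CStarAlgebra.quotientNormedRing J
  __ := CStarAlgebra.quotientStarRing J
  __ := CStarAlgebra.quotientCStarRing J
  __ := CStarAlgebra.quotientNormedAlgebra J
  __ : CompleteSpace (A ⧸ J) := Submodule.Quotient.completeSpace J
  star_smul := by
    rintro z ⟨a⟩
    exact congrArg (Ideal.Quotient.mk J) (star_smul z a)

end Quotient

/-! ### Ultrapowers -/

section Ultrapower

universe u w

variable {I : Type w} (A : Type u) [CStarAlgebra A] [Nontrivial A]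

/-- The C⋆-algebra `ℓ^∞(I, A)` of bounded families in `A`. -/
noncomputable instance lp.constCStarAlgebra : CStarAlgebra (lp (fun _ : I => A) ∞) where

variable (ω : Ultrafilter I)

/-- The ideal of the bounded families `f` with `lim_ω ‖f i‖ = 0`. -/
noncomputable def ultrapowerIdeal : Ideal (lp (fun _ : I => A) ∞) where
  carrier := {f | Filter.Tendsto (fun i => ‖f i‖) ω (𝓝 0)}
  zero_mem' := by simp
  add_mem' {f g} hf hg := by
    refine squeeze_zero (fun i => norm_nonneg _) (fun i => norm_add_le (f i) (g i)) ?_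
    simpa using hf.add hg
  smul_mem' f g hg := by
    refine squeeze_zero (fun i => norm_nonneg _) (fun i => (norm_mul_le (f i) (g i)).trans
      (mul_le_mul_of_nonneg_right (lp.norm_apply_le_norm ENNReal.top_ne_zero f i)
        (norm_nonneg _))) ?_
    simpa using hg.const_mul ‖f‖

instance ultrapowerIdeal.isTwoSided : (ultrapowerIdeal A ω).IsTwoSided where
  mul_mem_of_left {f} g hf := by
    refine squeeze_zero (fun i => norm_nonneg _) (fun i => (norm_mul_le (f i) (g i)).trans
      (mul_le_mul_of_nonneg_left (lp.norm_apply_le_norm ENNReal.top_ne_zero g i)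
        (norm_nonneg _))) ?_
    simpa using Filter.Tendsto.mul_const ‖g‖ hf

instance ultrapowerIdeal.isClosed :
    IsClosed (ultrapowerIdeal A ω : Set (lp (fun _ : I => A) ∞)) := by
  refine isClosed_of_closure_subset fun f hf => ?_
  change Filter.Tendsto (fun i => ‖f i‖) ω (𝓝 0)
  rw [Metric.tendsto_nhds]
  intro ε hε
  obtain ⟨g, hg, hfg⟩ := Metric.mem_closure_iff.1 hf (ε / 2) (half_pos hε)
  have hg' : Filter.Tendsto (fun i => ‖g i‖) ω (𝓝 0) := hg
  filter_upwards [hg'.eventually_lt_const (half_pos hε)] with i hi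
  have h1 : ‖f i - g i‖ ≤ ‖f - g‖ := lp.norm_apply_le_norm ENNReal.top_ne_zero (f - g) i
  rw [dist_eq_norm] at hfg
  have h2 : ‖f i‖ ≤ ‖f i - g i‖ + ‖g i‖ := by
    simpa using norm_add_le (f i - g i) (g i)
  rw [Real.dist_0_eq_abs, abs_norm]
  linarith

/-- The ultrapower `A_ω = ℓ^∞(I, A) / {f | lim_ω ‖f i‖ = 0}`. -/
abbrev CStarUltrapower : Type (max u w) := lp (fun _ : I => A) ∞ ⧸ ultrapowerIdeal A ω

end Ultrapower

/-! ### Operator systems and their maps -/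

/-- An operator system in a unital C⋆-algebra `B`: a linear subspace (not necessarily closed)
which contains the unit and is closed under the involution. -/
structure OperatorSystem (B : Type*) [CStarAlgebra B] extends Submodule ℂ B where
  one_mem : (1 : B) ∈ toSubmodule
  star_mem : ∀ x ∈ toSubmodule, star x ∈ toSubmodule

namespace OperatorSystem

universe u v w

section Maps

variable {B : Type u} [CStarAlgebra B] {X : OperatorSystem B} {A : Type v} [CStarAlgebra A]

/-- `φ` maps the unit to the unit. -/
def IsUnital (φ : X.toSubmodule →ₗ[ℂ] A) : Prop := φ ⟨1, X.one_mem⟩ = 1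

/-- `φ` is completely positive: each amplification `M_n(X) → M_n(A)` maps the elements that are
positive in `M_n(B)` to positive elements of `M_n(A)`. -/
def IsCompletelyPositive (φ : X.toSubmodule →ₗ[ℂ] A) : Prop :=
  ∀ (n : ℕ) (M : CStarMatrix (Fin n) (Fin n) X.toSubmodule),
    0 ≤ M.map (Subtype.val : X.toSubmodule → B) → 0 ≤ M.map φ

/-- Unital completely positive maps. -/
def IsUCP (φ : X.toSubmodule →ₗ[ℂ] A) : Prop := IsUnital φ ∧ IsCompletelyPositive φ

/-- `‖φ‖_k`, the norm of the amplification `M_k(X) → M_k(A)`, where `M_k(X)` carries the norm of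
the C⋆-algebra `M_k(B)`. -/
noncomputable def levelNorm (k : ℕ) (φ : X.toSubmodule →ₗ[ℂ] A) : ℝ≥0∞ :=
  ⨆ (M : CStarMatrix (Fin k) (Fin k) X.toSubmodule)
    (_ : ‖M.map (Subtype.val : X.toSubmodule → B)‖ ≤ 1), ‖M.map φ‖ₑ

/-- The completely bounded norm `sup_k ‖φ‖_k`. -/
noncomputable def cbNorm (φ : X.toSubmodule →ₗ[ℂ] A) : ℝ≥0∞ := ⨆ k : ℕ, levelNorm k φ

/-- The restriction of a linear map to a subsystem. -/
noncomputable def restrict {E : OperatorSystem B} (h : E.toSubmodule ≤ X.toSubmodule)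
    (φ : X.toSubmodule →ₗ[ℂ] A) : E.toSubmodule →ₗ[ℂ] A :=
  φ ∘ₗ Submodule.inclusion h

/-- The composition of a linear map into `A` with the quotient map `A → A ⧸ J`. -/
noncomputable def toQuotient (J : Ideal A) [J.IsTwoSided] (φ : X.toSubmodule →ₗ[ℂ] A) :
    X.toSubmodule →ₗ[ℂ] A ⧸ J :=
  (Ideal.Quotient.mkₐ ℂ J).toLinearMap ∘ₗ φ

end Maps

variable {B : Type u} [CStarAlgebra B] (X : OperatorSystem B)

/-- The local lifting property: for every u.c.p. map `φ : X → A ⧸ J` and every finite-dimensional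
subsystem `E` of `X`, the restriction of `φ` to `E` lifts to a u.c.p. map `E → A`. -/
def HasLLP : Prop :=
  ∀ (A : Type u) [CStarAlgebra A] (J : Ideal A) [J.IsTwoSided] [IsClosed (J : Set A)]
    (φ : X.toSubmodule →ₗ[ℂ] A ⧸ J), IsUCP φ →
    ∀ (E : OperatorSystem B) [FiniteDimensional ℂ E.toSubmodule]
      (hE : E.toSubmodule ≤ X.toSubmodule),
      ∃ ψ : E.toSubmodule →ₗ[ℂ] A, IsUCP ψ ∧ toQuotient J ψ = restrict hE φ

/-- The approximate local lifting property: for every u.c.p. map `φ : X → A ⧸ J`, every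
finite-dimensional subsystem `E` of `X` and every `ε > 0`, there is a linear map `ψ : E → A` with
`‖ψ‖_cb < 1 + ε` whose composition with the quotient map is within `ε` of the restriction of `φ`
to `E` in operator norm. -/
def HasALLP : Prop :=
  ∀ (A : Type u) [CStarAlgebra A] (J : Ideal A) [J.IsTwoSided] [IsClosed (J : Set A)]
    (φ : X.toSubmodule →ₗ[ℂ] A ⧸ J), IsUCP φ →
    ∀ (E : OperatorSystem B) [FiniteDimensional ℂ E.toSubmodule]
      (hE : E.toSubmodule ≤ X.toSubmodule) (ε : ℝ), 0 < ε →
      ∃ ψ : E.toSubmodule →ₗ[ℂ] A, cbNorm ψ < ENNReal.ofReal (1 + ε) ∧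
        ‖LinearMap.toContinuousLinearMap (toQuotient J ψ - restrict hE φ)‖ < ε

/-- The local ultrapower lifting property with respect to one ultrafilter `ω`: for every u.c.p.
map `φ : X → A_ω` and every finite-dimensional subsystem `E` of `X`, the restriction of `φ` to `E`
lifts to a u.c.p. map `E → ℓ^∞(A)`. (For the zero algebra the condition is void.) -/
def HasLULPAt {I : Type w} (ω : Ultrafilter I) : Prop :=
  ∀ (A : Type u) [CStarAlgebra A] [Nontrivial A]
    (φ : X.toSubmodule →ₗ[ℂ] CStarUltrapower A ω), IsUCP φ →
    ∀ (E : OperatorSystem B) [FiniteDimensional ℂ E.toSubmodule]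
      (hE : E.toSubmodule ≤ X.toSubmodule),
      ∃ ψ : E.toSubmodule →ₗ[ℂ] lp (fun _ : I => A) ∞, IsUCP ψ ∧
        toQuotient (ultrapowerIdeal A ω) ψ = restrict hE φ

/-- The local ultrapower lifting property, with respect to all ultrafilters on all index sets. -/
def HasLULP : Prop := ∀ (I : Type u) (ω : Ultrafilter I), X.HasLULPAt ω

/-- CP-stability. -/
def IsCPStable : Prop :=
  ∀ (E : OperatorSystem B) [FiniteDimensional ℂ E.toSubmodule],
    E.toSubmodule ≤ X.toSubmodule → ∀ δ : ℝ, 0 < δ →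
    ∃ (S : OperatorSystem B) (hES : E.toSubmodule ≤ S.toSubmodule) (k : ℕ) (ε : ℝ),
      FiniteDimensional ℂ S.toSubmodule ∧ S.toSubmodule ≤ X.toSubmodule ∧ 0 < k ∧ 0 < ε ∧
      ∀ (A : Type u) [CStarAlgebra A] (φ : S.toSubmodule →ₗ[ℂ] A), IsUnital φ →
        levelNorm k φ < ENNReal.ofReal (1 + ε) →
        ∃ ψ : E.toSubmodule →ₗ[ℂ] A, IsUCP ψ ∧
          ‖LinearMap.toContinuousLinearMap (restrict hES φ - ψ)‖ < δ

end OperatorSystem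

/-!
Three of the implications are formal: a unital completely positive lift is in particular a complete
contraction, and ultrapowers are quotients. What remains is that the approximate local lifting
property and CP-stability each imply the local lifting property, and that local lifting from
ultrapowers implies CP-stability.

*Approximate lifts suffice.* If the restriction of `φ` to a finite-dimensional `E` is a pointwise
limit of maps with unital completely positive lifts, then it has such a lift itself
(`exists_isUCP_lift_of_approx`). Two lifts `ψ₁`, `ψ₂` whose images in `A ⧸ J` are close are brought
close in `A`, without changing the image of `ψ₂`: replace `ψ₂` by an average of maps
`c ψ₂ c + g ψ₁ g`, where `c` is a self-adjoint contraction equal to `1` modulo `J` and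
`c² + g² = 1`. The differences `c ψ₁ c + g ψ₁ g - ψ₁` take values in `J`. If `c` is chosen small on
the previous differences, then the new one is almost orthogonal to them, so that the norm of a sum
of `N` differences grows like `√N` and the average tends to zero (`exists_sum_corrections`). A
Cauchy sequence of successively corrected lifts converges to a lift.

*Almost positive maps.* A finite-dimensional `E` has a faithful state `f` with `f(x) ≥ c ‖x‖` for
positive `x`, and positive matrices `x` over `E` with `f(x) = 1` are bounded uniformly in their
size. Normalizing by `f(x)^(-1/2)` shows that a map `R` which is positive up to `ε` at all matrix levels
becomes completely positive after adding a multiple `C ε f(·) 1`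
(`isCompletelyPositive_add_of_isNearlyPositive`). An almost completely contractive almost lift `ψ`
satisfies `ψ(1) ≈ 1` modulo `J`, hence `x ↦ c ψ(x) c` is almost positive at all levels for a
suitable cutoff `c`, and a small correction is unital completely positive
(`exists_isUCP_norm_sub_le_of_cbNorm_le`). This handles the approximate local lifting property.

For CP-stability, let `θ` be a linear, unital and Hermitian lift on the subsystem `S`. At a fixed
matrix level the positive unit ball of `S` is totally bounded, and the negative parts of the images
under `θ` of finitely many of its points have entries in `J`. So for a suitable cutoff `c` the lift
`c θ c + f(·) (1 - c²)` is almost positive at this level (`exists_isNearlyPositive_lift`), hence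
almost contractive at half of it, and CP-stability provides a nearby unital completely positive map.

*Ultrapowers.* If CP-stability fails for `E` and `δ`, then there are an ultrafilter, subsystems
`S i` containing `E` that become dense in `X` along it, and unital maps `φ i` on `S i` into algebras
`A i`, with norm at a level tending to infinity tending to `1`, none of them `δ`-close on `E` to a
unital completely positive map. Using states in the other coordinates, all the `A i` are replaced by
their product. The limit of the `φ i` is a map from `X` to the ultrapower which is unital and
completely contractive, hence completely positive, and the coordinates of a lift of its restriction
to `E` are unital completely positive maps close to `φ i` for some `i`, a contradiction. The index
set is the set of pairs of a finite subset of `X` and a level; for separable `X` it may be taken to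
be `ℕ`, with any non-principal ultrafilter.
-/

set_option linter.unusedSectionVars false

/-! ### Order and norm in C⋆-algebras -/

namespace CStarAlgebra

section Order

theorem ofReal_smul_one {A : Type*} [CStarAlgebra A] (t : ℝ) :
    (t : ℂ) • (1 : A) = algebraMap ℝ A t := by
  rw [Algebra.algebraMap_eq_smul_one, Complex.coe_smul]

theorem isSelfAdjoint_ofReal_smul {A : Type*} [CStarAlgebra A] (t : ℝ) {a : A}
    (ha : IsSelfAdjoint a) : IsSelfAdjoint ((t : ℂ) • a) := by
  rw [Complex.coe_smul]
  exact (IsSelfAdjoint.all t).smul ha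

/-- The expansion of `(v - wt)⋆(v - wt)` for `w = ± i` and real `t`. -/
theorem star_sub_smul_one_mul_self {A : Type*} [CStarAlgebra A] {w : ℂ} (hw : w * w = -1)
    (hws : star w = -w) (t : ℝ) (v : A) :
    star (v - (w * t) • 1) * (v - (w * t) • 1) =
      star v * v + (t : ℂ) • (w • v - w • star v) + ((t ^ 2 : ℝ) : ℂ) • 1 := by
  have hwt : star (w * (t : ℂ)) = -(w * t) := by
    rw [star_mul', hws, Complex.star_def, Complex.conj_ofReal, neg_mul]
  have hw2 : -(w * (t : ℂ)) * (w * t) = ((t ^ 2 : ℝ) : ℂ) := by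
    rw [show -(w * (t : ℂ)) * (w * t) = -(w * w) * t ^ 2 by ring, hw]
    push_cast
    ring
  rw [star_sub, star_smul, star_one, hwt, sub_mul, mul_sub, mul_sub, smul_mul_smul_comm, hw2,
    smul_one_mul, mul_smul_one, one_mul]
  module

variable {A : Type*} [CStarAlgebra A] [PartialOrder A] [StarOrderedRing A]

theorem exists_eq_star_mul_self {a : A} (ha : 0 ≤ a) : ∃ b : A, a = star b * b :=
  CStarAlgebra.nonneg_iff_eq_star_mul_self.1 ha

theorem ofReal_smul_nonneg {t : ℝ} (ht : 0 ≤ t) {a : A} (ha : 0 ≤ a) : 0 ≤ (t : ℂ) • a := by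
  rw [Complex.coe_smul]
  exact smul_nonneg ht ha

theorem norm_smul_one_add_nonneg {a : A} (ha : IsSelfAdjoint a) {t : ℝ} (ht : ‖a‖ ≤ t) :
    0 ≤ (t : ℂ) • (1 : A) + a := by
  have h := ha.neg.le_algebraMap_norm_self
  rw [norm_neg, ← ofReal_smul_one, ← sub_nonneg, sub_neg_eq_add] at h
  have h2 := ofReal_smul_nonneg (sub_nonneg.2 ht) (zero_le_one (α := A))
  have := add_nonneg h h2
  convert this using 1
  push_cast
  module

theorem norm_smul_one_sub_nonneg {a : A} (ha : IsSelfAdjoint a) {t : ℝ} (ht : ‖a‖ ≤ t) :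
    0 ≤ (t : ℂ) • (1 : A) - a := by
  rw [sub_eq_add_neg]
  exact norm_smul_one_add_nonneg ha.neg (by rwa [norm_neg])

theorem norm_le_of_smul_one_sub_nonneg {a : A} (ha : 0 ≤ a) {t : ℝ} (ht : 0 ≤ t)
    (h : 0 ≤ (t : ℂ) • (1 : A) - a) : ‖a‖ ≤ t := by
  rw [norm_le_iff_le_algebraMap a ht ha, ← ofReal_smul_one]
  exact sub_nonneg.1 h

theorem norm_smul_one_le {t : ℝ} (ht : 0 ≤ t) : ‖(t : ℂ) • (1 : A)‖ ≤ t :=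
  norm_le_of_smul_one_sub_nonneg (ofReal_smul_nonneg ht zero_le_one) ht (by simp)

theorem norm_le_of_sub_nonneg_of_add_nonneg {a : A} {t : ℝ} (ht : 0 ≤ t)
    (h1 : 0 ≤ (t : ℂ) • (1 : A) - a) (h2 : 0 ≤ (t : ℂ) • (1 : A) + a) : ‖a‖ ≤ t := by
  have ha : IsSelfAdjoint a := by
    have := h2.isSelfAdjoint.sub (isSelfAdjoint_ofReal_smul t (.one A))
    simpa using this
  -- `a² ≤ t²`, because `2t (t² - a²) = (t + a) (t - a) (t + a) + (t - a) (t + a) (t - a)`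
  have h3 : 0 ≤ ((2 * t * t ^ 2 : ℝ) : ℂ) • (1 : A) - ((2 * t : ℝ) : ℂ) • (star a * a) := by
    have e1 := star_left_conjugate_nonneg h1 ((t : ℂ) • 1 + a)
    have e2 := star_left_conjugate_nonneg h2 ((t : ℂ) • 1 - a)
    have := add_nonneg e1 e2
    convert this using 1
    simp only [star_add, star_sub, star_smul, star_one, ha.star_eq, mul_add, add_mul, mul_sub,
      sub_mul, smul_mul_assoc, mul_smul_comm, one_mul, mul_one, RCLike.star_def,
      Complex.conj_ofReal]
    push_cast
    module
  rcases ht.eq_or_lt with rfl | ht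
  · have : a = 0 := le_antisymm (by simpa using h1) (by simpa using h2)
    simp [this]
  · have h4 : ‖star a * a‖ ≤ t ^ 2 := by
      refine norm_le_of_smul_one_sub_nonneg (star_mul_self_nonneg a) (by positivity) ?_
      have := ofReal_smul_nonneg (t := (2 * t)⁻¹) (by positivity) h3
      convert this using 1
      rw [smul_sub, smul_smul, smul_smul, ← Complex.ofReal_mul, ← Complex.ofReal_mul,
        inv_mul_cancel₀ (by positivity), inv_mul_cancel_left₀ (by positivity),
        Complex.ofReal_one, one_smul]
    rw [CStarRing.norm_star_mul_self] at h4
    nlinarith [norm_nonneg a]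

theorem norm_le_of_sq_sub_nonneg {a : A} {t : ℝ} (ht : 0 ≤ t)
    (h : 0 ≤ ((t ^ 2 : ℝ) : ℂ) • (1 : A) - star a * a) : ‖a‖ ≤ t := by
  have h4 := norm_le_of_smul_one_sub_nonneg (star_mul_self_nonneg a) (by positivity) h
  rw [CStarRing.norm_star_mul_self] at h4
  nlinarith [norm_nonneg a]

theorem sq_sub_nonneg_of_norm_le {a : A} {t : ℝ} (h : ‖a‖ ≤ t) :
    0 ≤ ((t ^ 2 : ℝ) : ℂ) • (1 : A) - star a * a := by
  refine norm_smul_one_sub_nonneg (.star_mul_self a) ?_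
  rw [CStarRing.norm_star_mul_self]
  nlinarith [norm_nonneg a]

/-- Positivity can be tested up to arbitrarily small multiples of a fixed element. -/
theorem nonneg_of_forall_pos_smul_add {a b : A} (h : ∀ t : ℝ, 0 < t → 0 ≤ a + (t : ℂ) • b) :
    0 ≤ a := by
  have hc : Filter.Tendsto (fun t : ℝ => a + (t : ℂ) • b) (𝓝[>] 0) (𝓝 (a + ((0 : ℝ) : ℂ) • b)) :=
    (Continuous.tendsto (by fun_prop) 0).mono_left nhdsWithin_le_nhds
  simp only [Complex.ofReal_zero, zero_smul, add_zero] at hc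
  exact (isClosed_nonneg (A := A)).mem_of_tendsto hc
    (Filter.eventually_of_mem self_mem_nhdsWithin fun t ht => h t ht)

/-- The numerical range argument: if `y` is at most as far from every scalar as the positive
element `x`, then `y` is positive. Large imaginary scalars show that `y` is self-adjoint. -/
theorem nonneg_of_forall_norm_sub_le {A' : Type*} [CStarAlgebra A'] [PartialOrder A']
    [StarOrderedRing A'] {x : A'} {y : A} (hx : 0 ≤ x)
    (h : ∀ z : ℂ, ‖y - z • 1‖ ≤ ‖x - z • 1‖) : 0 ≤ y := by
  have hxs := hx.isSelfAdjoint
  set r := ‖x‖ with hr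
  -- comparing the distances to `w t` and dividing by `t` bounds `w (y - y⋆)` by `r² / t`
  have him (w : ℂ) (hw : w * w = -1) (hws : star w = -w) (t : ℝ) (ht : 0 < t) :
      0 ≤ ((r ^ 2 / t : ℝ) : ℂ) • (1 : A) - (w • y - w • star y) := by
    have h1 : ‖x - (w * t) • 1‖ ^ 2 ≤ r ^ 2 + t ^ 2 := by
      rw [sq, ← CStarRing.norm_star_mul_self, star_sub_smul_one_mul_self hw hws, hxs.star_eq,
        sub_self, smul_zero, add_zero]
      calc _ ≤ ‖x * x‖ + ‖((t ^ 2 : ℝ) : ℂ) • (1 : A')‖ := norm_add_le _ _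
        _ ≤ ‖x‖ * ‖x‖ + t ^ 2 := add_le_add (norm_mul_le _ _) (norm_smul_one_le (by positivity))
        _ = _ := by rw [hr]; ring
    have h2 : ‖y - (w * t) • 1‖ ^ 2 ≤ r ^ 2 + t ^ 2 :=
      (pow_le_pow_left₀ (norm_nonneg _) (h _) 2).trans h1
    have h3 := norm_smul_one_sub_nonneg (.star_mul_self (y - (w * t) • 1))
      (t := r ^ 2 + t ^ 2) (by rw [CStarRing.norm_star_mul_self, ← sq]; exact h2)
    have h4 := add_nonneg h3 (star_mul_self_nonneg y)
    rw [star_sub_smul_one_mul_self hw hws] at h4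
    have h5 : 0 ≤ ((r ^ 2 : ℝ) : ℂ) • (1 : A) - (t : ℂ) • (w • y - w • star y) := by
      convert h4 using 1
      push_cast
      module
    have h6 := ofReal_smul_nonneg (t := t⁻¹) (by positivity) h5
    rwa [smul_sub, smul_smul, smul_smul, ← Complex.ofReal_mul, ← Complex.ofReal_mul,
      inv_mul_cancel₀ ht.ne', Complex.ofReal_one, one_smul, inv_mul_eq_div] at h6
  have him' (w : ℂ) (hw : w * w = -1) (hws : star w = -w) : 0 ≤ -(w • y - w • star y) := by
    refine nonneg_of_forall_pos_smul_add (b := 1) fun t ht => ?_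
    have hrn : 0 ≤ r := norm_nonneg x
    have := add_nonneg (him w hw hws ((r ^ 2 + 1) / t) (by positivity))
      (ofReal_smul_nonneg (t := t * (1 / (r ^ 2 + 1))) (by positivity) (zero_le_one (α := A)))
    convert this using 1
    have ht' : t = r ^ 2 / ((r ^ 2 + 1) / t) + t * (1 / (r ^ 2 + 1)) := by
      field_simp
    conv_lhs => rw [ht', Complex.ofReal_add]
    module
  have hI := him' Complex.I (by simp) (by simp)
  have hI' := him' (-Complex.I) (by simp) (by simp)
  have hys : star y = y := by
    have : Complex.I • y - Complex.I • star y = 0 := by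
      refine le_antisymm (by simpa using hI) ?_
      convert hI' using 1
      module
    rw [← smul_sub, smul_eq_zero] at this
    exact (sub_eq_zero.1 (this.resolve_left Complex.I_ne_zero)).symm
  -- positivity of a self-adjoint element is read off from its distance to `r / 2`
  have h1 : ‖x - ((r / 2 : ℝ) : ℂ) • 1‖ ≤ r / 2 := by
    refine norm_le_of_sub_nonneg_of_add_nonneg (by positivity) ?_ ?_
    · convert norm_smul_one_sub_nonneg hxs hr.ge using 1
      push_cast
      module
    · convert hx using 1
      module
  have h2 := norm_smul_one_add_nonneg
    (show IsSelfAdjoint (y - ((r / 2 : ℝ) : ℂ) • 1) from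
      IsSelfAdjoint.sub hys (isSelfAdjoint_ofReal_smul _ (.one A))) ((h _).trans h1)
  simpa using h2

end Order

end CStarAlgebra

/-! ### Matrices over C⋆-algebras -/

namespace CStarMatrix

section Maps

variable {ι : Type*} [Fintype ι] [DecidableEq ι]
variable {A A' : Type*} [CStarAlgebra A] [CStarAlgebra A']

/-- The amplification of a unital ⋆-homomorphism to matrices. -/
def mapStarAlgHom (π : A →⋆ₐ[ℂ] A') : CStarMatrix ι ι A →⋆ₐ[ℂ] CStarMatrix ι ι A' where
  toFun M := M.map π
  map_one' := by
    ext i j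
    simp only [map_apply, one_apply]
    split_ifs <;> simp
  map_mul' M N := by
    ext i j
    simp [mul_apply]
  map_zero' := by ext; simp
  map_add' M N := by ext; simp
  commutes' r := by
    ext i j
    simp only [map_apply, algebraMap_apply]
    split_ifs
    · exact AlgHomClass.commutes π r
    · exact map_zero π
  map_star' M := by ext; simp [star_apply, map_star]

theorem map_starAlgHom_nonneg (π : A →⋆ₐ[ℂ] A') {M : CStarMatrix ι ι A} (hM : 0 ≤ M) :
    0 ≤ M.map π :=
  map_nonneg (mapStarAlgHom π) hM

theorem norm_map_starAlgHom_le (π : A →⋆ₐ[ℂ] A') (M : CStarMatrix ι ι A) : ‖M.map π‖ ≤ ‖M‖ :=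
  NonUnitalStarAlgHom.norm_apply_le (mapStarAlgHom π) M

variable (ι) in
/-- The diagonal matrix with all diagonal entries equal to `c`. -/
def diag (c : A) : CStarMatrix ι ι A := ofMatrix (Matrix.diagonal fun _ => c)

theorem diag_apply (c : A) (i j : ι) : diag ι c i j = if i = j then c else 0 :=
  Matrix.diagonal_apply ..

theorem diag_mul_apply (c : A) (M : CStarMatrix ι ι A) (i j : ι) :
    (diag ι c * M) i j = c * M i j := by
  simp [mul_apply, diag_apply]

theorem mul_diag_apply (c : A) (M : CStarMatrix ι ι A) (i j : ι) :
    (M * diag ι c) i j = M i j * c := by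
  simp [mul_apply, diag_apply]

theorem star_diag (c : A) : star (diag ι c) = diag ι (star c) := by
  ext i j
  simp only [star_apply, diag_apply, eq_comm]
  split_ifs <;> simp

theorem diag_one : diag ι (1 : A) = 1 := rfl

theorem diag_mul (c d : A) : diag ι (c * d) = diag ι c * diag ι d := by
  ext i j
  rw [diag_mul_apply, diag_apply, diag_apply, mul_ite, mul_zero]

theorem diag_add (c d : A) : diag ι (c + d) = diag ι c + diag ι d := by
  ext i j
  simp only [diag_apply, add_apply]
  split_ifs <;> simp

theorem diag_sub (c d : A) : diag ι (c - d) = diag ι c - diag ι d := by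
  ext i j
  simp only [diag_apply, sub_apply]
  split_ifs <;> simp

/-- The diagonal embedding `A → M_ι(A)`. -/
def diagStarAlgHom : A →⋆ₐ[ℂ] CStarMatrix ι ι A where
  toFun := diag ι
  map_one' := diag_one
  map_mul' := diag_mul
  map_zero' := by ext i j; simp [diag_apply]
  map_add' := diag_add
  commutes' r := by
    ext i j
    simp only [diag_apply, algebraMap_apply]
  map_star' c := (star_diag c).symm

theorem diag_nonneg {c : A} (hc : 0 ≤ c) : 0 ≤ diag ι c := map_nonneg (diagStarAlgHom (ι := ι)) hc

theorem norm_diag_le (c : A) : ‖diag ι c‖ ≤ ‖c‖ :=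
  NonUnitalStarAlgHom.norm_apply_le (diagStarAlgHom (ι := ι)) c

end Maps

section Blocks

variable {n m : ℕ}

/-- The matrix with blocks `a`, `b`, `c`, `d`, as a matrix indexed by `Fin (n + m)`. -/
def block {X : Type*} (a : CStarMatrix (Fin n) (Fin n) X) (b : CStarMatrix (Fin n) (Fin m) X)
    (c : CStarMatrix (Fin m) (Fin n) X) (d : CStarMatrix (Fin m) (Fin m) X) :
    CStarMatrix (Fin (n + m)) (Fin (n + m)) X :=
  ofMatrix (Matrix.of fun i j => Fin.addCases (fun i => Fin.addCases (a i) (b i) j)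
    (fun i => Fin.addCases (c i) (d i) j) i)

variable {X Y : Type*}
  (a a' : CStarMatrix (Fin n) (Fin n) X) (b b' : CStarMatrix (Fin n) (Fin m) X)
  (c c' : CStarMatrix (Fin m) (Fin n) X) (d d' : CStarMatrix (Fin m) (Fin m) X)

@[simp]
theorem block_castAdd_castAdd (i j : Fin n) :
    block a b c d (Fin.castAdd m i) (Fin.castAdd m j) = a i j := by
  simp [block]

@[simp]
theorem block_castAdd_natAdd (i : Fin n) (j : Fin m) :
    block a b c d (Fin.castAdd m i) (Fin.natAdd n j) = b i j := by
  simp [block]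

@[simp]
theorem block_natAdd_castAdd (i : Fin m) (j : Fin n) :
    block a b c d (Fin.natAdd n i) (Fin.castAdd m j) = c i j := by
  simp [block]

@[simp]
theorem block_natAdd_natAdd (i j : Fin m) :
    block a b c d (Fin.natAdd n i) (Fin.natAdd n j) = d i j := by
  simp [block]

theorem ext_block {M N : CStarMatrix (Fin (n + m)) (Fin (n + m)) X}
    (h1 : ∀ i j, M (Fin.castAdd m i) (Fin.castAdd m j) = N (Fin.castAdd m i) (Fin.castAdd m j))
    (h2 : ∀ i j, M (Fin.castAdd m i) (Fin.natAdd n j) = N (Fin.castAdd m i) (Fin.natAdd n j))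
    (h3 : ∀ i j, M (Fin.natAdd n i) (Fin.castAdd m j) = N (Fin.natAdd n i) (Fin.castAdd m j))
    (h4 : ∀ i j, M (Fin.natAdd n i) (Fin.natAdd n j) = N (Fin.natAdd n i) (Fin.natAdd n j)) :
    M = N := by
  ext i j
  exact Fin.addCases (fun i => Fin.addCases (h1 i) (h2 i) j)
    (fun i => Fin.addCases (h3 i) (h4 i) j) i

theorem block_map (f : X → Y) :
    (block a b c d).map f = block (a.map f) (b.map f) (c.map f) (d.map f) := by
  refine ext_block (fun i j => ?_) (fun i j => ?_) (fun i j => ?_) (fun i j => ?_) <;> simp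

theorem block_add [Add X] :
    block a b c d + block a' b' c' d' = block (a + a') (b + b') (c + c') (d + d') := by
  refine ext_block (fun i j => ?_) (fun i j => ?_) (fun i j => ?_) (fun i j => ?_) <;> simp

theorem block_sub [Sub X] :
    block a b c d - block a' b' c' d' = block (a - a') (b - b') (c - c') (d - d') := by
  refine ext_block (fun i j => ?_) (fun i j => ?_) (fun i j => ?_) (fun i j => ?_) <;> simp

theorem smul_block {R : Type*} [SMul R X] (r : R) :
    r • block a b c d = block (r • a) (r • b) (r • c) (r • d) := by
  refine ext_block (fun i j => ?_) (fun i j => ?_) (fun i j => ?_) (fun i j => ?_) <;> simp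

theorem block_one [Zero X] [One X] : block 1 0 0 1 = (1 : CStarMatrix (Fin (n + m)) _ X) := by
  refine ext_block (fun i j => ?_) (fun i j => ?_) (fun i j => ?_) (fun i j => ?_) <;>
    simp [one_apply, Fin.ext_iff] <;> omega

theorem star_block [Star X] :
    star (block a b c d) = block (star a) c.conjTranspose b.conjTranspose (star d) := by
  refine ext_block (fun i j => ?_) (fun i j => ?_) (fun i j => ?_) (fun i j => ?_) <;>
    simp [star_apply]

theorem block_mul [NonUnitalNonAssocSemiring X] :
    block a b c d * block a' b' c' d' =
      block (a * a' + b * c') (a * b' + b * d') (c * a' + d * c') (c * b' + d * d') := by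
  refine ext_block (fun i j => ?_) (fun i j => ?_) (fun i j => ?_) (fun i j => ?_) <;>
    simp [mul_apply, Fin.sum_univ_add]

theorem block_injective
    (h : block a b c d = block a' b' c' d') : a = a' ∧ b = b' ∧ c = c' ∧ d = d' := by
  refine ⟨?_, ?_, ?_, ?_⟩ <;> ext i j
  · simpa using congr($h (Fin.castAdd m i) (Fin.castAdd m j))
  · simpa using congr($h (Fin.castAdd m i) (Fin.natAdd n j))
  · simpa using congr($h (Fin.natAdd n i) (Fin.castAdd m j))
  · simpa using congr($h (Fin.natAdd n i) (Fin.natAdd n j))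

theorem exists_eq_block (M : CStarMatrix (Fin (n + m)) (Fin (n + m)) X) :
    ∃ a b c d, M = block (n := n) (m := m) a b c d := by
  refine ⟨ofMatrix (.of fun i j => M (Fin.castAdd m i) (Fin.castAdd m j)),
    ofMatrix (.of fun i j => M (Fin.castAdd m i) (Fin.natAdd n j)),
    ofMatrix (.of fun i j => M (Fin.natAdd n i) (Fin.castAdd m j)),
    ofMatrix (.of fun i j => M (Fin.natAdd n i) (Fin.natAdd n j)),
    ext_block (fun i j => ?_) (fun i j => ?_) (fun i j => ?_) (fun i j => ?_)⟩ <;> simp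

end Blocks

section BlockOrder

variable {n m : ℕ} {A : Type*} [CStarAlgebra A]

/-- The corner embedding `M_n(A) → M_{n+m}(A)`. -/
noncomputable def cornerStarHom : CStarMatrix (Fin n) (Fin n) A →⋆ₙₐ[ℂ]
    CStarMatrix (Fin (n + m)) (Fin (n + m)) A where
  toFun a := block a 0 0 0
  map_smul' r a := by simp [smul_block]
  map_zero' := by
    have := smul_block (0 : CStarMatrix (Fin n) (Fin n) A) 0 0 (0 : CStarMatrix (Fin m) _ A) (0 : ℂ)
    simpa using this.symm
  map_add' a b := by simp [block_add]
  map_mul' a b := by simp [block_mul]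
  map_star' a := by
    rw [star_block, star_zero]
    congr 1 <;> ext <;> simp

theorem norm_block_corner (a : CStarMatrix (Fin n) (Fin n) A) :
    ‖block a 0 0 (0 : CStarMatrix (Fin m) (Fin m) A)‖ = ‖a‖ :=
  NonUnitalStarAlgHom.norm_map (cornerStarHom (n := n) (m := m) (A := A))
    (fun _ _ h => (block_injective _ _ _ _ _ _ _ _ h).1) a

theorem norm_map_block_corner {X : Type*} [Zero X] {f : X → A} (hf : f 0 = 0)
    (M : CStarMatrix (Fin n) (Fin n) X) :
    ‖(block M 0 0 (0 : CStarMatrix (Fin m) (Fin m) X)).map f‖ = ‖M.map f‖ := by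
  rw [block_map, ← norm_block_corner (m := m) (M.map f)]
  congr 2 <;> ext <;> simp [hf]

variable {k : ℕ}

/-- The matrix `[1, x; x⋆, 1]` is the square of `[1, x; 0, q]`, where `q⋆q = 1 - x⋆x`. -/
theorem block_nonneg_of_norm_le {x : CStarMatrix (Fin k) (Fin k) A} (hx : ‖x‖ ≤ 1) :
    0 ≤ block 1 x (star x) 1 := by
  have h := CStarAlgebra.sq_sub_nonneg_of_norm_le hx
  rw [one_pow, Complex.ofReal_one, one_smul] at h
  obtain ⟨q, hq⟩ := CStarAlgebra.exists_eq_star_mul_self h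
  have : block 1 x (star x) 1 = star (block 1 x 0 q) * block 1 x 0 q := by
    rw [star_block, block_mul]
    simp only [← star_eq_conjTranspose, star_one, star_zero, one_mul, mul_zero, add_zero,
      mul_one, CStarMatrix.zero_mul, ← hq, add_sub_cancel]
  rw [this]
  exact star_mul_self_nonneg _

/-- `2 - [1, x; x⋆, 1] = [1, -x; -x⋆, 1]` is positive. -/
theorem norm_block_le_two {x : CStarMatrix (Fin k) (Fin k) A} (hx : ‖x‖ ≤ 1) :
    ‖block 1 x (star x) 1‖ ≤ 2 := by
  refine CStarAlgebra.norm_le_of_smul_one_sub_nonneg (block_nonneg_of_norm_le hx) (by norm_num) ?_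
  have := block_nonneg_of_norm_le (x := -x) (by rwa [norm_neg])
  convert this using 1
  rw [← block_one, smul_block, block_sub, star_neg]
  simp only [smul_zero, zero_sub]
  congr 1 <;> · push_cast; module

theorem norm_le_of_block_nonneg {y : CStarMatrix (Fin k) (Fin k) A} {t : ℝ} (ht : 0 < t)
    (h : 0 ≤ block ((t : ℂ) • 1) y (star y) ((t : ℂ) • 1)) : ‖y‖ ≤ t := by
  -- conjugate with the column `(-y, t)`
  have h1 := star_left_conjugate_nonneg h (block 0 (-y) 0 ((t : ℂ) • 1))
  obtain ⟨N, hN⟩ := CStarAlgebra.exists_eq_star_mul_self h1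
  obtain ⟨p, q, r, s, rfl⟩ := exists_eq_block (n := k) (m := k) N
  rw [star_block, star_block, block_mul, block_mul, block_mul] at hN
  have h2 := (block_injective _ _ _ _ _ _ _ _ hN).2.2.2
  simp only [← star_eq_conjTranspose] at h2
  have h3 : 0 ≤ star q * q + star s * s :=
    add_nonneg (star_mul_self_nonneg _) (star_mul_self_nonneg _)
  rw [← h2] at h3
  refine CStarAlgebra.norm_le_of_sq_sub_nonneg ht.le ?_
  have e : (star (-y) * (t : ℂ) • 1 + star ((t : ℂ) • 1) * star y) * -y +
      (star (-y) * y + star ((t : ℂ) • 1) * (t : ℂ) • 1) * (t : ℂ) • 1 =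
      (t : ℂ) • (((t ^ 2 : ℝ) : ℂ) • 1 - star y * y) := by
    have ht : star ((t : ℂ) • (1 : CStarMatrix (Fin k) (Fin k) A)) = (t : ℂ) • 1 := by
      rw [star_smul, star_one, Complex.star_def, Complex.conj_ofReal]
    rw [ht, mul_smul_one, smul_one_mul, mul_smul_one, mul_smul_one, star_neg, smul_neg,
      neg_add_cancel, CStarMatrix.zero_mul, zero_add]
    push_cast
    rw [neg_mul, smul_smul, ← sq, neg_add_eq_sub]
  rw [e] at h3
  have h4 := CStarAlgebra.ofReal_smul_nonneg (t := t⁻¹) (by positivity) h3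
  rwa [smul_smul, ← Complex.ofReal_mul, inv_mul_cancel₀ ht.ne', Complex.ofReal_one,
    one_smul] at h4

end BlockOrder

end CStarMatrix

/-! ### Positivity and norms of maps on operator systems -/

namespace CStarMatrix

variable {ι : Type*} [Fintype ι] [DecidableEq ι] {A : Type*} [CStarAlgebra A]

theorem apply_self_nonneg {M : CStarMatrix ι ι A} (hM : 0 ≤ M) (i : ι) : 0 ≤ M i i := by
  obtain ⟨N, rfl⟩ := CStarAlgebra.exists_eq_star_mul_self hM
  rw [mul_apply]
  exact Finset.sum_nonneg fun k _ => by
    rw [star_apply]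
    exact star_mul_self_nonneg _

end CStarMatrix

namespace OperatorSystem

universe u v w

section Basic

variable {B : Type u} [CStarAlgebra B] (X : OperatorSystem B)

instance : One X.toSubmodule := ⟨⟨1, X.one_mem⟩⟩

instance : StarAddMonoid X.toSubmodule where
  star x := ⟨star (x : B), X.star_mem _ x.2⟩
  star_involutive x := Subtype.ext (star_star (x : B))
  star_add x y := Subtype.ext (star_add (x : B) y)

instance : StarModule ℂ X.toSubmodule where
  star_smul z x := Subtype.ext (star_smul z (x : B))

@[simp]
theorem coe_star (x : X.toSubmodule) : ((star x : X.toSubmodule) : B) = star (x : B) := rfl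

variable {X} {A : Type v} [CStarAlgebra A]

/-- A linear map on an operator system is Hermitian if it commutes with the involution. -/
def IsHermitianMap (φ : X.toSubmodule →ₗ[ℂ] A) : Prop := ∀ x, φ (star x) = star (φ x)

variable {ι : Type*} {φ : X.toSubmodule →ₗ[ℂ] A}

section MapLemmas

variable (φ) (M N : CStarMatrix ι ι X.toSubmodule)

theorem map_add_matrix : (M + N).map φ = M.map φ + N.map φ := by ext; simp

theorem map_sub_matrix : (M - N).map φ = M.map φ - N.map φ := by ext; simp

theorem map_smul_matrix (z : ℂ) : (z • M).map φ = z • M.map φ := by ext; simp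

theorem map_val_add :
    (M + N).map (Subtype.val : X.toSubmodule → B) = M.map Subtype.val + N.map Subtype.val := by
  ext; simp

theorem map_val_sub :
    (M - N).map (Subtype.val : X.toSubmodule → B) = M.map Subtype.val - N.map Subtype.val := by
  ext; simp

theorem map_val_smul (z : ℂ) :
    (z • M).map (Subtype.val : X.toSubmodule → B) = z • M.map Subtype.val := by
  ext; simp

theorem map_val_star :
    (star M).map (Subtype.val : X.toSubmodule → B) = star (M.map Subtype.val) := by
  ext; simp [CStarMatrix.star_apply]

theorem map_val_one [DecidableEq ι] :
    (1 : CStarMatrix ι ι X.toSubmodule).map (Subtype.val : X.toSubmodule → B) = 1 := by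
  ext i j
  simp only [CStarMatrix.map_apply, CStarMatrix.one_apply]
  split_ifs <;> rfl

variable {φ}

theorem IsUnital.map_one_matrix [DecidableEq ι] (hφ : IsUnital φ) :
    (1 : CStarMatrix ι ι X.toSubmodule).map φ = 1 := by
  ext i j
  simp only [CStarMatrix.map_apply, CStarMatrix.one_apply]
  split_ifs
  · exact hφ
  · exact map_zero φ

theorem IsHermitianMap.map_star_matrix (hφ : IsHermitianMap φ) :
    (star M).map φ = star (M.map φ) := by
  ext i j
  simp [CStarMatrix.star_apply, hφ _]

end MapLemmas

theorem isSelfAdjoint_of_map_val {M : CStarMatrix ι ι X.toSubmodule}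
    (h : IsSelfAdjoint (M.map (Subtype.val : X.toSubmodule → B))) : star M = M := by
  refine CStarMatrix.map_injective Subtype.val_injective ?_
  exact (map_val_star M).trans h

theorem IsCompletelyPositive.apply_nonneg (hφ : IsCompletelyPositive φ) {x : X.toSubmodule}
    (hx : 0 ≤ (x : B)) : 0 ≤ φ x := by
  have h := hφ 1 (CStarMatrix.ofMatrix (.of fun _ _ => x)) (by
    convert CStarMatrix.diag_nonneg (ι := Fin 1) hx using 1
    ext i j
    simp [CStarMatrix.diag_apply, Subsingleton.elim i j])
  exact CStarMatrix.apply_self_nonneg h 0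

/-- Hermitian elements of an operator system are differences `(‖x‖ + x) - ‖x‖` of positive ones. -/
theorem IsCompletelyPositive.isHermitianMap (hφ : IsCompletelyPositive φ) :
    IsHermitianMap φ := by
  have key (x : X.toSubmodule) (hx : star x = x) : star (φ x) = φ x := by
    have hxs : IsSelfAdjoint (x : B) := congrArg Subtype.val hx
    have h1 := (hφ.apply_nonneg (x := ((‖(x : B)‖ : ℝ) : ℂ) • 1 + x)
      (CStarAlgebra.norm_smul_one_add_nonneg hxs le_rfl)).isSelfAdjoint
    have h2 := (hφ.apply_nonneg (x := ((‖(x : B)‖ : ℝ) : ℂ) • 1)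
      (CStarAlgebra.ofReal_smul_nonneg (norm_nonneg _) zero_le_one)).isSelfAdjoint
    have h3 := h1.sub h2
    rwa [← map_sub, add_sub_cancel_left] at h3
  intro x
  have h1 := key (x + star x) (by simp [add_comm])
  have h2 := key (Complex.I • (x - star x)) (by
    rw [star_smul, star_sub, star_star, Complex.star_def, Complex.conj_I]; module)
  rw [map_smul, star_smul, Complex.star_def, Complex.conj_I, neg_smul, ← smul_neg] at h2
  have h2' := smul_right_injective _ Complex.I_ne_zero h2
  simp only [map_add, map_sub, star_add, star_sub, neg_sub] at h1 h2'
  have h3 : star (φ x) + star (φ x) = φ (star x) + φ (star x) := by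
    have h4 : star (φ x) = φ x + φ (star x) - star (φ (star x)) := by
      rw [← h1]; abel
    have h5 : star (φ x) = star (φ (star x)) - (φ x - φ (star x)) := by
      rw [← h2']; abel
    nth_rewrite 1 [h4]
    rw [h5]
    abel
  rw [← two_smul ℂ, ← two_smul ℂ (φ (star x))] at h3
  exact (smul_right_injective _ two_ne_zero h3).symm

end Basic

section LevelNorm

variable {B : Type u} [CStarAlgebra B] {X : OperatorSystem B} {A : Type v} [CStarAlgebra A]
variable {φ : X.toSubmodule →ₗ[ℂ] A}

theorem levelNorm_le {k : ℕ} {C : ℝ} (h : ∀ M : CStarMatrix (Fin k) (Fin k) X.toSubmodule,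
    ‖M.map (Subtype.val : X.toSubmodule → B)‖ ≤ 1 → ‖M.map φ‖ ≤ C) :
    levelNorm k φ ≤ ENNReal.ofReal C := by
  refine iSup₂_le fun M hM => ?_
  rw [← ofReal_norm]
  exact ENNReal.ofReal_le_ofReal (h M hM)

theorem norm_map_le_of_levelNorm_le {k : ℕ} {C : ℝ} (hC : 0 ≤ C)
    (h : levelNorm k φ ≤ ENNReal.ofReal C) (M : CStarMatrix (Fin k) (Fin k) X.toSubmodule) :
    ‖M.map φ‖ ≤ C * ‖M.map (Subtype.val : X.toSubmodule → B)‖ := by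
  have h1 (M : CStarMatrix (Fin k) (Fin k) X.toSubmodule)
      (hM : ‖M.map (Subtype.val : X.toSubmodule → B)‖ ≤ 1) : ‖M.map φ‖ ≤ C := by
    have := (le_iSup₂_of_le (f := fun (M : CStarMatrix (Fin k) (Fin k) X.toSubmodule)
      (_ : ‖M.map (Subtype.val : X.toSubmodule → B)‖ ≤ 1) => ‖M.map φ‖ₑ) M hM le_rfl).trans h
    rwa [← ofReal_norm, ENNReal.ofReal_le_ofReal_iff hC] at this
  rcases eq_or_ne (M.map (Subtype.val : X.toSubmodule → B)) 0 with h0 | h0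
  · have : M = 0 := CStarMatrix.map_injective Subtype.val_injective (h0.trans (by ext; simp))
    subst this
    have : (0 : CStarMatrix (Fin k) (Fin k) X.toSubmodule).map φ = 0 := by ext; simp
    rw [this, h0]
    simp
  · have hp := norm_pos_iff.2 h0
    set r := ‖M.map (Subtype.val : X.toSubmodule → B)‖ with hr
    have h2 := h1 ((r⁻¹ : ℂ) • M) (by
      rw [map_val_smul, norm_smul, norm_inv, Complex.norm_real, Real.norm_of_nonneg hp.le, ← hr,
        inv_mul_cancel₀ hp.ne'])
    rw [map_smul_matrix, norm_smul, norm_inv, Complex.norm_real, Real.norm_of_nonneg hp.le,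
      inv_mul_le_iff₀ hp] at h2
    linarith

/-- Matrices of size `k` are corners of matrices of size `l`. -/
theorem levelNorm_mono {k l : ℕ} (h : k ≤ l) : levelNorm k φ ≤ levelNorm l φ := by
  obtain ⟨m, rfl⟩ := Nat.exists_eq_add_of_le h
  refine iSup₂_le fun M hM => ?_
  set P := CStarMatrix.block M 0 0 (0 : CStarMatrix (Fin m) (Fin m) X.toSubmodule)
  have h1 : ‖P.map (Subtype.val : X.toSubmodule → B)‖ = ‖M.map (Subtype.val : _ → B)‖ :=
    CStarMatrix.norm_map_block_corner rfl M
  have h2 : ‖P.map φ‖ = ‖M.map φ‖ := CStarMatrix.norm_map_block_corner (map_zero φ) M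
  rw [← ofReal_norm, ← h2, ofReal_norm]
  exact le_iSup₂_of_le (f := fun (M : CStarMatrix (Fin (k + m)) (Fin (k + m)) X.toSubmodule)
    (_ : ‖M.map (Subtype.val : X.toSubmodule → B)‖ ≤ 1) => ‖M.map φ‖ₑ) P (h1.trans_le hM) le_rfl

/-- `R` is positive up to `ε` at the matrix level `n`. -/
def IsNearlyPositive (n : ℕ) (ε : ℝ) (R : X.toSubmodule →ₗ[ℂ] A) : Prop :=
  ∀ M : CStarMatrix (Fin n) (Fin n) X.toSubmodule,
    0 ≤ M.map (Subtype.val : X.toSubmodule → B) →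
    ‖M.map (Subtype.val : X.toSubmodule → B)‖ ≤ 1 → 0 ≤ (ε : ℂ) • 1 + M.map R

/-- Applying near positivity to `[1, x; x⋆, 1]`, which is positive with norm at most `2`. -/
theorem IsNearlyPositive.levelNorm_le {k : ℕ} {ε : ℝ} (hε : 0 ≤ ε) (hu : IsUnital φ)
    (hh : IsHermitianMap φ) (h : IsNearlyPositive (k + k) ε φ) :
    levelNorm k φ ≤ ENNReal.ofReal (1 + 2 * ε) := by
  refine OperatorSystem.levelNorm_le fun M hM => ?_
  set P : CStarMatrix (Fin (k + k)) (Fin (k + k)) X.toSubmodule :=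
    CStarMatrix.block 1 M (star M) 1
  have hP : P.map (Subtype.val : X.toSubmodule → B) =
      CStarMatrix.block 1 (M.map Subtype.val) (star (M.map Subtype.val)) 1 := by
    rw [CStarMatrix.block_map, map_val_one, map_val_star]
  have hφP : P.map φ = CStarMatrix.block 1 (M.map φ) (star (M.map φ)) 1 := by
    rw [CStarMatrix.block_map, hu.map_one_matrix, hh.map_star_matrix]
  have h1 := h (((2⁻¹ : ℝ) : ℂ) • P)
    (by
      rw [map_val_smul, hP]
      exact CStarAlgebra.ofReal_smul_nonneg (by norm_num) (CStarMatrix.block_nonneg_of_norm_le hM))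
    (by
      rw [map_val_smul, hP, norm_smul, Complex.norm_real, Real.norm_of_nonneg (by norm_num)]
      linarith [CStarMatrix.norm_block_le_two hM])
  refine CStarMatrix.norm_le_of_block_nonneg (by positivity) ?_
  have h2 := CStarAlgebra.ofReal_smul_nonneg (t := 2) (by norm_num) h1
  convert h2 using 1
  rw [map_smul_matrix, hφP, ← CStarMatrix.block_one, smul_add, smul_smul, smul_smul,
    CStarMatrix.smul_block, CStarMatrix.smul_block, CStarMatrix.block_add]
  congr 1
  · push_cast; module
  · push_cast; module
  · push_cast; module
  · push_cast; module

theorem IsUCP.levelNorm_le_one (h : IsUCP φ) (k : ℕ) : levelNorm k φ ≤ 1 := by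
  have := IsNearlyPositive.levelNorm_le (k := k) le_rfl h.1 h.2.isHermitianMap
    (fun M hM _ => by simpa using h.2 _ M hM)
  simpa using this

theorem IsUCP.cbNorm_le_one (h : IsUCP φ) : cbNorm φ ≤ 1 := iSup_le h.levelNorm_le_one

/-- Unital complete contractions are completely positive, since they do not increase the distances
to the scalars. -/
theorem isUCP_of_norm_map_le (hu : IsUnital φ)
    (h : ∀ (k : ℕ) (M : CStarMatrix (Fin k) (Fin k) X.toSubmodule),
      ‖M.map φ‖ ≤ ‖M.map (Subtype.val : X.toSubmodule → B)‖) : IsUCP φ := by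
  refine ⟨hu, fun n M hM => CStarAlgebra.nonneg_of_forall_norm_sub_le hM fun z => ?_⟩
  have := h n (M - z • 1)
  rwa [map_sub_matrix, map_smul_matrix, hu.map_one_matrix, map_val_sub, map_val_smul,
    map_val_one] at this

/-- The norm at any positive matrix level dominates the norm of the map itself. -/
theorem norm_apply_le_of_levelNorm_le {k : ℕ} (hk : 0 < k) {C : ℝ} (hC : 0 ≤ C)
    (h : levelNorm k φ ≤ ENNReal.ofReal C) (x : X.toSubmodule) : ‖φ x‖ ≤ C * ‖x‖ := by
  have h1 := norm_map_le_of_levelNorm_le hC ((levelNorm_mono hk).trans h)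
    (CStarMatrix.ofMatrix (.of fun _ _ => x))
  have h2 : (CStarMatrix.ofMatrix (.of fun _ _ => x)).map (Subtype.val : X.toSubmodule → B) =
      CStarMatrix.diag (Fin 1) (x : B) := by
    ext i j
    simp [CStarMatrix.diag_apply, Subsingleton.elim i j]
  rw [h2] at h1
  refine le_trans ?_ (h1.trans (mul_le_mul_of_nonneg_left (CStarMatrix.norm_diag_le _) hC))
  exact CStarMatrix.norm_entry_le_norm (i := (0 : Fin 1)) (j := 0)
    (M := (CStarMatrix.ofMatrix (.of fun _ _ => x)).map φ)

end LevelNorm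

end OperatorSystem

/-! ### Positive functionals -/

open scoped ComplexOrder MatrixOrder in
theorem Matrix.exists_eq_conjTranspose_mul_self {n : Type*} [Fintype n] [DecidableEq n]
    {G : Matrix n n ℂ} (hG : G.IsHermitian) (h : ∀ v, 0 ≤ (star v ⬝ᵥ (G.mulVec v)).re) :
    ∃ N : Matrix n n ℂ, G = N.conjTranspose * N := by
  have hp : @Matrix.PosSemidef n ℂ _ Complex.partialOrder _ G := by
    refine Matrix.PosSemidef.of_dotProduct_mulVec_nonneg hG fun v => ?_
    rw [Complex.le_def]
    refine ⟨h v, ?_⟩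
    have : star (star v ⬝ᵥ (G.mulVec v)) = star v ⬝ᵥ (G.mulVec v) := by
      rw [← Matrix.star_dotProduct_star, star_star, Matrix.star_mulVec, hG.eq,
        ← Matrix.dotProduct_mulVec]
    have h2 := Complex.conj_eq_iff_im.1 this
    rw [h2]
    rfl
  exact CStarAlgebra.nonneg_iff_eq_star_mul_self.mp hp.nonneg

/-- An element `a ≥ η > 0` has an invertible square root. -/
theorem CStarAlgebra.exists_isSelfAdjoint_inverse_sqrt {A : Type*} [CStarAlgebra A]
    [PartialOrder A] [StarOrderedRing A] {a : A} {η : ℝ} (hη : 0 < η)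
    (h : 0 ≤ a - (η : ℂ) • 1) :
    ∃ d e : A, IsSelfAdjoint d ∧ IsSelfAdjoint e ∧ e * d = 1 ∧ d * e = 1 ∧ e * e = a := by
  have ha : 0 ≤ a := by
    simpa using add_nonneg h (ofReal_smul_nonneg hη.le (zero_le_one (α := A)))
  have hu : IsUnit a := by
    refine CStarAlgebra.isUnit_of_le ((η : ℂ) • 1 : A) (sub_nonneg.1 h) ?_
    rw [ofReal_smul_one]
    exact IsStrictlyPositive.iff_of_unital.2 ⟨by
      rw [← ofReal_smul_one]; exact ofReal_smul_nonneg hη.le zero_le_one,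
      (IsUnit.mk0 η hη.ne').map _⟩
  have he : CFC.sqrt a * CFC.sqrt a = a := CFC.sqrt_mul_sqrt_self a ha
  have hes : IsSelfAdjoint (CFC.sqrt a) := (CFC.sqrt_nonneg a).isSelfAdjoint
  obtain ⟨u, hu'⟩ : IsUnit (CFC.sqrt a) := by
    have : Commute (CFC.sqrt a) (CFC.sqrt a) := Commute.refl _
    exact (this.isUnit_mul_iff.1 (he.symm ▸ hu)).1
  refine ⟨↑u⁻¹, CFC.sqrt a, ?_, hes, ?_, ?_, he⟩
  · rw [IsSelfAdjoint, ← Units.coe_star, star_inv]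
    congr 2
    ext
    rw [Units.coe_star, hu', hes.star_eq]
  · rw [← hu', Units.mul_inv]
  · rw [← hu', Units.inv_mul]

namespace OperatorSystem

universe u v w

section Functionals

variable {B : Type u} [CStarAlgebra B] {X : OperatorSystem B} {A : Type v} [CStarAlgebra A]

/-- The Hermitian part `x ↦ (ψ(x) + ψ(x⋆)⋆) / 2` of a linear map. -/
noncomputable def hermitianPart (ψ : X.toSubmodule →ₗ[ℂ] A) : X.toSubmodule →ₗ[ℂ] A where
  toFun x := (2⁻¹ : ℂ) • (ψ x + star (ψ (star x)))
  map_add' x y := by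
    simp only [star_add, map_add]
    module
  map_smul' z x := by
    simp only [star_smul, map_smul, Complex.star_def, RingHomCompTriple.comp_apply,
      RingHom.id_apply]
    module

theorem hermitianPart_apply (ψ : X.toSubmodule →ₗ[ℂ] A) (x : X.toSubmodule) :
    hermitianPart ψ x = (2⁻¹ : ℂ) • (ψ x + star (ψ (star x))) := rfl

theorem isHermitianMap_hermitianPart (ψ : X.toSubmodule →ₗ[ℂ] A) :
    IsHermitianMap (hermitianPart ψ) := by
  intro x
  simp [hermitianPart_apply, add_comm]

theorem map_hermitianPart {ι : Type*} (ψ : X.toSubmodule →ₗ[ℂ] A)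
    {M : CStarMatrix ι ι X.toSubmodule} (hM : star M = M) :
    M.map (hermitianPart ψ) = (2⁻¹ : ℂ) • (M.map ψ + star (M.map ψ)) := by
  ext i j
  have : star (M i j) = M j i := by
    rw [← CStarMatrix.star_apply, hM]
  simp [hermitianPart_apply, CStarMatrix.star_apply, this]

/-- A positive linear functional on an operator system. -/
structure IsPositiveFunctional (f : X.toSubmodule →ₗ[ℂ] ℂ) : Prop where
  hermitian : IsHermitianMap f
  nonneg : ∀ x : X.toSubmodule, 0 ≤ (x : B) → 0 ≤ (f x).re

/-- The matrices `(f(x i j))` are positive semidefinite because `∑ v̄ i v j x i j` is positive. -/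
theorem IsPositiveFunctional.exists_eq_conjTranspose_mul {f : X.toSubmodule →ₗ[ℂ] ℂ}
    (hf : IsPositiveFunctional f) {n : ℕ} {M : CStarMatrix (Fin n) (Fin n) X.toSubmodule}
    (hM : 0 ≤ M.map (Subtype.val : X.toSubmodule → B)) :
    ∃ N : Matrix (Fin n) (Fin n) ℂ, ∀ i j, f (M i j) = ∑ k, star (N k i) * N k j := by
  set G : Matrix (Fin n) (Fin n) ℂ := Matrix.of fun i j => f (M i j) with hGdef
  have hMs : star M = M := isSelfAdjoint_of_map_val hM.isSelfAdjoint
  have hG : G.IsHermitian := by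
    ext i j
    simp only [hGdef, Matrix.conjTranspose_apply, Matrix.of_apply]
    rw [← hf.hermitian, ← CStarMatrix.star_apply, hMs]
  obtain ⟨N, hN⟩ := Matrix.exists_eq_conjTranspose_mul_self hG (by
    intro v
    have h1 : star v ⬝ᵥ G.mulVec v = f (∑ i, ∑ j, (star (v i) * v j) • M i j) := by
      simp only [dotProduct, Matrix.mulVec, map_sum, map_smul, Finset.mul_sum, hGdef,
        Matrix.of_apply, Pi.star_apply, smul_eq_mul]
      refine Finset.sum_congr rfl fun i _ => Finset.sum_congr rfl fun j _ => by ring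
    rw [h1]
    apply hf.nonneg
    obtain ⟨N, hN⟩ := CStarAlgebra.exists_eq_star_mul_self hM
    have h2 (i j : Fin n) : (M i j : B) = ∑ k, star (N k i) * N k j := by
      have := congr($hN i j)
      simpa [CStarMatrix.mul_apply, CStarMatrix.star_apply] using this
    have h3 : ((∑ i, ∑ j, (star (v i) * v j) • M i j : X.toSubmodule) : B) =
        ∑ k, star (∑ i, v i • N k i) * ∑ j, v j • N k j := by
      simp only [Submodule.coe_sum, Submodule.coe_smul, h2, Finset.smul_sum, star_sum, star_smul,
        Finset.sum_mul_sum, smul_mul_smul_comm]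
      rw [Finset.sum_comm_cycle]
    rw [h3]
    exact Finset.sum_nonneg fun k _ => star_mul_self_nonneg _)
  refine ⟨N, fun i j => ?_⟩
  have := congr($hN i j)
  simpa [Matrix.mul_apply, hGdef] using this

/-- The maps `x ↦ f(x) b` with `f` and `b` positive are completely positive. -/
theorem IsPositiveFunctional.smulRight {f : X.toSubmodule →ₗ[ℂ] ℂ}
    (hf : IsPositiveFunctional f) {b : A} (hb : 0 ≤ b) : IsCompletelyPositive (f.smulRight b) := by
  intro n M hM
  obtain ⟨N, hN⟩ := hf.exists_eq_conjTranspose_mul hM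
  obtain ⟨q, rfl⟩ := CStarAlgebra.exists_eq_star_mul_self hb
  have : M.map (f.smulRight (star q * q)) =
      star (CStarMatrix.ofMatrix (.of fun i j => N i j • q)) *
        CStarMatrix.ofMatrix (.of fun i j => N i j • q) := by
    ext i j
    simp only [CStarMatrix.map_apply, LinearMap.smulRight_apply, hN, CStarMatrix.mul_apply,
      CStarMatrix.star_apply, CStarMatrix.ofMatrix_apply, Matrix.of_apply, star_smul,
      smul_mul_smul_comm, Finset.sum_smul]
  rw [this]
  exact star_mul_self_nonneg _

/-- A state `f` with `f(x) ≥ c ‖x‖` for all positive `x`. -/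
structure IsFaithfulState (f : X.toSubmodule →ₗ[ℂ] ℂ) (c : ℝ) : Prop
    extends IsPositiveFunctional f where
  map_one : f 1 = 1
  pos : 0 < c
  le : ∀ x : X.toSubmodule, 0 ≤ (x : B) → c * ‖x‖ ≤ (f x).re

/-- Separate `0` from the convex hull of the set of positive elements of norm `1`. -/
theorem exists_isFaithfulState [Nontrivial B] (X : OperatorSystem B)
    [FiniteDimensional ℂ X.toSubmodule] :
    ∃ (f : X.toSubmodule →ₗ[ℂ] ℂ) (c : ℝ), IsFaithfulState f c := by
  have : FiniteDimensional ℝ X.toSubmodule := FiniteDimensional.complexToReal _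
  set K : Set X.toSubmodule := {x | 0 ≤ (x : B) ∧ ‖x‖ = 1} with hK
  -- a convex combination of at most `dim + 1` positive elements of norm `1` has norm at least
  -- its largest coefficient, by monotonicity of the norm
  set d : ℝ := Module.finrank ℝ X.toSubmodule + 1 with hd
  have hd0 : 0 < d := by positivity
  have hhull : convexHull ℝ K ⊆ {x | d⁻¹ ≤ ‖x‖} := by
    intro x hx
    obtain ⟨ι, _, z, w, hz, hzi, hw, hw1, rfl⟩ := eq_pos_convex_span_of_mem_convexHull hx
    have hcard : (Fintype.card ι : ℝ) ≤ d := by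
      have := hzi.card_le_finrank_succ.trans
        (Nat.add_le_add_right (Submodule.finrank_le (vectorSpan ℝ (Set.range z))) 1)
      rw [hd]
      exact_mod_cast this
    have hne : (Finset.univ : Finset ι).Nonempty := by
      by_contra h
      rw [Finset.not_nonempty_iff_eq_empty.1 h, Finset.sum_empty] at hw1
      exact zero_ne_one hw1
    obtain ⟨i, -, hi⟩ := Finset.exists_le_of_sum_le (f := fun _ => d⁻¹) (g := w) hne (by
      rw [hw1, Finset.sum_const, nsmul_eq_mul, Finset.card_univ, ← div_eq_mul_inv]
      exact div_le_one_of_le₀ hcard hd0.le)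
    have hz' (j : ι) := hz ⟨j, rfl⟩
    have hle : ‖w i • (z i : B)‖ ≤ ‖∑ j, w j • (z j : B)‖ := by
      refine CStarAlgebra.norm_le_norm_of_nonneg_of_le (smul_nonneg (hw i).le (hz' i).1) ?_
      exact Finset.single_le_sum (f := fun j => w j • (z j : B))
        (fun j _ => smul_nonneg (hw j).le (hz' j).1) (Finset.mem_univ i)
    have h1 : ‖w i • (z i : B)‖ = w i := by
      rw [norm_smul, Real.norm_of_nonneg (hw i).le]
      exact (congrArg _ (hz' i).2).trans (mul_one _)
    have h2 : ((∑ j, w j • z j : X.toSubmodule) : B) = ∑ j, w j • (z j : B) := by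
      rw [Submodule.coe_sum]
      rfl
    change d⁻¹ ≤ ‖((∑ j, w j • z j : X.toSubmodule) : B)‖
    rw [h2]
    exact hi.trans (h1.symm.trans_le hle)
  have h0 : (0 : X.toSubmodule) ∉ closure (convexHull ℝ K) := fun h => by
    have := closure_minimal hhull (isClosed_le continuous_const continuous_norm) h
    simp only [Set.mem_ofPred_eq, norm_zero] at this
    exact absurd this (not_le.2 (by positivity))
  obtain ⟨F, s, hs0, hs⟩ := RCLike.geometric_hahn_banach_point_closed (𝕜 := ℂ) (x := 0)
    (convex_convexHull ℝ K).closure isClosed_closure h0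
  simp only [map_zero, RCLike.re_to_complex] at hs0 hs
  have hle (x : X.toSubmodule) (hx : 0 ≤ (x : B)) : s * ‖x‖ ≤ (F x).re := by
    rcases eq_or_ne x 0 with rfl | hx0
    · simp
    · have hn := norm_pos_iff.2 hx0
      have hmem : ((‖x‖⁻¹ : ℝ) : ℂ) • x ∈ K :=
        ⟨CStarAlgebra.ofReal_smul_nonneg (by positivity) hx, by
          rw [norm_smul, Complex.norm_real, Real.norm_of_nonneg (by positivity),
            inv_mul_cancel₀ hn.ne']⟩
      have := hs _ (subset_closure (subset_convexHull ℝ K hmem))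
      rw [map_smul, smul_eq_mul, Complex.re_ofReal_mul, inv_mul_eq_div, lt_div_iff₀ hn] at this
      exact this.le
  have hsa (x : X.toSubmodule) (hx : 0 ≤ (x : B)) :
      hermitianPart F.toLinearMap x = ((F x).re : ℂ) := by
    have hx' : star x = x := Subtype.ext hx.isSelfAdjoint
    rw [hermitianPart_apply, hx']
    apply Complex.ext
    · simp
      ring
    · simp
  have h1 : 0 < (F 1).re := by
    refine lt_of_lt_of_le (mul_pos hs0 ?_) (hle 1 zero_le_one)
    exact norm_pos_iff.2 fun h => one_ne_zero (α := B) (congrArg Subtype.val h)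
  refine ⟨(((F 1).re⁻¹ : ℝ) : ℂ) • hermitianPart F.toLinearMap, (F 1).re⁻¹ * s,
    ⟨⟨?_, ?_⟩, ?_, by positivity, ?_⟩⟩
  · intro x
    rw [LinearMap.smul_apply, LinearMap.smul_apply, isHermitianMap_hermitianPart, star_smul]
    simp only [Complex.star_def, Complex.conj_ofReal]
  · intro x hx
    rw [LinearMap.smul_apply, hsa x hx, smul_eq_mul, ← Complex.ofReal_mul, Complex.ofReal_re]
    have := hle x hx
    have := norm_nonneg x
    have : 0 ≤ (F x).re := by nlinarith
    positivity
  · rw [LinearMap.smul_apply, hsa 1 zero_le_one, smul_eq_mul, ← Complex.ofReal_mul,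
      inv_mul_cancel₀ h1.ne', Complex.ofReal_one]
  · intro x hx
    rw [LinearMap.smul_apply, hsa x hx, smul_eq_mul, ← Complex.ofReal_mul, Complex.ofReal_re,
      mul_assoc]
    exact mul_le_mul_of_nonneg_left (hle x hx) (by positivity)

end Functionals

end OperatorSystem

/-! ### Perturbing nearly positive maps to completely positive ones -/

namespace CStarMatrix

variable {ι : Type*} [Fintype ι] [DecidableEq ι]

variable (A : Type*) [CStarAlgebra A] in
/-- A scalar matrix as a matrix over `A`. -/
noncomputable def ofScalar (D : CStarMatrix ι ι ℂ) : CStarMatrix ι ι A :=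
  D.map (StarAlgHom.ofId ℂ A)

section

variable {A : Type*} [CStarAlgebra A]

theorem ofScalar_apply (D : CStarMatrix ι ι ℂ) (i j : ι) :
    ofScalar A D i j = algebraMap ℂ A (D i j) := rfl

theorem ofScalar_mul (D E : CStarMatrix ι ι ℂ) :
    ofScalar A (D * E) = ofScalar A D * ofScalar A E :=
  map_mul (mapStarAlgHom (ι := ι) (StarAlgHom.ofId ℂ A)) D E

theorem ofScalar_one : ofScalar A (1 : CStarMatrix ι ι ℂ) = 1 :=
  map_one (mapStarAlgHom (ι := ι) (StarAlgHom.ofId ℂ A))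

theorem star_ofScalar (D : CStarMatrix ι ι ℂ) : star (ofScalar A D) = ofScalar A (star D) :=
  (map_star (mapStarAlgHom (ι := ι) (StarAlgHom.ofId ℂ A)) D).symm

theorem norm_ofScalar_le (D : CStarMatrix ι ι ℂ) : ‖ofScalar A D‖ ≤ ‖D‖ :=
  norm_map_starAlgHom_le _ D

end

/-- The two-sided product `D M D` of a matrix `M` over a vector space with a scalar matrix `D`. -/
def scalarConj {Y : Type*} [AddCommGroup Y] [Module ℂ Y] (D : CStarMatrix ι ι ℂ)
    (M : CStarMatrix ι ι Y) : CStarMatrix ι ι Y :=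
  ofMatrix (.of fun i j => ∑ k, ∑ l, (D i k * D l j) • M k l)

theorem scalarConj_map {Y Z : Type*} [AddCommGroup Y] [Module ℂ Y] [AddCommGroup Z] [Module ℂ Z]
    (D : CStarMatrix ι ι ℂ) (M : CStarMatrix ι ι Y) (φ : Y →ₗ[ℂ] Z) :
    (scalarConj D M).map φ = scalarConj D (M.map φ) := by
  ext i j
  simp [scalarConj]

theorem scalarConj_eq {A : Type*} [CStarAlgebra A] (D : CStarMatrix ι ι ℂ)
    (M : CStarMatrix ι ι A) : scalarConj D M = ofScalar A D * M * ofScalar A D := by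
  ext i j
  simp only [scalarConj, ofMatrix_apply, Matrix.of_apply, mul_apply, ofScalar_apply,
    Finset.sum_mul]
  rw [Finset.sum_comm]
  refine Finset.sum_congr rfl fun k _ => Finset.sum_congr rfl fun l _ => ?_
  rw [← Algebra.smul_def, ← Algebra.commutes, ← Algebra.smul_def, smul_smul, mul_comm]

end CStarMatrix

namespace OperatorSystem

universe u v w

section Perturbation

open CStarMatrix

variable {B : Type u} [CStarAlgebra B] {X : OperatorSystem B} {A : Type v} [CStarAlgebra A]
variable {f : X.toSubmodule →ₗ[ℂ] ℂ} {c : ℝ}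

/-- A bounded Hermitian functional `g` satisfies `-(K / c) f ≤ g ≤ (K / c) f` in the order of
completely positive maps. -/
theorem IsFaithfulState.norm_map_le_of_hermitian (hf : IsFaithfulState f c)
    {g : X.toSubmodule →ₗ[ℂ] ℂ} (hg : IsHermitianMap g) {K : ℝ} (hK : 0 ≤ K)
    (hgK : ∀ x, ‖g x‖ ≤ K * ‖x‖) {n : ℕ} {M : CStarMatrix (Fin n) (Fin n) X.toSubmodule}
    (hM : 0 ≤ M.map (Subtype.val : X.toSubmodule → B)) (hM1 : M.map f = 1) :
    ‖M.map g‖ ≤ K / c := by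
  have hc := hf.pos
  have key (h : X.toSubmodule →ₗ[ℂ] ℂ) (hh : IsHermitianMap h) (hhK : ∀ x, ‖h x‖ ≤ K * ‖x‖) :
      0 ≤ ((K / c : ℝ) : ℂ) • (1 : CStarMatrix (Fin n) (Fin n) ℂ) + M.map h := by
    have hp : IsPositiveFunctional (((K / c : ℝ) : ℂ) • f + h) := by
      refine ⟨fun x => ?_, fun x hx => ?_⟩
      · simp [hf.hermitian x, hh x]
      · have h1 := hf.le x hx
        have h2 := (abs_le.1 ((Complex.abs_re_le_norm (h x)).trans (hhK x))).1
        have h3 : K * ‖x‖ ≤ K / c * (f x).re := by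
          rw [div_mul_eq_mul_div, le_div_iff₀ hc]
          nlinarith
        rw [LinearMap.add_apply, LinearMap.smul_apply, smul_eq_mul, Complex.add_re,
          Complex.re_ofReal_mul]
        linarith
    have h1 := hp.smulRight (zero_le_one (α := ℂ)) n M hM
    convert h1 using 1
    rw [← hM1]
    ext i j
    simp
  refine CStarAlgebra.norm_le_of_sub_nonneg_of_add_nonneg (by positivity) ?_ (key g hg hgK)
  have := key (-g) (fun x => by simp [hg x]) (by simpa using hgK)
  convert this using 1
  rw [sub_eq_add_neg]
  congr 1

/-- Split `g` into its real and imaginary parts. -/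
theorem IsFaithfulState.norm_map_functional_le (hf : IsFaithfulState f c)
    (g : X.toSubmodule →ₗ[ℂ] ℂ) {K : ℝ} (hK : 0 ≤ K)
    (hgK : ∀ x, ‖g x‖ ≤ K * ‖x‖) {n : ℕ} {M : CStarMatrix (Fin n) (Fin n) X.toSubmodule}
    (hM : 0 ≤ M.map (Subtype.val : X.toSubmodule → B)) (hM1 : M.map f = 1) :
    ‖M.map g‖ ≤ 2 * (K / c) := by
  have hb (h : X.toSubmodule →ₗ[ℂ] ℂ) (hhK : ∀ x, ‖h x‖ ≤ K * ‖x‖) (x) :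
      ‖hermitianPart h x‖ ≤ K * ‖x‖ := by
    have hs : ‖star x‖ = ‖x‖ := norm_star (x : B)
    have h1 := hhK (star x)
    rw [hs] at h1
    rw [hermitianPart_apply, norm_smul, norm_inv, Complex.norm_ofNat]
    have h2 := norm_add_le (h x) (star (h (star x)))
    rw [norm_star] at h2
    linarith [hhK x]
  have h1 := hf.norm_map_le_of_hermitian (isHermitianMap_hermitianPart g) hK (hb g hgK) hM hM1
  have h2 := hf.norm_map_le_of_hermitian (isHermitianMap_hermitianPart (-(Complex.I • g))) hK
    (hb (-(Complex.I • g)) (by simpa using hgK)) hM hM1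
  have h3 : M.map g = M.map (hermitianPart g) +
      Complex.I • M.map (hermitianPart (-(Complex.I • g))) := by
    ext i j
    simp only [map_apply, hermitianPart_apply, CStarMatrix.add_apply, CStarMatrix.smul_apply,
      LinearMap.neg_apply, LinearMap.smul_apply, star_neg, Complex.star_def, map_mul, Complex.conj_I,
      smul_eq_mul]
    linear_combination ((g (M i j) - (starRingEnd ℂ) (g (star (M i j)))) / 2) * Complex.I_mul_I
  rw [h3]
  refine (norm_add_le _ _).trans ?_
  rw [norm_smul, Complex.norm_I, one_mul]
  linarith

/-- The normalization `f(M) = 1` bounds the positive matrices over a finite-dimensional operator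
system, uniformly in the size of the matrix: all coordinates of `M` are dominated by `f(M)`. -/
theorem IsFaithfulState.exists_norm_le [FiniteDimensional ℂ X.toSubmodule]
    (hf : IsFaithfulState f c) : ∃ C : ℝ, 0 < C ∧ ∀ (n : ℕ)
      (M : CStarMatrix (Fin n) (Fin n) X.toSubmodule),
      0 ≤ M.map (Subtype.val : X.toSubmodule → B) → M.map f = 1 →
      ‖M.map (Subtype.val : X.toSubmodule → B)‖ ≤ C := by
  have hc := hf.pos
  set b := Module.finBasis ℂ X.toSubmodule
  set K : Fin (Module.finrank ℂ X.toSubmodule) → ℝ :=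
    fun i => ‖LinearMap.toContinuousLinearMap (b.coord i)‖
  refine ⟨1 + ∑ i, 2 * (K i / c) * ‖(b i : B)‖, by positivity, fun n M hM hM1 => ?_⟩
  have h1 : M.map (Subtype.val : X.toSubmodule → B) =
      ∑ i, ofScalar B (M.map (b.coord i)) * diag (Fin n) (b i : B) := by
    ext p q
    have hsum (s : Finset (Fin (Module.finrank ℂ X.toSubmodule)))
        (F : Fin (Module.finrank ℂ X.toSubmodule) → CStarMatrix (Fin n) (Fin n) B) :
        (∑ i ∈ s, F i) p q = ∑ i ∈ s, F i p q := by
      induction s using Finset.cons_induction with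
      | empty => simp
      | cons a s ha ih => rw [Finset.sum_cons, Finset.sum_cons, CStarMatrix.add_apply, ih]
    rw [hsum]
    simp only [mul_diag_apply, ofScalar_apply, map_apply]
    conv_lhs => rw [← b.sum_repr (M p q), Submodule.coe_sum]
    refine Finset.sum_congr rfl fun i _ => ?_
    rw [Submodule.coe_smul, Algebra.smul_def]
    rfl
  rw [h1]
  refine (norm_sum_le _ _).trans (le_add_of_nonneg_of_le zero_le_one
    (Finset.sum_le_sum fun i _ => ?_))
  refine (norm_mul_le _ _).trans (mul_le_mul ((norm_ofScalar_le _).trans ?_) (norm_diag_le _)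
    (norm_nonneg _) (by positivity))
  exact hf.norm_map_functional_le _ (norm_nonneg _)
    (fun x => (LinearMap.toContinuousLinearMap (b.coord i)).le_opNorm x) hM hM1

/-- A map that is positive up to `ε` at all matrix levels becomes completely positive after adding
`C ε f(·) 1`. By the normalization `M ↦ f(M)^(-1/2) M f(M)^(-1/2)` it suffices to treat the
positive matrices `M` with `f(M) = 1`, which are bounded by `C`. -/
theorem isCompletelyPositive_add_of_isNearlyPositive {C : ℝ} (hC : 0 < C)
    (hf : IsFaithfulState f c)
    (hfC : ∀ (n : ℕ) (M : CStarMatrix (Fin n) (Fin n) X.toSubmodule),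
      0 ≤ M.map (Subtype.val : X.toSubmodule → B) → M.map f = 1 →
      ‖M.map (Subtype.val : X.toSubmodule → B)‖ ≤ C)
    {R : X.toSubmodule →ₗ[ℂ] A} {ε : ℝ} (hR : ∀ n, IsNearlyPositive n ε R) :
    IsCompletelyPositive (R + f.smulRight (((C * ε : ℝ) : ℂ) • (1 : A))) := by
  intro n M hM
  have hmap (M : CStarMatrix (Fin n) (Fin n) X.toSubmodule) :
      M.map (R + f.smulRight (((C * ε : ℝ) : ℂ) • (1 : A))) =
        M.map R + ((C * ε : ℝ) : ℂ) • ofScalar A (M.map f) := by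
    ext i j
    simp only [map_apply, LinearMap.add_apply, LinearMap.smulRight_apply, CStarMatrix.add_apply,
      CStarMatrix.smul_apply, ofScalar_apply, Algebra.algebraMap_eq_smul_one]
    rw [smul_comm]
  set T := R + f.smulRight (((C * ε : ℝ) : ℂ) • (1 : A)) with hT
  -- replace `M` by `M + η`, for which `f(M)` is invertible
  refine CStarAlgebra.nonneg_of_forall_pos_smul_add
    (b := (1 : CStarMatrix (Fin n) (Fin n) X.toSubmodule).map T) fun η hη => ?_
  rw [← map_smul_matrix, ← map_add_matrix]
  set M' := M + (η : ℂ) • (1 : CStarMatrix (Fin n) (Fin n) X.toSubmodule) with hM'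
  have hM'0 : 0 ≤ M'.map (Subtype.val : X.toSubmodule → B) := by
    rw [hM', map_val_add, map_val_smul, map_val_one]
    exact add_nonneg hM (CStarAlgebra.ofReal_smul_nonneg hη.le zero_le_one)
  have hfs : f.smulRight (1 : ℂ) = f := by ext; simp
  have hfM : 0 ≤ M.map f := by
    have := hf.toIsPositiveFunctional.smulRight (zero_le_one (α := ℂ)) n M hM
    rwa [hfs] at this
  have hf1 : (1 : CStarMatrix (Fin n) (Fin n) X.toSubmodule).map f = 1 :=
    IsUnital.map_one_matrix hf.map_one
  obtain ⟨D, E, hD, hE, hED, hDE, hEE⟩ := CStarAlgebra.exists_isSelfAdjoint_inverse_sqrt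
    (a := M'.map f) hη (by
      rw [hM', map_add_matrix, map_smul_matrix, hf1, add_sub_cancel_right]
      exact hfM)
  set N := scalarConj D M' with hN
  have hN0 : 0 ≤ N.map (Subtype.val : X.toSubmodule → B) := by
    have h := scalarConj_map D M' X.toSubmodule.subtype
    have h' : N.map (Subtype.val : X.toSubmodule → B) =
        ofScalar B D * M'.map (Subtype.val : X.toSubmodule → B) * ofScalar B D :=
      h.trans (scalarConj_eq _ _)
    rw [h']
    have hs : star (ofScalar B D) = ofScalar B D := by rw [star_ofScalar, hD.star_eq]
    have := star_left_conjugate_nonneg hM'0 (ofScalar B D)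
    rwa [hs] at this
  have hN1 : N.map f = 1 := by
    have h0 (T : CStarMatrix (Fin n) (Fin n) ℂ) : ofScalar ℂ T = T := rfl
    rw [hN, scalarConj_map, scalarConj_eq, h0, ← hEE, ← mul_assoc, hDE, one_mul, hED]
  have hNC := hfC n N hN0 hN1
  have h1 := hR n (((C⁻¹ : ℝ) : ℂ) • N)
    (by
      rw [map_val_smul]
      exact CStarAlgebra.ofReal_smul_nonneg (by positivity) hN0)
    (by
      rw [map_val_smul, norm_smul, Complex.norm_real, Real.norm_of_nonneg (by positivity),
        inv_mul_le_iff₀ hC, mul_one]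
      exact hNC)
  have h2 := CStarAlgebra.ofReal_smul_nonneg hC.le h1
  rw [map_smul_matrix, smul_add, smul_smul, smul_smul, ← Complex.ofReal_mul, ← Complex.ofReal_mul,
    mul_inv_cancel₀ hC.ne', Complex.ofReal_one, one_smul, hN, scalarConj_map, scalarConj_eq] at h2
  have h3 := star_left_conjugate_nonneg h2 (ofScalar A E)
  rw [star_ofScalar, hE.star_eq] at h3
  rw [hmap]
  convert h3 using 1
  have e1 : ofScalar A E * ofScalar A D = 1 := by rw [← ofScalar_mul, hED, ofScalar_one]
  have e2 : ofScalar A D * ofScalar A E = 1 := by rw [← ofScalar_mul, hDE, ofScalar_one]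
  rw [mul_add, add_mul, mul_smul_one, smul_mul_assoc, ← ofScalar_mul, hEE, add_comm]
  congr 1
  simp only [← mul_assoc]
  rw [e1, one_mul, mul_assoc, e2, mul_one]

end Perturbation

end OperatorSystem

/-! ### Quotients and cutoffs -/

namespace CStarMatrix

/-- The norm of a matrix is at most the sum of the norms of its entries. -/
theorem norm_le_sum_norm_apply {ι : Type*} [Fintype ι] {A : Type*} [CStarAlgebra A]
    (M : CStarMatrix ι ι A) : ‖M‖ ≤ ∑ j, ∑ i, ‖M i j‖ := by
  rw [norm_def]
  refine (toCLM M).opNorm_le_bound (by positivity) fun v => ?_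
  simp only [toCLM_apply_eq_sum, Finset.sum_mul]
  refine (WithCStarModule.pi_norm_le_sum_norm _).trans ?_
  gcongr with j _
  refine (norm_sum_le _ _).trans ?_
  gcongr with i _
  refine (norm_mul_le _ _).trans ?_
  rw [mul_comm]
  gcongr
  exact WithCStarModule.norm_apply_le_norm v i

theorem norm_le_card_mul {m : ℕ} {A : Type*} [CStarAlgebra A]
    {M : CStarMatrix (Fin m) (Fin m) A} {r : ℝ} (h : ∀ i j, ‖M i j‖ ≤ r) :
    ‖M‖ ≤ m * (m * r) := by
  refine (norm_le_sum_norm_apply M).trans ?_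
  calc ∑ j, ∑ i, ‖M i j‖ ≤ ∑ _j : Fin m, ∑ _i : Fin m, r :=
        Finset.sum_le_sum fun j _ => Finset.sum_le_sum fun i _ => h i j
    _ = _ := by simp

end CStarMatrix

namespace CStarAlgebra

variable {A : Type*} [CStarAlgebra A]

/-- A self-adjoint element with positive image under a ⋆-homomorphism becomes positive after adding
an element of the kernel, its negative part. -/
theorem exists_map_eq_zero_add_nonneg {A' : Type*} [CStarAlgebra A'] (π : A →⋆ₐ[ℂ] A') {y : A}
    (hy : IsSelfAdjoint y) (h : 0 ≤ π y) : ∃ n : A, π n = 0 ∧ 0 ≤ y + n := by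
  refine ⟨y⁻, ?_, ?_⟩
  · set q := π y⁻
    have hq : 0 ≤ q := map_nonneg π (CFC.negPart_nonneg y)
    have hqs : star q = q := hq.isSelfAdjoint
    have h1 : π y * q = -(q * q) := by
      conv_lhs => rw [← CFC.posPart_sub_negPart y hy, map_sub, sub_mul, ← map_mul,
        CFC.posPart_mul_negPart, map_zero, zero_sub]
    have h2 : star q * π y * q = -(star q * q * q) := by
      rw [mul_assoc, h1, mul_neg, mul_assoc]
    have h3 := star_left_conjugate_nonneg h q
    have h4 := star_left_conjugate_nonneg hq q
    rw [h2] at h3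
    rw [hqs, mul_assoc] at h3 h4
    have h5 : q * (q * q) = 0 := le_antisymm (neg_nonneg.1 h3) h4
    have h6 : q * q = 0 := by
      rw [← norm_eq_zero, ← mul_self_eq_zero, ← CStarRing.norm_star_mul_self, star_mul, hqs,
        mul_assoc, h5, mul_zero, norm_zero]
    rw [← norm_eq_zero, ← mul_self_eq_zero, ← CStarRing.norm_star_mul_self, hqs, h6, norm_zero]
  · exact neg_le_iff_add_nonneg.1 (CFC.neg_negPart_le hy)

variable (J : Ideal A) [hJ2 : J.IsTwoSided] [hJ : IsClosed (J : Set A)]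

/-- The quotient map `A → A ⧸ J` as a ⋆-homomorphism. -/
noncomputable def quotientMk : A →⋆ₐ[ℂ] A ⧸ J where
  __ := Ideal.Quotient.mkₐ ℂ J
  map_star' _ := rfl

theorem quotientMk_eq_zero {a : A} : quotientMk J a = 0 ↔ a ∈ J := Ideal.Quotient.eq_zero_iff_mem

theorem norm_quotientMk_le (a : A) : ‖quotientMk J a‖ ≤ ‖a‖ := Submodule.Quotient.norm_mk_le J a

theorem exists_quotientMk_eq_norm_lt {a : A} {r : ℝ} (h : ‖quotientMk J a‖ < r) :
    ∃ b, quotientMk J b = quotientMk J a ∧ ‖b‖ < r := by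
  obtain ⟨b, hb, hlt⟩ := Submodule.Quotient.norm_mk_lt (quotientMk J a) (sub_pos.2 h)
  exact ⟨b, hb, by linarith⟩

/-- For finitely many elements of an ideal there is a self-adjoint contraction `c`, equal to `1`
modulo the ideal, which almost annihilates them. -/
theorem exists_cutoff {F : Set A} (hF : F.Finite) (hFJ : F ⊆ J) {η : ℝ} (hη : 0 < η) :
    ∃ c : A, IsSelfAdjoint c ∧ ‖c‖ ≤ 1 ∧ quotientMk J c = 1 ∧ ∀ j ∈ F, ‖j * c‖ < η := by
  set h := ∑ j ∈ hF.toFinset, star j * j with hh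
  have hhJ : h ∈ J := J.sum_mem fun j hj => J.mul_mem_left _ (hFJ (hF.mem_toFinset.1 hj))
  obtain ⟨b, c, hbs, hb1, hbc, hlt⟩ := exists_approx_cutoff h (ε := η ^ 2) (by positivity)
  refine ⟨b, hbs, hb1, ?_, fun j hj => ?_⟩
  · have : quotientMk J (1 - b) = 0 := by
      rw [quotientMk_eq_zero, hbc]
      exact J.mul_mem_right _ (J.mul_mem_left _ hhJ)
    rw [map_sub, map_one, sub_eq_zero] at this
    exact this.symm
  · have hle : star j * j ≤ h := Finset.single_le_sum (f := fun j => star j * j)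
      (fun j _ => star_mul_self_nonneg j) (hF.mem_toFinset.2 hj)
    have h1 := star_left_conjugate_le_conjugate hle b
    have h2 := star_left_conjugate_nonneg (star_mul_self_nonneg j) b
    have h3 := norm_le_norm_of_nonneg_of_le h2 h1
    have h4 : ‖j * b‖ * ‖j * b‖ < η ^ 2 := by
      rw [← CStarRing.norm_star_mul_self, star_mul]
      calc ‖star b * star j * (j * b)‖ = ‖star b * (star j * j) * b‖ := by
            simp only [mul_assoc]
        _ ≤ ‖star b * h * b‖ := h3
        _ ≤ ‖star b‖ * ‖h * b‖ := by rw [mul_assoc]; exact norm_mul_le _ _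
        _ ≤ 1 * ‖h * b‖ := by rw [norm_star]; gcongr
        _ < _ := by rwa [one_mul]
    nlinarith [norm_nonneg (j * b)]

end CStarAlgebra

/-! ### From approximate lifts to unital completely positive approximate lifts -/

/-- Compressing by a cutoff `d` which almost fixes `u` turns an almost contractive lift into an
almost positive one: here `z` and `u` stand for the images of a positive contraction and of `1`. -/
theorem CStarAlgebra.nonneg_of_norm_two_smul_sub_le {A : Type*} [CStarAlgebra A] [PartialOrder A]
    [StarOrderedRing A] {d z u : A} (hd : IsSelfAdjoint d) (hd1 : ‖d‖ ≤ 1) {ε : ℝ} (hε : 0 ≤ ε)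
    (hz : ‖(2 : ℂ) • z - u‖ ≤ 1 + ε) (hu : ‖(1 - u) * d‖ ≤ 3 * ε) :
    0 ≤ ((2 * ε : ℝ) : ℂ) • (1 : A) + (2⁻¹ : ℂ) • (d * z * d + star (d * z * d)) := by
  have hre (y : A) : IsSelfAdjoint ((2⁻¹ : ℂ) • (y + star y)) := by
    simp [IsSelfAdjoint, add_comm]
  have hren (y : A) {t : ℝ} (h : ‖y‖ ≤ t) : ‖(2⁻¹ : ℂ) • (y + star y)‖ ≤ t := by
    rw [norm_smul]
    have := norm_add_le y (star y)
    rw [norm_star] at this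
    norm_num
    linarith
  set y := (2 : ℂ) • z - u with hy
  have h1 := star_left_conjugate_nonneg (norm_smul_one_add_nonneg (hre y) (hren y hz)) d
  have h2' : ‖d * ((1 - u) * d)‖ ≤ 3 * ε := by
    refine (norm_mul_le _ _).trans ?_
    calc ‖d‖ * ‖(1 - u) * d‖ ≤ 1 * ‖(1 - u) * d‖ := by gcongr
      _ ≤ _ := by rwa [one_mul]
  have h2 := norm_smul_one_sub_nonneg (hre _) (hren _ h2')
  have h3 := ofReal_smul_nonneg hε (sq_sub_nonneg_of_norm_le hd1)
  have h4 := ofReal_smul_nonneg (t := 1 / 2) (by norm_num) (add_nonneg (add_nonneg h1 h2) h3)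
  -- with `y = 2z - u`, twice the claim is the sum of `d (Re y + 1 + ε) d`,
  -- `3ε - Re d (1 - u) d` and `ε (1 - d²)`
  convert h4 using 1
  simp only [hy, hd.star_eq, star_mul, star_sub, star_smul, mul_add, add_mul, mul_sub,
    sub_mul, smul_mul_assoc, mul_smul_comm, mul_one, one_mul, smul_add, smul_sub, smul_smul,
    mul_assoc, Complex.star_def, map_ofNat]
  push_cast
  module

namespace OperatorSystem

open CStarAlgebra

universe u v

variable {B : Type u} [CStarAlgebra B] {X : OperatorSystem B} {A : Type v} [CStarAlgebra A]

/-- The map `x ↦ d φ(x) d`. -/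
noncomputable def conj (d : A) (φ : X.toSubmodule →ₗ[ℂ] A) : X.toSubmodule →ₗ[ℂ] A :=
  LinearMap.mulLeft ℂ d ∘ₗ LinearMap.mulRight ℂ d ∘ₗ φ

theorem conj_apply (d : A) (φ : X.toSubmodule →ₗ[ℂ] A) (x : X.toSubmodule) :
    conj d φ x = d * φ x * d := by simp [conj, mul_assoc]

theorem map_conj {n : ℕ} (d : A) (φ : X.toSubmodule →ₗ[ℂ] A)
    (M : CStarMatrix (Fin n) (Fin n) X.toSubmodule) :
    M.map (conj d φ) = CStarMatrix.diag (Fin n) d * M.map φ * CStarMatrix.diag (Fin n) d := by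
  ext i j
  simp [CStarMatrix.mul_diag_apply, CStarMatrix.diag_mul_apply, conj_apply]

theorem IsUCP.norm_apply_le {φ : X.toSubmodule →ₗ[ℂ] A} (h : IsUCP φ) (x : X.toSubmodule) :
    ‖φ x‖ ≤ ‖x‖ := by
  simpa using
    norm_apply_le_of_levelNorm_le one_pos zero_le_one (by simpa using h.levelNorm_le_one 1) x

theorem IsFaithfulState.isUCP_smulRight {f : X.toSubmodule →ₗ[ℂ] ℂ} {c : ℝ}
    (hf : IsFaithfulState f c) : IsUCP (f.smulRight (1 : A)) :=
  ⟨(congrArg (· • (1 : A)) hf.map_one).trans (one_smul ℂ 1), hf.smulRight zero_le_one⟩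

@[simp]
theorem star_one_eq : star (1 : X.toSubmodule) = 1 := Subtype.ext (star_one B)

theorem norm_one_eq [Nontrivial B] : ‖(1 : X.toSubmodule)‖ = 1 :=
  (norm_one : ‖(1 : B)‖ = 1)

theorem IsFaithfulState.norm_apply_le {f : X.toSubmodule →ₗ[ℂ] ℂ} {c : ℝ}
    (hf : IsFaithfulState f c) (x : X.toSubmodule) : ‖f x‖ ≤ ‖x‖ := by
  simpa using (hf.isUCP_smulRight (A := ℂ)).norm_apply_le x

variable (J : Ideal A) [hJ2 : J.IsTwoSided] [hJ : IsClosed (J : Set A)]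

/-- Almost completely contractive almost lifts are compressed by a cutoff, which makes them almost
completely positive. They are then corrected by small multiples of a faithful state. -/
theorem exists_isUCP_norm_sub_le_of_cbNorm_le [Nontrivial B] [FiniteDimensional ℂ X.toSubmodule]
    {φ : X.toSubmodule →ₗ[ℂ] A ⧸ J} (hφ : IsUCP φ) {f : X.toSubmodule →ₗ[ℂ] ℂ} {c C : ℝ}
    (hf : IsFaithfulState f c) (hC : 0 < C)
    (hfC : ∀ (n : ℕ) (M : CStarMatrix (Fin n) (Fin n) X.toSubmodule),
      0 ≤ M.map (Subtype.val : X.toSubmodule → B) → M.map f = 1 →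
      ‖M.map (Subtype.val : X.toSubmodule → B)‖ ≤ C)
    {ψ : X.toSubmodule →ₗ[ℂ] A} {ε : ℝ} (hε : 0 < ε) (hψ : cbNorm ψ ≤ ENNReal.ofReal (1 + ε))
    (hψφ : ∀ x, ‖quotientMk J (ψ x) - φ x‖ ≤ ε * ‖x‖) :
    ∃ ψ' : X.toSubmodule →ₗ[ℂ] A, IsUCP ψ' ∧
      ∀ x, ‖quotientMk J (ψ' x) - φ x‖ ≤ (8 + 4 * C) * ε * ‖x‖ := by
  have hone : ‖(1 : X.toSubmodule)‖ = 1 := norm_one_eq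
  set π := quotientMk J with hπ
  have hφ1 : φ 1 = 1 := hφ.1
  -- `1 - ψ(1)` is the sum of a small element and an element of `J`, which `d` almost annihilates
  have hu1 : ‖π (1 - ψ 1)‖ < 2 * ε := by
    have := hψφ 1
    rw [hφ1, hone, mul_one, norm_sub_rev] at this
    rw [map_sub, map_one]
    linarith
  obtain ⟨r, hr, hrn⟩ := exists_quotientMk_eq_norm_lt J hu1
  have hj : 1 - ψ 1 - r ∈ J := by
    rw [← quotientMk_eq_zero, map_sub, hr, sub_self]
  obtain ⟨d, hd, hd1, hπd, hjd⟩ := exists_cutoff J (Set.finite_singleton (1 - ψ 1 - r))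
    (by simpa using hj) hε
  rw [← hπ] at hπd
  have hud : ‖(1 - ψ 1) * d‖ ≤ 3 * ε := by
    have h1 : (1 - ψ 1) * d = r * d + (1 - ψ 1 - r) * d := by noncomm_ring
    have h2 : ‖r * d‖ ≤ 2 * ε := by
      calc _ ≤ ‖r‖ * ‖d‖ := norm_mul_le _ _
        _ ≤ (2 * ε) * 1 := by gcongr
        _ = _ := mul_one _
    rw [h1]
    refine (norm_add_le _ _).trans ?_
    have := hjd _ rfl
    linarith
  set R := hermitianPart (conj d ψ) with hR
  have hRnear (n : ℕ) : IsNearlyPositive n (2 * ε) R := by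
    intro M hM hM1
    have hMs : star M = M := isSelfAdjoint_of_map_val hM.isSelfAdjoint
    have hone' : (1 : CStarMatrix (Fin n) (Fin n) X.toSubmodule).map ψ =
        CStarMatrix.diag (Fin n) (ψ 1) := by
      ext i j
      simp only [CStarMatrix.map_apply, CStarMatrix.one_apply, CStarMatrix.diag_apply]
      split_ifs
      · rfl
      · exact map_zero ψ
    rw [hR, map_hermitianPart _ hMs, map_conj]
    refine nonneg_of_norm_two_smul_sub_le (u := CStarMatrix.diag (Fin n) (ψ 1)) ?_ ?_ hε.le ?_ ?_
    · rw [IsSelfAdjoint, CStarMatrix.star_diag, hd.star_eq]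
    · exact (CStarMatrix.norm_diag_le d).trans hd1
    · rw [← hone', ← map_smul_matrix, ← map_sub_matrix]
      refine (norm_map_le_of_levelNorm_le (by positivity)
        ((le_iSup (fun k => levelNorm k ψ) n).trans hψ) _).trans ?_
      refine mul_le_of_le_one_right (by positivity) ?_
      rw [map_val_sub, map_val_smul, map_val_one]
      set m := M.map (Subtype.val : X.toSubmodule → B)
      have h1 := norm_smul_one_sub_nonneg hM.isSelfAdjoint hM1
      refine norm_le_of_sub_nonneg_of_add_nonneg zero_le_one ?_ ?_
      · convert add_nonneg h1 h1 using 1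
        push_cast
        module
      · convert add_nonneg hM hM using 1
        push_cast
        module
    · rw [← CStarMatrix.diag_one, ← CStarMatrix.diag_sub, ← CStarMatrix.diag_mul]
      exact (CStarMatrix.norm_diag_le _).trans hud
  -- `T = R + C (2ε) f(·) 1` is completely positive and `T(1) ≤ κ`; adding `f(·) (κ - T(1))` and
  -- dividing by `κ` makes it unital
  have hT := isCompletelyPositive_add_of_isNearlyPositive hC hf hfC hRnear
  set s : ℝ := C * (2 * ε) with hs
  have hs0 : 0 ≤ s := by positivity
  set T := R + f.smulRight (((s : ℝ) : ℂ) • (1 : A)) with hTdef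
  have hT_apply (x) : T x = R x + f x • (((s : ℝ) : ℂ) • (1 : A)) := rfl
  set κ : ℝ := 1 + 3 * ε + s with hκ
  have hκ1 : 1 ≤ κ := by linarith
  have hκ0 : 0 < κ := by linarith
  have hre : 0 ≤ ((κ : ℝ) : ℂ) • (1 : A) - T 1 := by
    have h2' : ‖d * ((1 - ψ 1) * d)‖ ≤ 3 * ε := by
      refine (norm_mul_le _ _).trans ?_
      calc ‖d‖ * ‖(1 - ψ 1) * d‖ ≤ 1 * ‖(1 - ψ 1) * d‖ := by gcongr
        _ ≤ _ := by rwa [one_mul]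
    have h1 := sq_sub_nonneg_of_norm_le hd1
    set y := d * ((1 - ψ 1) * d) with hy
    have h3 : IsSelfAdjoint ((2⁻¹ : ℂ) • (y + star y)) := by simp [IsSelfAdjoint, add_comm]
    have h4 : ‖(2⁻¹ : ℂ) • (y + star y)‖ ≤ 3 * ε := by
      rw [norm_smul]
      have := norm_add_le y (star y)
      rw [norm_star] at this
      norm_num
      linarith
    convert add_nonneg h1 (norm_smul_one_add_nonneg h3 h4) using 1
    rw [hT_apply, hf.map_one, hR, hermitianPart_apply, star_one_eq, conj_apply, hκ, hy]
    simp only [hd.star_eq, star_mul, star_sub, mul_sub, sub_mul, one_mul, mul_assoc]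
    push_cast
    module
  set T' := T + f.smulRight (((κ : ℝ) : ℂ) • (1 : A) - T 1) with hT'
  have hT'_apply (x) : T' x = T x + f x • (((κ : ℝ) : ℂ) • (1 : A) - T 1) := rfl
  have hT'cp : IsCompletelyPositive T' := by
    intro n M hM
    have : M.map T' = M.map T + M.map (f.smulRight (((κ : ℝ) : ℂ) • (1 : A) - T 1)) := by
      ext; simp [hT'_apply]
    rw [this]
    exact add_nonneg (hT n M hM) (hf.smulRight hre n M hM)
  have hT'1 : T' 1 = ((κ : ℝ) : ℂ) • (1 : A) := by rw [hT'_apply, hf.map_one]; simp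
  refine ⟨((κ⁻¹ : ℝ) : ℂ) • T', ⟨?_, ?_⟩, fun x => ?_⟩
  · change ((κ⁻¹ : ℝ) : ℂ) • T' 1 = 1
    rw [hT'1, smul_smul, ← Complex.ofReal_mul, inv_mul_cancel₀ hκ0.ne', Complex.ofReal_one,
      one_smul]
  · intro n M hM
    have : M.map (((κ⁻¹ : ℝ) : ℂ) • T') = ((κ⁻¹ : ℝ) : ℂ) • M.map T' := by ext; simp
    rw [this]
    exact ofReal_smul_nonneg (by positivity) (hT'cp n M hM)
  · have hRφ (x) : ‖π (R x) - φ x‖ ≤ ε * ‖x‖ := by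
      have h1 : π (R x) - φ x = (2⁻¹ : ℂ) • ((π (ψ x) - φ x) +
          star (π (ψ (star x)) - φ (star x))) := by
        rw [hR, hermitianPart_apply, conj_apply, conj_apply, hφ.2.isHermitianMap x]
        simp only [map_smul, map_add, map_mul, map_star, hπd, one_mul, mul_one, star_sub, star_star]
        module
      rw [h1, norm_smul]
      have h2 := hψφ x
      have h3 := hψφ (star x)
      have h4 : ‖star x‖ = ‖x‖ := norm_star (x : B)
      rw [h4] at h3
      have h5 := norm_add_le (π (ψ x) - φ x) (star (π (ψ (star x)) - φ (star x)))
      rw [norm_star] at h5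
      rw [show ‖(2⁻¹ : ℂ)‖ = 2⁻¹ by simp]
      linarith
    have hR1 := hRφ 1
    rw [hφ1, hone, mul_one] at hR1
    have hx := norm_nonneg x
    have hfx := hf.norm_apply_le x
    have hT'φ : ‖π (T' x) - φ x‖ ≤ (5 * ε + s) * ‖x‖ := by
      have h1 : π (T' x) - φ x = (π (R x) - φ x) + f x • (((s : ℝ) : ℂ) • (1 : A ⧸ J)) +
          f x • (((3 * ε : ℝ) : ℂ) • (1 : A ⧸ J) - (π (R 1) - 1)) := by
        rw [hT'_apply, hT_apply, hT_apply, hf.map_one, hκ]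
        simp only [map_smul, map_add, map_sub, map_one]
        push_cast
        module
      have h2 : ‖f x • (((s : ℝ) : ℂ) • (1 : A ⧸ J))‖ ≤ ‖x‖ * s := by
        rw [norm_smul]
        gcongr
        exact norm_smul_one_le hs0
      have h3 : ‖f x • (((3 * ε : ℝ) : ℂ) • (1 : A ⧸ J) - (π (R 1) - 1))‖ ≤
          ‖x‖ * (3 * ε + ε) := by
        rw [norm_smul]
        gcongr
        exact (norm_sub_le _ _).trans (add_le_add (norm_smul_one_le (by positivity)) hR1)
      rw [h1]
      have := (norm_add₃_le (a := π (R x) - φ x)).trans (add_le_add_three (hRφ x) h2 h3)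
      linarith
    have h1 : π ((((κ⁻¹ : ℝ) : ℂ) • T') x) - φ x =
        ((κ⁻¹ : ℝ) : ℂ) • ((π (T' x) - φ x) - ((κ - 1 : ℝ) : ℂ) • φ x) := by
      have h0 : ((κ⁻¹ : ℝ) : ℂ) * ((κ : ℝ) : ℂ) = 1 := by
        rw [← Complex.ofReal_mul, inv_mul_cancel₀ hκ0.ne', Complex.ofReal_one]
      rw [LinearMap.smul_apply, map_smul, smul_sub, smul_sub, smul_smul]
      push_cast at h0 ⊢
      rw [mul_sub, h0]
      module
    have h2 : ‖((κ - 1 : ℝ) : ℂ) • φ x‖ ≤ (3 * ε + s) * ‖x‖ := by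
      rw [norm_smul, Complex.norm_real, Real.norm_of_nonneg (by linarith)]
      have : κ - 1 = 3 * ε + s := by rw [hκ]; ring
      rw [this]
      gcongr
      exact hφ.norm_apply_le x
    rw [h1, norm_smul, Complex.norm_real, Real.norm_of_nonneg (by positivity)]
    calc _ ≤ 1 * ((5 * ε + s) * ‖x‖ + (3 * ε + s) * ‖x‖) := by
          gcongr
          · exact inv_le_one_of_one_le₀ hκ1
          · exact (norm_sub_le _ _).trans (add_le_add hT'φ h2)
      _ = _ := by rw [hs]; ring

end OperatorSystem

/-! ### Almost positive lifts and CP-stability -/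

namespace OperatorSystem

open CStarAlgebra

universe u v

section Restrict

variable {B : Type u} [CStarAlgebra B] {X E : OperatorSystem B} {A : Type v} [CStarAlgebra A]

theorem restrict_apply (h : E.toSubmodule ≤ X.toSubmodule) (φ : X.toSubmodule →ₗ[ℂ] A)
    (x : E.toSubmodule) : restrict h φ x = φ (Submodule.inclusion h x) := rfl

theorem IsUCP.restrict (h : E.toSubmodule ≤ X.toSubmodule) {φ : X.toSubmodule →ₗ[ℂ] A}
    (hφ : IsUCP φ) : IsUCP (restrict h φ) :=
  ⟨hφ.1, fun n M hM => hφ.2 n (M.map (Submodule.inclusion h)) hM⟩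

end Restrict

variable {B : Type u} [CStarAlgebra B] [Nontrivial B] {X : OperatorSystem B}
  {A : Type v} [CStarAlgebra A] (J : Ideal A) [hJ2 : J.IsTwoSided] [hJ : IsClosed (J : Set A)]

/-- The Hermitian part of a linear lift is made unital by means of a state. -/
theorem exists_isUnital_isHermitianMap_lift [FiniteDimensional ℂ X.toSubmodule]
    {φ : X.toSubmodule →ₗ[ℂ] A ⧸ J} (hφ : IsUCP φ) :
    ∃ θ : X.toSubmodule →ₗ[ℂ] A, IsUnital θ ∧ IsHermitianMap θ ∧
      ∀ x, quotientMk J (θ x) = φ x := by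
  obtain ⟨f, c, hf⟩ := exists_isFaithfulState X
  obtain ⟨s, hs⟩ := (Ideal.Quotient.mkₐ ℂ J).toLinearMap.exists_rightInverse_of_surjective
    (LinearMap.range_eq_top.2 Ideal.Quotient.mk_surjective)
  have hs' (y : A ⧸ J) : quotientMk J (s y) = y := LinearMap.congr_fun hs y
  set θ := hermitianPart (s ∘ₗ φ) with hθ
  have hθh := isHermitianMap_hermitianPart (s ∘ₗ φ)
  rw [← hθ] at hθh
  have hθφ (x) : quotientMk J (θ x) = φ x := by
    rw [hθ, hermitianPart_apply]
    simp only [LinearMap.comp_apply, map_smul, map_add, map_star, hs']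
    rw [hφ.2.isHermitianMap, star_star]
    module
  have hφ1 : φ 1 = 1 := hφ.1
  refine ⟨θ + f.smulRight (1 - θ 1), ?_, fun x => ?_, fun x => ?_⟩
  · change θ 1 + f 1 • (1 - θ 1) = 1
    rw [hf.map_one]
    module
  · change θ (star x) + f (star x) • (1 - θ 1) = star (θ x + f x • (1 - θ 1))
    have h1 : star (θ 1) = θ 1 := by rw [← hθh, star_one_eq]
    rw [hθh, hf.hermitian, star_add, star_smul, star_sub, star_one, h1]
  · change quotientMk J (θ x + f x • (1 - θ 1)) = φ x
    rw [map_add, map_smul, map_sub, hθφ, hθφ, map_one, hφ1, sub_self, smul_zero, add_zero]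

/-- A Hermitian lift becomes almost positive at a given level after compression by a cutoff: the
positive unit ball at that level is totally bounded, and the negative parts of the images of
finitely many of its points have entries in the ideal. -/
theorem exists_isNearlyPositive_lift [FiniteDimensional ℂ X.toSubmodule]
    {φ : X.toSubmodule →ₗ[ℂ] A ⧸ J} (hφ : IsUCP φ) (m : ℕ) {ε : ℝ} (hε : 0 < ε) :
    ∃ R : X.toSubmodule →ₗ[ℂ] A, IsUnital R ∧ IsHermitianMap R ∧ IsNearlyPositive m ε R ∧
      ∀ x, quotientMk J (R x) = φ x := by
  obtain ⟨f, c, hf⟩ := exists_isFaithfulState X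
  obtain ⟨θ, hθ1, hθh, hθφ⟩ := exists_isUnital_isHermitianMap_lift J hφ
  obtain ⟨K, hK, hθK⟩ := (LinearMap.toContinuousLinearMap θ).bound
  simp only [LinearMap.coe_toContinuousLinearMap'] at hθK
  set η : ℝ := ε / (2 * ((m : ℝ) * m + 1)) with hη
  have hη0 : 0 < η := by positivity
  have hr0 : 0 < η / K := by positivity
  let mat : (Fin m → Fin m → X.toSubmodule) → CStarMatrix (Fin m) (Fin m) X.toSubmodule :=
    fun g => CStarMatrix.ofMatrix (.of g)
  set P : Set (Fin m → Fin m → X.toSubmodule) :=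
    {g | 0 ≤ (mat g).map (Subtype.val : X.toSubmodule → B) ∧
      ‖(mat g).map (Subtype.val : X.toSubmodule → B)‖ ≤ 1} with hP
  have hPtb : TotallyBounded P := by
    have : ProperSpace X.toSubmodule := FiniteDimensional.proper ℂ _
    refine (isCompact_closedBall (0 : Fin m → Fin m → X.toSubmodule) 1).totallyBounded.subset ?_
    intro g hg
    rw [mem_closedBall_zero_iff, pi_norm_le_iff_of_nonneg zero_le_one]
    intro i
    rw [pi_norm_le_iff_of_nonneg zero_le_one]
    intro j
    exact (CStarMatrix.norm_entry_le_norm (M := (mat g).map (Subtype.val : X.toSubmodule → B))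
      (i := i) (j := j)).trans hg.2
  obtain ⟨t, htP, htf, htc⟩ := Metric.finite_approx_of_totallyBounded hPtb (η / K) hr0
  have hN (g) : g ∈ t → ∃ N : CStarMatrix (Fin m) (Fin m) A,
      N.map (quotientMk J) = 0 ∧ 0 ≤ (mat g).map θ + N := by
    intro hg
    have h1 : star ((mat g).map θ) = (mat g).map θ := by
      rw [← hθh.map_star_matrix, isSelfAdjoint_of_map_val (htP hg).1.isSelfAdjoint]
    refine exists_map_eq_zero_add_nonneg (CStarMatrix.mapStarAlgHom (quotientMk J)) h1 ?_
    have h2 : CStarMatrix.mapStarAlgHom (ι := Fin m) (quotientMk J) ((mat g).map θ) =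
        (mat g).map φ := by
      ext i j
      exact hθφ _
    rw [h2]
    exact hφ.2 m _ (htP hg).1
  choose! N hN1 hN2 using hN
  obtain ⟨d, hd, hd1, hπd, hjd⟩ := exists_cutoff J
    (F := ⋃ g ∈ t, Set.range fun p : Fin m × Fin m => N g p.1 p.2)
    (htf.biUnion fun g _ => Set.finite_range _) (by
      intro j hj
      simp only [Set.mem_iUnion, Set.mem_range] at hj
      obtain ⟨g, hg, p, rfl⟩ := hj
      rw [SetLike.mem_coe, ← quotientMk_eq_zero]
      exact congrFun (congrFun (hN1 g hg) p.1) p.2) hη0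
  have hb : 0 ≤ 1 - d * d := by
    have := sq_sub_nonneg_of_norm_le hd1
    rwa [hd.star_eq, one_pow, Complex.ofReal_one, one_smul] at this
  set R := conj d θ + f.smulRight (1 - d * d) with hR
  have hR_apply (x) : R x = d * θ x * d + f x • (1 - d * d) := by
    rw [hR, LinearMap.add_apply, conj_apply]; rfl
  have hθ1' : θ 1 = 1 := hθ1
  have hRh : IsHermitianMap R := by
    intro x
    rw [hR_apply, hR_apply, hθh, hf.hermitian, star_add, star_smul, hb.isSelfAdjoint.star_eq]
    simp [hd.star_eq, mul_assoc]
  refine ⟨R, ?_, hRh, ?_, fun x => ?_⟩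
  · change R 1 = 1
    rw [hR_apply, hf.map_one, hθ1', mul_one]
    module
  · intro M hM hM1
    have hMs : star M = M := isSelfAdjoint_of_map_val hM.isSelfAdjoint
    obtain ⟨g, hg, hMg⟩ : ∃ g ∈ t, (fun i j => M i j) ∈ Metric.ball g (η / K) := by
      have := htc (show (fun i j => M i j) ∈ P from ⟨hM, hM1⟩)
      simpa using this
    have hMg' (i j) : ‖M i j - g i j‖ ≤ η / K := by
      rw [mem_ball_iff_norm] at hMg
      exact ((norm_le_pi_norm ((fun j => M i j) - g i) j).trans
        (norm_le_pi_norm ((fun i j => M i j) - g) i)).trans hMg.le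
    set D := CStarMatrix.diag (Fin m) d with hD
    have hDs : star D = D := by rw [hD, CStarMatrix.star_diag, hd.star_eq]
    have hDn : ‖D‖ ≤ 1 := (CStarMatrix.norm_diag_le d).trans hd1
    have hmap : M.map R = D * M.map θ * D + M.map (f.smulRight (1 - d * d)) := by
      rw [hD, ← map_conj]
      ext i j
      simp [hR]
    -- `M.map R` is the sum of `a`, a positive conjugate belonging to the nearby point `g` of the
    -- net, and the positive matrix `f(M) (1 - d²)`
    set a := D * M.map θ * D - D * ((mat g).map θ + N g) * D with ha
    have h1 := star_left_conjugate_nonneg (hN2 g hg) D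
    rw [hDs] at h1
    have has : IsSelfAdjoint a := by
      refine IsSelfAdjoint.sub ?_ h1.isSelfAdjoint
      rw [IsSelfAdjoint, star_mul, star_mul, hDs, ← hθh.map_star_matrix, hMs, mul_assoc]
    have han : ‖a‖ ≤ ε := by
      have h2 : a = D * (M - mat g).map θ * D - D * (N g * D) := by
        rw [ha, map_sub_matrix]
        noncomm_ring
      have h3 : ‖(M - mat g).map θ‖ ≤ m * (m * η) := by
        refine CStarMatrix.norm_le_card_mul fun i j => ?_
        calc ‖θ (M i j - g i j)‖ ≤ K * ‖M i j - g i j‖ := hθK _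
          _ ≤ K * (η / K) := by gcongr; exact hMg' i j
          _ = η := by field_simp
      have h4 : ‖N g * D‖ ≤ m * (m * η) := by
        refine CStarMatrix.norm_le_card_mul fun i j => ?_
        rw [hD, CStarMatrix.mul_diag_apply]
        refine (hjd _ ?_).le
        simp only [Set.mem_iUnion, Set.mem_range]
        exact ⟨g, hg, (i, j), rfl⟩
      have h5 : ‖D * (M - mat g).map θ * D‖ ≤ m * (m * η) := by
        calc _ ≤ ‖D‖ * ‖(M - mat g).map θ‖ * ‖D‖ := norm_mul₃_le
          _ ≤ 1 * (m * (m * η)) * 1 := by gcongr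
          _ = _ := by ring
      have h6 : ‖D * (N g * D)‖ ≤ m * (m * η) := by
        calc _ ≤ ‖D‖ * ‖N g * D‖ := norm_mul_le _ _
          _ ≤ 1 * (m * (m * η)) := by gcongr
          _ = _ := by ring
      have h7 : (m : ℝ) * m * η + m * m * η ≤ ε := by
        have : ε = 2 * ((m : ℝ) * m + 1) * η := by rw [hη]; field_simp
        nlinarith
      rw [h2]
      exact (norm_sub_le _ _).trans (by linarith)
    have h8 := add_nonneg (add_nonneg (norm_smul_one_add_nonneg has han) h1)
      (hf.smulRight hb m M hM)
    convert h8 using 1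
    rw [hmap, ha]
    abel
  · rw [hR_apply]
    simp [hπd, hθφ]

/-- The lift of `φ` to the subsystem `S` is almost positive at level `2k`, hence almost contractive
at level `k`, and CP-stability applies to it. -/
theorem IsCPStable.exists_isUCP_norm_sub_le {A : Type u} [CStarAlgebra A] (J : Ideal A)
    [J.IsTwoSided] [IsClosed (J : Set A)] (h : X.IsCPStable)
    {φ : X.toSubmodule →ₗ[ℂ] A ⧸ J} (hφ : IsUCP φ) {E : OperatorSystem B}
    [FiniteDimensional ℂ E.toSubmodule] (hE : E.toSubmodule ≤ X.toSubmodule) {δ : ℝ} (hδ : 0 < δ) :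
    ∃ ψ : E.toSubmodule →ₗ[ℂ] A, IsUCP ψ ∧
      ∀ x, ‖quotientMk J (ψ x) - restrict hE φ x‖ ≤ δ * ‖x‖ := by
  obtain ⟨S, hES, k, ε, hSf, hSX, hk, hε, H⟩ := h E hE δ hδ
  obtain ⟨R, hR1, hRh, hRp, hRφ⟩ := exists_isNearlyPositive_lift J (hφ.restrict hSX) (k + k)
    (ε := ε / 4) (by positivity)
  obtain ⟨ψ, hψ, hlt⟩ := H A R hR1 ((hRp.levelNorm_le (by positivity) hR1 hRh).trans_lt
    ((ENNReal.ofReal_lt_ofReal_iff (by positivity)).2 (by linarith)))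
  refine ⟨ψ, hψ, fun x => ?_⟩
  have h1 : restrict hE φ x = quotientMk J (restrict hES R x) := by
    rw [restrict_apply hES, hRφ]
    rfl
  rw [h1, norm_sub_rev, ← map_sub]
  refine (norm_quotientMk_le J _).trans ?_
  refine ((LinearMap.toContinuousLinearMap (restrict hES R - ψ)).le_opNorm x).trans ?_
  gcongr

theorem HasALLP.exists_isUCP_norm_sub_le {A : Type u} [CStarAlgebra A] (J : Ideal A)
    [J.IsTwoSided] [IsClosed (J : Set A)] (h : X.HasALLP)
    {φ : X.toSubmodule →ₗ[ℂ] A ⧸ J} (hφ : IsUCP φ) {E : OperatorSystem B}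
    [FiniteDimensional ℂ E.toSubmodule] (hE : E.toSubmodule ≤ X.toSubmodule) {δ : ℝ} (hδ : 0 < δ) :
    ∃ ψ : E.toSubmodule →ₗ[ℂ] A, IsUCP ψ ∧
      ∀ x, ‖quotientMk J (ψ x) - restrict hE φ x‖ ≤ δ * ‖x‖ := by
  obtain ⟨f, c, hf⟩ := exists_isFaithfulState E
  obtain ⟨C, hC, hfC⟩ := hf.exists_norm_le
  obtain ⟨ψ, hψ, hψφ⟩ := h A J φ hφ E hE (δ / (8 + 4 * C)) (by positivity)
  obtain ⟨ψ', hψ', hle⟩ := exists_isUCP_norm_sub_le_of_cbNorm_le J (hφ.restrict hE) hf hC hfC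
    (ε := δ / (8 + 4 * C)) (by positivity) hψ.le fun x => by
      refine ((LinearMap.toContinuousLinearMap
        (toQuotient J ψ - OperatorSystem.restrict hE φ)).le_opNorm x).trans ?_
      gcongr
  refine ⟨ψ', hψ', fun x => (hle x).trans_eq ?_⟩
  field_simp

end OperatorSystem

/-! ### From approximate liftings to liftings -/

namespace CStarAlgebra

variable {A : Type*} [CStarAlgebra A]

/-- The complement `g = √(1 - c²)` of a self-adjoint contraction `c`. -/
theorem exists_complement_cutoff {c : A} (hc : IsSelfAdjoint c) (hc1 : ‖c‖ ≤ 1) :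
    ∃ g : A, IsSelfAdjoint g ∧ ‖g‖ ≤ 1 ∧ c * c + g * g = 1 ∧ ∀ j, ‖j * (1 - g)‖ ≤ ‖j * c‖ := by
  have h0 : 0 ≤ 1 - c * c := by
    have := sq_sub_nonneg_of_norm_le hc1
    rwa [hc.star_eq, one_pow, Complex.ofReal_one, one_smul] at this
  set g := CFC.sqrt (1 - c * c) with hg
  have hg0 : 0 ≤ g := CFC.sqrt_nonneg _
  have hgs : IsSelfAdjoint g := hg0.isSelfAdjoint
  have hgg : g * g = 1 - c * c := CFC.sqrt_mul_sqrt_self _ h0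
  have hcc : 0 ≤ c * c := by
    have := star_mul_self_nonneg c
    rwa [hc.star_eq] at this
  have hg1 : ‖g‖ ≤ 1 := by
    refine norm_le_of_sq_sub_nonneg zero_le_one ?_
    rw [hgs.star_eq, hgg]
    simpa using hcc
  refine ⟨g, hgs, hg1, by rw [hgg]; abel, fun j => ?_⟩
  have h1 : 0 ≤ g - g * g := by
    set s := CFC.sqrt g
    have hs : IsSelfAdjoint s := (CFC.sqrt_nonneg g).isSelfAdjoint
    have hss : s * s = g := CFC.sqrt_mul_sqrt_self _ hg0
    have h2 := norm_smul_one_sub_nonneg hgs hg1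
    have h3 := star_left_conjugate_nonneg h2 s
    rw [hs.star_eq, Complex.ofReal_one, one_smul] at h3
    convert h3 using 1
    rw [← hss]
    noncomm_ring
  have h2 : (1 - g) * (1 - g) ≤ c * c := by
    rw [← sub_nonneg]
    convert add_nonneg h1 h1 using 1
    rw [show c * c = 1 - g * g by rw [hgg]; abel]
    noncomm_ring
  have h3 := norm_le_norm_of_nonneg_of_le (star_right_conjugate_nonneg (c := j)
    (show 0 ≤ (1 - g) * (1 - g) by
      have := star_mul_self_nonneg (1 - g)
      rwa [star_sub, star_one, hgs.star_eq] at this)) (star_right_conjugate_le_conjugate h2 j)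
  have h4 (y : A) (hy : IsSelfAdjoint y) : ‖j * (y * y) * star j‖ = ‖j * y‖ * ‖j * y‖ := by
    rw [← CStarRing.norm_self_mul_star, star_mul, hy.star_eq]
    simp only [mul_assoc]
  rw [h4 _ ((IsSelfAdjoint.one A).sub hgs), h4 _ hc] at h3
  exact (mul_self_le_mul_self_iff (norm_nonneg _) (norm_nonneg _)).2 h3

end CStarAlgebra

namespace OperatorSystem

open CStarAlgebra

universe u v

variable {B : Type u} [CStarAlgebra B] {X : OperatorSystem B} {A : Type v} [CStarAlgebra A]

theorem IsCompletelyPositive.add {φ ψ : X.toSubmodule →ₗ[ℂ] A} (hφ : IsCompletelyPositive φ)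
    (hψ : IsCompletelyPositive ψ) : IsCompletelyPositive (φ + ψ) := by
  intro n M hM
  have : M.map (φ + ψ) = M.map φ + M.map ψ := by ext; simp
  rw [this]
  exact add_nonneg (hφ n M hM) (hψ n M hM)

theorem IsCompletelyPositive.smul {φ : X.toSubmodule →ₗ[ℂ] A} (hφ : IsCompletelyPositive φ)
    {t : ℝ} (ht : 0 ≤ t) : IsCompletelyPositive ((t : ℂ) • φ) := by
  intro n M hM
  have : M.map ((t : ℂ) • φ) = (t : ℂ) • M.map φ := by ext; simp
  rw [this]
  exact ofReal_smul_nonneg ht (hφ n M hM)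

theorem IsCompletelyPositive.conj {φ : X.toSubmodule →ₗ[ℂ] A} (hφ : IsCompletelyPositive φ)
    {d : A} (hd : IsSelfAdjoint d) : IsCompletelyPositive (conj d φ) := by
  intro n M hM
  rw [map_conj]
  have := star_left_conjugate_nonneg (hφ n M hM) (CStarMatrix.diag (Fin n) d)
  rwa [CStarMatrix.star_diag, hd.star_eq] at this

variable (J : Ideal A) [hJ2 : J.IsTwoSided] [hJ : IsClosed (J : Set A)]

/-- One step of the averaging: the error of a sum `Φ` of `N` corrections, measured on a finite
family `b`, is split into a part which grows linearly with small slope and a part `e` in the ideal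
whose square grows linearly. A new summand `c ψ₂ c + g ψ₁ g` with `c² + g² = 1`, in which `c` is a
cutoff for the previous errors, contributes an almost orthogonal part to `e`. -/
theorem exists_sum_corrections {ψ₁ ψ₂ : X.toSubmodule →ₗ[ℂ] A} (h₁ : IsUCP ψ₁) (h₂ : IsUCP ψ₂)
    {δ : ℝ} (hδ : ∀ x, ‖quotientMk J (ψ₂ x - ψ₁ x)‖ ≤ δ * ‖x‖) {ι : Type*} [Finite ι]
    (b : ι → X.toSubmodule) {η : ℝ} (hη : 0 < η) (N : ℕ) :
    ∃ (Φ : X.toSubmodule →ₗ[ℂ] A) (e : ι → A), IsCompletelyPositive Φ ∧ Φ 1 = ((N : ℝ) : ℂ) • 1 ∧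
      (∀ x, quotientMk J (Φ x) = ((N : ℝ) : ℂ) • quotientMk J (ψ₂ x)) ∧ (∀ i, e i ∈ J) ∧
      (∀ i, ‖Φ (b i) - ((N : ℝ) : ℂ) • ψ₁ (b i) - e i‖ ≤ N * (δ * ‖b i‖ + η)) ∧
      ∀ i, ‖e i‖ ^ 2 ≤ N * (9 * ‖b i‖ ^ 2 + 4 * ‖b i‖ + 2) := by
  induction N with
  | zero => exact ⟨0, 0, fun n M _ => by
      rw [show M.map (0 : X.toSubmodule →ₗ[ℂ] A) = 0 by ext; simp], by simp, by simp, by simp,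
      by simp, by simp⟩
  | succ N ih =>
    obtain ⟨Φ, e, hΦ, hΦ1, hΦπ, heJ, hΦe, hen⟩ := ih
    have hlift (i) : ∃ r, quotientMk J r = quotientMk J (ψ₂ (b i) - ψ₁ (b i)) ∧
        ‖r‖ < δ * ‖b i‖ + η / 2 := exists_quotientMk_eq_norm_lt J (by
      have := hδ (b i)
      linarith)
    choose r hr hrn using hlift
    obtain ⟨c, hc, hc1, hπc, hcj⟩ := exists_cutoff J (η := min 1 (η / 2))
      (F := Set.range (fun i => ψ₂ (b i) - ψ₁ (b i) - r i) ∪ Set.range (fun i => star (e i)) ∪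
        Set.range fun i => star (e i) * ψ₁ (b i))
      (((Set.finite_range _).union (Set.finite_range _)).union (Set.finite_range _)) (by
        rintro _ ((⟨i, rfl⟩ | ⟨i, rfl⟩) | ⟨i, rfl⟩)
        · rw [SetLike.mem_coe, ← quotientMk_eq_zero, map_sub, hr, sub_self]
        · exact star_mem_ideal J (heJ i)
        · exact J.mul_mem_right _ (star_mem_ideal J (heJ i))) (by positivity)
    have hc1' (i) : ‖(ψ₂ (b i) - ψ₁ (b i) - r i) * c‖ ≤ η / 2 :=
      (hcj _ (.inl (.inl ⟨i, rfl⟩))).le.trans (min_le_right _ _)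
    have hc2' (i) : ‖star (e i) * c‖ ≤ 1 :=
      (hcj _ (.inl (.inr ⟨i, rfl⟩))).le.trans (min_le_left _ _)
    have hc3' (i) : ‖star (e i) * ψ₁ (b i) * c‖ ≤ 1 :=
      (hcj _ (.inr ⟨i, rfl⟩)).le.trans (min_le_left _ _)
    obtain ⟨g, hg, hg1, hcg, hgj⟩ := exists_complement_cutoff hc hc1
    have hπg : quotientMk J g = 0 := by
      have h := congrArg (quotientMk J) hcg
      rw [map_add, map_mul, map_mul, hπc, map_one, mul_one, add_eq_left] at h
      rw [← norm_eq_zero, ← mul_self_eq_zero, ← CStarRing.norm_star_mul_self, ← map_star,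
        hg.star_eq, h, norm_zero]
    set d : ι → A := fun i => c * ψ₁ (b i) * c + g * ψ₁ (b i) * g - ψ₁ (b i) with hd
    have hψ₁1 : ψ₁ 1 = 1 := h₁.1
    have hψ₂1 : ψ₂ 1 = 1 := h₂.1
    refine ⟨Φ + (conj c ψ₂ + conj g ψ₁), fun i => e i + d i,
      hΦ.add ((h₂.2.conj hc).add (h₁.2.conj hg)), ?_, fun x => ?_, fun i => ?_, fun i => ?_,
      fun i => ?_⟩
    · simp only [LinearMap.add_apply, conj_apply, hΦ1, hψ₁1, hψ₂1, mul_one, hcg]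
      push_cast
      module
    · simp only [LinearMap.add_apply, conj_apply, map_add, map_mul, hπc, hπg, hΦπ, one_mul, mul_one,
        zero_mul]
      push_cast
      module
    · refine J.add_mem (heJ i) ?_
      rw [← quotientMk_eq_zero]
      simp [hd, hπc, hπg]
    · have h3 : (Φ + (conj c ψ₂ + conj g ψ₁)) (b i) - ((N + 1 : ℕ) : ℝ) • ψ₁ (b i) - (e i + d i) =
          (Φ (b i) - ((N : ℝ) : ℂ) • ψ₁ (b i) - e i) +
            (c * r i * c + c * ((ψ₂ (b i) - ψ₁ (b i) - r i) * c)) := by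
        rw [← Complex.coe_smul]
        simp only [LinearMap.add_apply, conj_apply, hd, mul_sub, sub_mul, mul_assoc]
        push_cast
        module
      have h4 : ‖c * r i * c‖ ≤ δ * ‖b i‖ + η / 2 := by
        calc _ ≤ ‖c‖ * ‖r i‖ * ‖c‖ := norm_mul₃_le
          _ ≤ 1 * ‖r i‖ * 1 := by gcongr
          _ ≤ _ := by linarith [hrn i]
      have h5 : ‖c * ((ψ₂ (b i) - ψ₁ (b i) - r i) * c)‖ ≤ η / 2 := by
        calc _ ≤ ‖c‖ * ‖(ψ₂ (b i) - ψ₁ (b i) - r i) * c‖ := norm_mul_le _ _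
          _ ≤ 1 * ‖(ψ₂ (b i) - ψ₁ (b i) - r i) * c‖ := by gcongr
          _ ≤ _ := by linarith [hc1' i]
      rw [Complex.coe_smul, h3]
      refine (norm_add_le _ _).trans ((add_le_add (hΦe i) ((norm_add_le _ _).trans
        (add_le_add h4 h5))).trans_eq ?_)
      push_cast
      ring
    · have hψn : ‖ψ₁ (b i)‖ ≤ ‖b i‖ := h₁.norm_apply_le _
      have hb := norm_nonneg (b i)
      have hdn : ‖d i‖ ≤ 3 * ‖b i‖ := by
        have h3 (q : A) (hq : ‖q‖ ≤ 1) : ‖q * ψ₁ (b i) * q‖ ≤ ‖b i‖ := by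
          calc _ ≤ ‖q‖ * ‖ψ₁ (b i)‖ * ‖q‖ := norm_mul₃_le
            _ ≤ 1 * ‖b i‖ * 1 := by gcongr
            _ = _ := by ring
        have := norm_sub_le (c * ψ₁ (b i) * c + g * ψ₁ (b i) * g) (ψ₁ (b i))
        have := norm_add_le (c * ψ₁ (b i) * c) (g * ψ₁ (b i) * g)
        linarith [h3 c hc1, h3 g hg1]
      have hed : ‖star (e i) * d i‖ ≤ 2 * ‖b i‖ + 1 := by
        have h3 : star (e i) * d i = star (e i) * c * (ψ₁ (b i) * c) -
            star (e i) * (1 - g) * (ψ₁ (b i) * g) - star (e i) * ψ₁ (b i) * (1 - g) := by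
          simp only [hd]
          noncomm_ring
        have h4 : ‖star (e i) * c * (ψ₁ (b i) * c)‖ ≤ ‖b i‖ := by
          calc _ ≤ ‖star (e i) * c‖ * (‖ψ₁ (b i)‖ * ‖c‖) :=
                (norm_mul_le _ _).trans (by gcongr; exact norm_mul_le _ _)
            _ ≤ 1 * (‖b i‖ * 1) := by gcongr; exact hc2' i
            _ = _ := by ring
        have h5 : ‖star (e i) * (1 - g) * (ψ₁ (b i) * g)‖ ≤ ‖b i‖ := by
          calc _ ≤ ‖star (e i) * (1 - g)‖ * (‖ψ₁ (b i)‖ * ‖g‖) :=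
                (norm_mul_le _ _).trans (by gcongr; exact norm_mul_le _ _)
            _ ≤ 1 * (‖b i‖ * 1) := by gcongr; exact (hgj _).trans (hc2' i)
            _ = _ := by ring
        have h6 := (hgj (star (e i) * ψ₁ (b i))).trans (hc3' i)
        rw [h3]
        have := norm_sub_le (star (e i) * c * (ψ₁ (b i) * c) -
            star (e i) * (1 - g) * (ψ₁ (b i) * g)) (star (e i) * ψ₁ (b i) * (1 - g))
        have := norm_sub_le (star (e i) * c * (ψ₁ (b i) * c))
            (star (e i) * (1 - g) * (ψ₁ (b i) * g))
        linarith
      have h3 : ‖e i + d i‖ ^ 2 ≤ ‖e i‖ ^ 2 + 2 * ‖star (e i) * d i‖ + ‖d i‖ ^ 2 := by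
        have h4 : star (e i + d i) * (e i + d i) = star (e i) * e i +
            (star (e i) * d i + star (star (e i) * d i)) + star (d i) * d i := by
          rw [star_mul, star_star, star_add]
          noncomm_ring
        rw [sq, ← CStarRing.norm_star_mul_self, h4]
        have h5 := norm_add₃_le (a := star (e i) * e i)
          (b := star (e i) * d i + star (star (e i) * d i)) (c := star (d i) * d i)
        have h6 := norm_add_le (star (e i) * d i) (star (star (e i) * d i))
        rw [norm_star] at h6
        rw [CStarRing.norm_star_mul_self, CStarRing.norm_star_mul_self] at h5
        nlinarith
      have h7 := hen i
      have h8 : ‖d i‖ ^ 2 ≤ (3 * ‖b i‖) ^ 2 := by gcongr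
      push_cast
      nlinarith

/-- A unital completely positive map can be moved close to a second one without changing its
image in the quotient, if these images are close. -/
theorem exists_isUCP_norm_sub_le {ψ₁ ψ₂ : X.toSubmodule →ₗ[ℂ] A} (h₁ : IsUCP ψ₁) (h₂ : IsUCP ψ₂)
    {δ : ℝ} (hδ : ∀ x, ‖quotientMk J (ψ₂ x - ψ₁ x)‖ ≤ δ * ‖x‖) {ι : Type*} [Finite ι]
    (b : ι → X.toSubmodule) {ε : ℝ} (hε : 0 < ε) :
    ∃ ψ : X.toSubmodule →ₗ[ℂ] A, IsUCP ψ ∧ (∀ x, quotientMk J (ψ x) = quotientMk J (ψ₂ x)) ∧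
      ∀ i, ‖ψ (b i) - ψ₁ (b i)‖ ≤ δ * ‖b i‖ + ε := by
  obtain ⟨K, hK⟩ := (Set.finite_range fun i => 9 * ‖b i‖ ^ 2 + 4 * ‖b i‖ + 2).bddAbove
  obtain ⟨N, hN⟩ := exists_nat_gt (max 0 (K / (ε / 2) ^ 2))
  have hN0 : (0 : ℝ) < N := (le_max_left _ _).trans_lt hN
  have hNK : K ≤ N * (ε / 2) ^ 2 := by
    rw [← div_le_iff₀ (by positivity)]
    exact ((le_max_right _ _).trans_lt hN).le
  obtain ⟨Φ, e, hΦ, hΦ1, hΦπ, heJ, hΦe, hen⟩ :=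
    exists_sum_corrections J h₁ h₂ hδ b (half_pos hε) N
  have hNN : (((N : ℝ)⁻¹ : ℝ) : ℂ) * ((N : ℝ) : ℂ) = 1 := by
    rw [← Complex.ofReal_mul, inv_mul_cancel₀ hN0.ne', Complex.ofReal_one]
  refine ⟨(((N : ℝ)⁻¹ : ℝ) : ℂ) • Φ, ⟨?_, hΦ.smul (by positivity)⟩, fun x => ?_, fun i => ?_⟩
  · change (((N : ℝ)⁻¹ : ℝ) : ℂ) • Φ 1 = 1
    rw [hΦ1, smul_smul, hNN, one_smul]
  · rw [LinearMap.smul_apply, map_smul, hΦπ, smul_smul, hNN, one_smul]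
  · have h3 : ((((N : ℝ)⁻¹ : ℝ) : ℂ) • Φ) (b i) - ψ₁ (b i) = (((N : ℝ)⁻¹ : ℝ) : ℂ) •
        ((Φ (b i) - ((N : ℝ) : ℂ) • ψ₁ (b i) - e i) + e i) := by
      rw [sub_add_cancel, smul_sub, smul_smul, hNN, one_smul]; rfl
    have h4 : ‖e i‖ ≤ N * (ε / 2) := by
      refine abs_le_of_sq_le_sq' ?_ (by positivity) |>.2
      have h5 : 9 * ‖b i‖ ^ 2 + 4 * ‖b i‖ + 2 ≤ K := hK ⟨i, rfl⟩
      calc _ ≤ N * (9 * ‖b i‖ ^ 2 + 4 * ‖b i‖ + 2) := hen i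
        _ ≤ N * (N * (ε / 2) ^ 2) := by gcongr; exact h5.trans hNK
        _ = _ := by ring
    rw [h3, norm_smul, Complex.norm_real, Real.norm_of_nonneg (by positivity)]
    calc _ ≤ (N : ℝ)⁻¹ * (N * (δ * ‖b i‖ + ε / 2) + N * (ε / 2)) := by
          gcongr
          exact (norm_add_le _ _).trans (add_le_add (hΦe i) h4)
      _ = _ := by field_simp; ring

/-- Complete positivity is preserved under pointwise limits. -/
theorem isCompletelyPositive_of_tendsto {ψ : ℕ → X.toSubmodule →ₗ[ℂ] A}
    {φ : X.toSubmodule →ₗ[ℂ] A} (hψ : ∀ n, IsCompletelyPositive (ψ n))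
    (h : ∀ x, Filter.Tendsto (fun n => ψ n x) .atTop (𝓝 (φ x))) : IsCompletelyPositive φ := by
  intro m M hM
  have hlim : Filter.Tendsto (fun n => M.map (ψ n)) .atTop (𝓝 (M.map φ)) := by
    rw [tendsto_iff_norm_sub_tendsto_zero]
    refine squeeze_zero (fun _ => norm_nonneg _)
      (fun n => CStarMatrix.norm_le_sum_norm_apply _) ?_
    have : Filter.Tendsto (fun n => ∑ j, ∑ i, ‖ψ n (M i j) - φ (M i j)‖) .atTop
        (𝓝 (∑ _j : Fin m, ∑ _i : Fin m, 0)) :=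
      tendsto_finsetSum _ fun j _ => tendsto_finsetSum _ fun i _ =>
        tendsto_iff_norm_sub_tendsto_zero.1 (h (M i j))
    simpa using this
  exact (CStarAlgebra.isClosed_nonneg (A := CStarMatrix (Fin m) (Fin m) A)).mem_of_tendsto hlim
    (.of_forall fun n => hψ n m M hM)

/-- Arveson's principle: on a finite-dimensional operator system, limits of liftable unital
completely positive maps are liftable. -/
theorem exists_isUCP_lift_of_approx [FiniteDimensional ℂ X.toSubmodule]
    {φ : X.toSubmodule →ₗ[ℂ] A ⧸ J}
    (H : ∀ δ : ℝ, 0 < δ → ∃ ψ : X.toSubmodule →ₗ[ℂ] A, IsUCP ψ ∧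
      ∀ x, ‖quotientMk J (ψ x) - φ x‖ ≤ δ * ‖x‖) :
    ∃ ψ : X.toSubmodule →ₗ[ℂ] A, IsUCP ψ ∧ toQuotient J ψ = φ := by
  set b := Module.finBasis ℂ X.toSubmodule
  let P (n : ℕ) (ψ : X.toSubmodule →ₗ[ℂ] A) : Prop :=
    IsUCP ψ ∧ ∀ x, ‖quotientMk J (ψ x) - φ x‖ ≤ (1 / 2) ^ n * ‖x‖
  have hstep (n : ℕ) (ψ : X.toSubmodule →ₗ[ℂ] A) : P n ψ →
      ∃ ψ', P (n + 1) ψ' ∧ ∀ i, ‖ψ' (b i) - ψ (b i)‖ ≤ (2 * ‖b i‖ + 1) * (1 / 2) ^ n := by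
    intro hψ
    obtain ⟨ψ₂, hψ₂, hψ₂φ⟩ := H ((1 / 2) ^ (n + 1)) (by positivity)
    obtain ⟨ψ', h1, h2, h3⟩ := exists_isUCP_norm_sub_le J (δ := 2 * (1 / 2) ^ n) hψ.1 hψ₂ (by
      intro x
      have h4 : quotientMk J (ψ₂ x - ψ x) =
          (quotientMk J (ψ₂ x) - φ x) - (quotientMk J (ψ x) - φ x) := by
        rw [map_sub]; abel
      rw [h4]
      refine (norm_sub_le _ _).trans ((add_le_add (hψ₂φ x) (hψ.2 x)).trans ?_)
      rw [pow_succ]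
      have : 0 ≤ (1 / 2 : ℝ) ^ n * ‖x‖ := by positivity
      linarith) b (ε := (1 / 2) ^ n) (by positivity)
    refine ⟨ψ', ⟨h1, fun x => by rw [h2]; exact hψ₂φ x⟩, fun i => (h3 i).trans_eq ?_⟩
    ring
  choose! next hnext hclose using hstep
  obtain ⟨ψ₀, hψ₀⟩ := H 1 one_pos
  let ψ : ℕ → X.toSubmodule →ₗ[ℂ] A := fun n => Nat.rec ψ₀ next n
  have hP (n : ℕ) : P n (ψ n) := by
    induction n with
    | zero => exact ⟨hψ₀.1, fun x => by rw [pow_zero]; exact hψ₀.2 x⟩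
    | succ n ih => exact hnext n _ ih
  have hcau (i) : CauchySeq fun n => ψ n (b i) :=
    cauchySeq_of_le_geometric (1 / 2) (2 * ‖b i‖ + 1) (by norm_num) fun n => by
      rw [dist_comm, dist_eq_norm]
      exact hclose n _ (hP n) i
  choose a ha using fun i => cauchySeq_tendsto_of_complete (hcau i)
  have hlim (x) : Filter.Tendsto (fun n => ψ n x) .atTop (𝓝 (b.constr ℂ a x)) := by
    have h1 (n) : ψ n x = ∑ i, b.repr x i • ψ n (b i) := by
      conv_lhs => rw [← b.sum_repr x, map_sum]
      simp only [map_smul]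
    simp only [h1, Module.Basis.constr_apply_fintype, Module.Basis.equivFun_apply]
    exact tendsto_finsetSum _ fun i _ => (ha i).const_smul _
  refine ⟨b.constr ℂ a, ⟨?_, isCompletelyPositive_of_tendsto (fun n => (hP n).1.2) hlim⟩, ?_⟩
  · refine tendsto_nhds_unique (hlim 1) ?_
    rw [show (fun n => ψ n 1) = fun _ => 1 from funext fun n => (hP n).1.1]
    exact tendsto_const_nhds
  · refine LinearMap.ext fun x => ?_
    change quotientMk J (b.constr ℂ a x) = φ x
    rw [← sub_eq_zero, ← norm_le_zero_iff]
    have h1 : Filter.Tendsto (fun n => (1 / 2 : ℝ) ^ n * ‖x‖ + ‖b.constr ℂ a x - ψ n x‖) .atTop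
        (𝓝 (0 * ‖x‖ + ‖b.constr ℂ a x - b.constr ℂ a x‖)) :=
      ((tendsto_pow_atTop_nhds_zero_of_lt_one (by norm_num) (by norm_num)).mul_const _).add
        ((tendsto_const_nhds.sub (hlim x)).norm)
    rw [zero_mul, sub_self, norm_zero, add_zero] at h1
    refine ge_of_tendsto' h1 fun n => ?_
    have h2 : quotientMk J (b.constr ℂ a x) - φ x =
        (quotientMk J (ψ n x) - φ x) + quotientMk J (b.constr ℂ a x - ψ n x) := by
      rw [map_sub]; abel
    rw [h2]
    exact (norm_add_le _ _).trans (add_le_add ((hP n).2 x) (norm_quotientMk_le J _))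

end OperatorSystem

/-! ### Maps into ultrapowers -/

/-- The positive element `t² - z⋆z` is a square `q⋆q`, and `‖q‖ ≤ t` because `q⋆q ≤ t²`. -/
theorem CStarAlgebra.exists_norm_le_sq_sub_eq_star_mul_self {A : Type*} [CStarAlgebra A]
    [PartialOrder A] [StarOrderedRing A] {z : A} {t : ℝ} (ht : 0 ≤ t) (hz : ‖z‖ ≤ t) :
    ∃ q : A, ‖q‖ ≤ t ∧ ((t ^ 2 : ℝ) : ℂ) • 1 - star z * z = star q * q := by
  obtain ⟨q, hq⟩ := exists_eq_star_mul_self (sq_sub_nonneg_of_norm_le hz)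
  refine ⟨q, norm_le_of_sq_sub_nonneg ht ?_, hq⟩
  rw [← hq, sub_sub_cancel]
  exact star_mul_self_nonneg _

namespace lp

open CStarAlgebra

universe u w

variable {I : Type w}

/-- The bounded family with entries `a i`. -/
def ofBounded {A : I → Type u} [∀ i, NormedAddCommGroup (A i)] (a : ∀ i, A i) {C : ℝ}
    (h : ∀ i, ‖a i‖ ≤ C) : lp A ∞ :=
  ⟨a, memℓp_infty ⟨C, by rintro _ ⟨i, rfl⟩; exact h i⟩⟩

variable {A : Type u} [CStarAlgebra A] [Nontrivial A]

variable (A) in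
/-- The coordinate homomorphisms of `ℓ^∞(I, A)`. -/
noncomputable def coord (i : I) : lp (fun _ : I => A) ∞ →⋆ₐ[ℂ] A where
  toFun a := a i
  map_one' := rfl
  map_mul' _ _ := rfl
  map_zero' := rfl
  map_add' _ _ := rfl
  commutes' _ := rfl
  map_star' _ := rfl

variable (ω : Ultrafilter I)

theorem quotientMk_ultrapowerIdeal_eq_zero {a : lp (fun _ : I => A) ∞} :
    quotientMk (ultrapowerIdeal A ω) a = 0 ↔ Filter.Tendsto (fun i => ‖a i‖) ω (𝓝 0) :=
  quotientMk_eq_zero _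

/-- The norm of a matrix over an ultrapower is bounded by any number which bounds the norms of the
coordinates along the ultrafilter. Writing `t² - z⋆z = q⋆q` in these coordinates exhibits
`t² - z⋆z` as a positive element over the ultrapower. -/
theorem norm_map_quotientMk_ultrapowerIdeal_le {n : ℕ}
    (z : CStarMatrix (Fin n) (Fin n) (lp (fun _ : I => A) ∞)) {t : ℝ} (ht : 0 ≤ t)
    (h : ∀ᶠ i in (ω : Filter I), ‖z.map (coord A i)‖ ≤ t) :
    ‖z.map (quotientMk (ultrapowerIdeal A ω))‖ ≤ t := by
  have hq (i : I) : ∃ q : CStarMatrix (Fin n) (Fin n) A, ‖q‖ ≤ t ∧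
      (‖z.map (coord A i)‖ ≤ t →
        ((t ^ 2 : ℝ) : ℂ) • 1 - star (z.map (coord A i)) * z.map (coord A i) = star q * q) := by
    by_cases hi : ‖z.map (coord A i)‖ ≤ t
    · obtain ⟨q, hqt, hq⟩ := exists_norm_le_sq_sub_eq_star_mul_self ht hi
      exact ⟨q, hqt, fun _ => hq⟩
    · exact ⟨0, by simpa using ht, fun h => absurd h hi⟩
  choose q hqt hqz using hq
  let Q : CStarMatrix (Fin n) (Fin n) (lp (fun _ : I => A) ∞) :=
    CStarMatrix.ofMatrix (.of fun a b => ofBounded (fun i => q i a b) (C := t)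
      fun i => CStarMatrix.norm_entry_le_norm.trans (hqt i))
  have hQ (i : I) : Q.map (coord A i) = q i := rfl
  let Z : CStarMatrix (Fin n) (Fin n) (lp (fun _ : I => A) ∞) :=
    ((t ^ 2 : ℝ) : ℂ) • 1 - star z * z - star Q * Q
  have hZ (π : lp (fun _ : I => A) ∞ →⋆ₐ[ℂ] A) : Z.map π =
      ((t ^ 2 : ℝ) : ℂ) • 1 - star (z.map π) * z.map π - star (Q.map π) * Q.map π := by
    change CStarMatrix.mapStarAlgHom π Z = ((t ^ 2 : ℝ) : ℂ) • 1 -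
      star (CStarMatrix.mapStarAlgHom π z) * CStarMatrix.mapStarAlgHom π z -
      star (CStarMatrix.mapStarAlgHom π Q) * CStarMatrix.mapStarAlgHom π Q
    simp only [Z, map_sub, map_smul, map_mul, map_star, map_one]
  have hZ0 : Z.map (quotientMk (ultrapowerIdeal A ω)) = 0 := by
    ext a b
    rw [CStarMatrix.map_apply, CStarMatrix.zero_apply, quotientMk_ultrapowerIdeal_eq_zero]
    refine tendsto_const_nhds.congr' ?_
    filter_upwards [h] with i hi
    have h1 := hZ (coord A i)
    rw [hqz i hi, hQ, sub_self] at h1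
    have h2 : Z a b i = 0 := congrFun (congrFun h1 a) b
    rw [h2]
    exact _root_.norm_zero.symm
  have hZ' : CStarMatrix.mapStarAlgHom (quotientMk (ultrapowerIdeal A ω)) Z = 0 := hZ0
  simp only [Z, map_sub, map_smul, map_mul, map_star, map_one, sub_eq_zero] at hZ'
  refine norm_le_of_sq_sub_nonneg
    (a := CStarMatrix.mapStarAlgHom (quotientMk (ultrapowerIdeal A ω)) z) ht ?_
  rw [hZ']
  exact star_mul_self_nonneg _

end lp

/-! ### Almost contractive maps along an ultrafilter -/

namespace OperatorSystem

open CStarAlgebra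

universe u v w

theorem IsUCP.starAlgHom_comp {B : Type u} [CStarAlgebra B] {X : OperatorSystem B} {A : Type v}
    [CStarAlgebra A] {A' : Type w} [CStarAlgebra A'] {φ : X.toSubmodule →ₗ[ℂ] A} (hφ : IsUCP φ)
    (p : A →⋆ₐ[ℂ] A') : IsUCP (p.toAlgHom.toLinearMap ∘ₗ φ) :=
  ⟨(congrArg p hφ.1).trans (map_one p), fun n M hM =>
    CStarMatrix.map_starAlgHom_nonneg p (hφ.2 n M hM)⟩

variable {B : Type u} [CStarAlgebra B] {X : OperatorSystem B}

/-- A family of unital maps on subsystems `S i` exhausting `X`, with values in one algebra `A`,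
such that the norm at a level tending to infinity tends to `1` along the ultrafilter `ω`. That `S i`
exhausts `X` means that the distance from each element of `X` to `S i` tends to `0` along `ω`. -/
structure IsAlmostUCPFamily {I : Type w} (ω : Ultrafilter I) (X : OperatorSystem B)
    (S : I → OperatorSystem B) {A : Type u} [CStarAlgebra A]
    (Φ : ∀ i, (S i).toSubmodule →ₗ[ℂ] A) (k : I → ℕ) (ε : I → ℝ) : Prop where
  le : ∀ i, (S i).toSubmodule ≤ X.toSubmodule
  infDist : ∀ x ∈ X.toSubmodule,
    Filter.Tendsto (fun i => Metric.infDist x ((S i).toSubmodule : Set B)) ω (𝓝 0)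
  unital : ∀ i, IsUnital (Φ i)
  level_pos : ∀ i, 0 < k i
  tendsto_level : Filter.Tendsto k ω .atTop
  nonneg : ∀ i, 0 ≤ ε i
  le_one : ∀ i, ε i ≤ 1
  tendsto_zero : Filter.Tendsto ε ω (𝓝 0)
  levelNorm_le : ∀ i, levelNorm (k i) (Φ i) ≤ ENNReal.ofReal (1 + ε i)

namespace IsAlmostUCPFamily

variable {I : Type w} {ω : Ultrafilter I} {S : I → OperatorSystem B} {A : Type u} [CStarAlgebra A]
  {Φ : ∀ i, (S i).toSubmodule →ₗ[ℂ] A} {k : I → ℕ} {ε : I → ℝ}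

theorem norm_apply_le (h : IsAlmostUCPFamily ω X S Φ k ε) (i : I) (x : (S i).toSubmodule) :
    ‖Φ i x‖ ≤ 2 * ‖x‖ :=
  norm_apply_le_of_levelNorm_le (h.level_pos i) zero_le_two ((h.levelNorm_le i).trans
    (ENNReal.ofReal_le_ofReal (by linarith [h.le_one i]))) x

/-- Elements of `X` are bounded limits of elements of the subsystems `S i`. -/
theorem exists_tendsto (h : IsAlmostUCPFamily ω X S Φ k ε) (x : X.toSubmodule) :
    ∃ s : ∀ i, (S i).toSubmodule, (∀ i, ‖s i‖ ≤ 2 * ‖x‖ + 1) ∧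
      Filter.Tendsto (fun i => ‖(s i : B) - x‖) ω (𝓝 0) := by
  have hex (i : I) : ∃ s : (S i).toSubmodule,
      dist (x : B) s <
        Metric.infDist (x : B) ((S i).toSubmodule : Set B) + 1 / ((k i : ℝ) + 1) := by
    obtain ⟨s, hs, hlt⟩ := (Metric.infDist_lt_iff ⟨0, (S i).toSubmodule.zero_mem⟩).1
      (lt_add_of_pos_right (Metric.infDist (x : B) ((S i).toSubmodule : Set B))
        (show (0 : ℝ) < 1 / ((k i : ℝ) + 1) by positivity))
    exact ⟨⟨s, hs⟩, hlt⟩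
  choose s hs using hex
  refine ⟨s, fun i => ?_, ?_⟩
  · have h1 : Metric.infDist (x : B) ((S i).toSubmodule : Set B) ≤ ‖x‖ := by
      refine (Metric.infDist_le_dist_of_mem (S i).toSubmodule.zero_mem).trans ?_
      rw [dist_zero_right]
      rfl
    have h2 : 1 / ((k i : ℝ) + 1) ≤ 1 := by
      rw [div_le_one (by positivity)]
      linarith [(k i).cast_nonneg (α := ℝ)]
    have h3 := hs i
    rw [dist_comm, dist_eq_norm] at h3
    have h4 : ‖s i‖ ≤ ‖(s i : B) - x‖ + ‖x‖ := by
      have := norm_add_le ((s i : B) - x) x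
      rwa [sub_add_cancel] at this
    linarith
  · have h1 : Filter.Tendsto (fun i => 1 / ((k i : ℝ) + 1)) ω (𝓝 0) :=
      tendsto_one_div_add_atTop_nhds_zero_nat.comp h.tendsto_level
    have h2 := (h.infDist x x.2).add h1
    rw [add_zero] at h2
    refine squeeze_zero (fun _ => norm_nonneg _) (fun i => ?_) h2
    rw [← dist_eq_norm, dist_comm]
    exact (hs i).le

variable [Nontrivial A]

/-- The class of `(Φ i (s i))` in the ultrapower depends on the family `s` only up to families
converging to zero. -/
theorem quotientMk_eq_of_tendsto (h : IsAlmostUCPFamily ω X S Φ k ε) {y z : lp (fun _ : I => A) ∞}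
    {s t : ∀ i, (S i).toSubmodule} (hy : ∀ i, y i = Φ i (s i)) (hz : ∀ i, z i = Φ i (t i))
    (hst : Filter.Tendsto (fun i => ‖(s i : B) - t i‖) ω (𝓝 0)) :
    quotientMk (ultrapowerIdeal A ω) y = quotientMk (ultrapowerIdeal A ω) z := by
  rw [← sub_eq_zero, ← map_sub, lp.quotientMk_ultrapowerIdeal_eq_zero]
  have h2 := hst.const_mul 2
  rw [mul_zero] at h2
  refine squeeze_zero (fun _ => norm_nonneg _) (fun i => ?_) h2
  have : (y - z) i = Φ i (s i - t i) := by
    rw [map_sub, ← hy, ← hz]; rfl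
  rw [this]
  exact h.norm_apply_le i _

/-- The limit of the maps `Φ i` in the ultrapower is unital completely positive, because its
amplifications are contractive. -/
theorem exists_isUCP (h : IsAlmostUCPFamily ω X S Φ k ε) :
    ∃ φ : X.toSubmodule →ₗ[ℂ] CStarUltrapower A ω, IsUCP φ ∧
      ∀ x : X.toSubmodule, ∃ (s : ∀ i, (S i).toSubmodule) (y : lp (fun _ : I => A) ∞),
        Filter.Tendsto (fun i => ‖(s i : B) - x‖) ω (𝓝 0) ∧ (∀ i, y i = Φ i (s i)) ∧
        φ x = quotientMk (ultrapowerIdeal A ω) y := by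
  choose s hsb hs using h.exists_tendsto
  let y (x : X.toSubmodule) : lp (fun _ : I => A) ∞ := lp.ofBounded (fun i => Φ i (s x i))
    (C := 2 * (2 * ‖x‖ + 1)) fun i => (h.norm_apply_le i _).trans (by gcongr; exact hsb x i)
  let φ : X.toSubmodule →ₗ[ℂ] CStarUltrapower A ω :=
    { toFun := fun x => quotientMk (ultrapowerIdeal A ω) (y x)
      map_add' := fun x x' => by
        rw [← map_add]
        refine h.quotientMk_eq_of_tendsto (s := s (x + x')) (t := fun i => s x i + s x' i)
          (fun i => rfl) (fun i => (map_add (Φ i) _ _).symm) ?_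
        have h1 := (hs (x + x')).add ((hs x).add (hs x'))
        simp only [add_zero] at h1
        refine squeeze_zero (fun _ => norm_nonneg _) (fun i => ?_) h1
        have h2 : (s (x + x') i : B) - ((s x i + s x' i : (S i).toSubmodule) : B) =
            (s (x + x') i - ((x + x' : X.toSubmodule) : B)) - ((s x i - x) + (s x' i - x')) := by
          push_cast
          abel
        rw [h2]
        exact (norm_sub_le _ _).trans (by gcongr; exact norm_add_le _ _)
      map_smul' := fun z x => by
        rw [RingHom.id_apply, ← map_smul]
        refine h.quotientMk_eq_of_tendsto (s := s (z • x)) (t := fun i => z • s x i)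
          (fun i => rfl) (fun i => (map_smul (Φ i) _ _).symm) ?_
        have h1 := (hs (z • x)).add ((hs x).const_mul ‖z‖)
        simp only [mul_zero, add_zero] at h1
        refine squeeze_zero (fun _ => norm_nonneg _) (fun i => ?_) h1
        have h2 : (s (z • x) i : B) - ((z • s x i : (S i).toSubmodule) : B) =
            (s (z • x) i - ((z • x : X.toSubmodule) : B)) - z • (s x i - (x : B)) := by
          push_cast
          rw [smul_sub]
          abel
        rw [h2]
        exact (norm_sub_le _ _).trans (by gcongr; exact norm_smul_le _ _) }
  have hφ (x) : φ x = quotientMk (ultrapowerIdeal A ω) (y x) := rfl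
  refine ⟨φ, isUCP_of_norm_map_le ?_ fun n M => ?_, fun x => ⟨s x, y x, hs x, fun _ => rfl, rfl⟩⟩
  · change φ 1 = 1
    rw [hφ, ← map_one (quotientMk (ultrapowerIdeal A ω))]
    exact h.quotientMk_eq_of_tendsto (s := s 1) (t := fun i => 1) (fun _ => rfl)
      (fun i => (h.unital i).symm) (hs 1)
  · set m := ‖M.map (Subtype.val : X.toSubmodule → B)‖ with hm
    refine le_of_forall_pos_le_add fun δ hδ => ?_
    have hMφ : M.map φ = (M.map y).map (quotientMk (ultrapowerIdeal A ω)) := rfl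
    rw [hMφ]
    refine lp.norm_map_quotientMk_ultrapowerIdeal_le ω _ (by positivity) ?_
    let Ms (i : I) : CStarMatrix (Fin n) (Fin n) (S i).toSubmodule := M.map fun x => s x i
    have hlim : Filter.Tendsto
        (fun i => (Ms i).map (Subtype.val : (S i).toSubmodule → B)) ω
        (𝓝 (M.map (Subtype.val : X.toSubmodule → B))) := by
      rw [tendsto_iff_norm_sub_tendsto_zero]
      refine squeeze_zero (fun _ => norm_nonneg _)
        (fun i => CStarMatrix.norm_le_sum_norm_apply _) ?_
      have : Filter.Tendsto (fun i => ∑ b, ∑ a, ‖(s (M a b) i : B) - M a b‖) ω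
          (𝓝 (∑ _b : Fin n, ∑ _a : Fin n, 0)) :=
        tendsto_finsetSum _ fun b _ => tendsto_finsetSum _ fun a _ => hs (M a b)
      simp only [Finset.sum_const_zero] at this
      exact this
    have hlim2 := (h.tendsto_zero.const_add 1).mul hlim.norm
    rw [add_zero, one_mul] at hlim2
    filter_upwards [hlim2.eventually_lt_const (lt_add_of_pos_right m hδ),
      h.tendsto_level.eventually_ge_atTop n] with i hi hki
    have h1 := norm_map_le_of_levelNorm_le (by linarith [h.nonneg i])
      ((levelNorm_mono hki).trans (h.levelNorm_le i)) (Ms i)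
    exact h1.trans hi.le

/-- If `X` has the local ultrapower lifting property, then the maps `Φ i` are close to unital
completely positive maps on each finite-dimensional subsystem. -/
theorem exists_isUCP_norm_sub_lt (h : IsAlmostUCPFamily ω X S Φ k ε) (hX : X.HasLULPAt ω)
    {E : OperatorSystem B} [FiniteDimensional ℂ E.toSubmodule]
    (hE : ∀ i, E.toSubmodule ≤ (S i).toSubmodule) {δ : ℝ} (hδ : 0 < δ) :
    ∃ (i : I) (ψ : E.toSubmodule →ₗ[ℂ] A), IsUCP ψ ∧
      ‖LinearMap.toContinuousLinearMap (restrict (hE i) (Φ i) - ψ)‖ < δ := by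
  obtain ⟨φ, hφ, hφs⟩ := h.exists_isUCP
  have hEX : E.toSubmodule ≤ X.toSubmodule := by
    obtain ⟨i⟩ : Nonempty I := ω.neBot.nonempty
    exact (hE i).trans (h.le i)
  obtain ⟨ψ, hψ, hψφ⟩ := hX A φ hφ E hEX
  let ψi (i : I) : E.toSubmodule →ₗ[ℂ] A := (lp.coord A i).toAlgHom.toLinearMap ∘ₗ ψ
  have hclose (x : E.toSubmodule) :
      Filter.Tendsto (fun i => ‖(restrict (hE i) (Φ i) - ψi i) x‖) ω (𝓝 0) := by
    obtain ⟨s, y, hs, hy, hφx⟩ := hφs (Submodule.inclusion hEX x)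
    have h1 : quotientMk (ultrapowerIdeal A ω) (y - ψ x) = 0 := by
      rw [map_sub, ← hφx, sub_eq_zero]
      exact (LinearMap.congr_fun hψφ x).symm
    rw [lp.quotientMk_ultrapowerIdeal_eq_zero] at h1
    have h2 := (hs.const_mul 2).add h1
    rw [mul_zero, add_zero] at h2
    refine squeeze_zero (fun _ => norm_nonneg _) (fun i => ?_) h2
    have h3 : (restrict (hE i) (Φ i) - ψi i) x =
        -Φ i (s i - Submodule.inclusion (hE i) x) + (y - ψ x) i := by
      have key (a b c : A) : a - c = -(b - a) + (b - c) := by abel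
      rw [map_sub, ← hy]
      exact key _ _ _
    rw [h3]
    refine (norm_add_le _ _).trans ?_
    rw [norm_neg]
    gcongr
    exact h.norm_apply_le i _
  obtain ⟨C, hC, hCb⟩ := (Module.finBasis ℂ E.toSubmodule).exists_opNorm_le (F := A)
  have hev : ∀ᶠ i in (ω : Filter I), ∀ j,
      ‖(restrict (hE i) (Φ i) - ψi i) (Module.finBasis ℂ E.toSubmodule j)‖ < δ / (2 * C) :=
    Filter.eventually_all.2 fun j => (hclose _).eventually_lt_const (by positivity)
  obtain ⟨i, hi⟩ := hev.exists
  refine ⟨i, ψi i, hψ.starAlgHom_comp _, (hCb (by positivity) fun j => (hi j).le).trans_lt ?_⟩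
  rw [mul_div_assoc', div_lt_iff₀ (by positivity)]
  nlinarith

end IsAlmostUCPFamily

end OperatorSystem

/-! ### Products of C⋆-algebras -/

namespace lp

open CStarAlgebra

universe u w

variable {I : Type w} {A : I → Type u} [∀ i, CStarAlgebra (A i)] [∀ i, Nontrivial (A i)]

/-- The `ℓ^∞`-product of a family of nonzero unital C⋆-algebras. -/
@[reducible]
noncomputable def piCStarAlgebra : CStarAlgebra (lp A ∞) where

attribute [local instance] piCStarAlgebra

variable (A) in
/-- The coordinate homomorphisms of a product. -/
noncomputable def piCoord (i : I) : lp A ∞ →⋆ₐ[ℂ] A i where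
  toFun a := a i
  map_one' := rfl
  map_mul' _ _ := rfl
  map_zero' := rfl
  map_add' _ _ := rfl
  commutes' _ := rfl
  map_star' _ := rfl

/-- The norm of a matrix over a product is the supremum of the norms of its coordinates: in each
coordinate `t² - z⋆z` is a square. -/
theorem norm_le_of_forall_norm_map_piCoord_le {n : ℕ} (z : CStarMatrix (Fin n) (Fin n) (lp A ∞))
    {t : ℝ} (ht : 0 ≤ t) (h : ∀ i, ‖z.map (piCoord A i)‖ ≤ t) : ‖z‖ ≤ t := by
  choose q hqt hqz using fun i => exists_norm_le_sq_sub_eq_star_mul_self ht (h i)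
  let Q : CStarMatrix (Fin n) (Fin n) (lp A ∞) :=
    CStarMatrix.ofMatrix (.of fun a b => ofBounded (fun i => q i a b) (C := t)
      fun i => CStarMatrix.norm_entry_le_norm.trans (hqt i))
  have hQ : ((t ^ 2 : ℝ) : ℂ) • 1 - star z * z = star Q * Q := by
    rw [← sub_eq_zero]
    ext a b i
    have h1 : CStarMatrix.mapStarAlgHom (piCoord A i)
        (((t ^ 2 : ℝ) : ℂ) • 1 - star z * z - star Q * Q) = 0 := by
      simp only [map_sub, map_smul, map_mul, map_star, map_one]
      exact sub_eq_zero.2 (hqz i)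
    exact congrFun (congrFun h1 a) b
  refine norm_le_of_sq_sub_nonneg ht ?_
  rw [hQ]
  exact star_mul_self_nonneg _

end lp

namespace OperatorSystem

open CStarAlgebra

universe u v w

variable {B : Type u} [CStarAlgebra B] {X : OperatorSystem B}

attribute [local instance] lp.piCStarAlgebra

/-- A family of unital maps with a common bound on the norms at one level defines a unital map into
the product with the same bound. -/
theorem exists_pi {I : Type w} {A : I → Type v} [∀ i, CStarAlgebra (A i)] [∀ i, Nontrivial (A i)]
    (φ : ∀ i, X.toSubmodule →ₗ[ℂ] A i) (hφ : ∀ i, IsUnital (φ i)) {k : ℕ} (hk : 0 < k) {C : ℝ}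
    (hC : 0 ≤ C) (hle : ∀ i, levelNorm k (φ i) ≤ ENNReal.ofReal C) :
    ∃ Φ : X.toSubmodule →ₗ[ℂ] lp A ∞, IsUnital Φ ∧ levelNorm k Φ ≤ ENNReal.ofReal C ∧
      ∀ i x, lp.piCoord A i (Φ x) = φ i x := by
  let Φ : X.toSubmodule →ₗ[ℂ] lp A ∞ :=
    { toFun := fun x => lp.ofBounded (fun i => φ i x) (C := C * ‖x‖)
        fun i => norm_apply_le_of_levelNorm_le hk hC (hle i) x
      map_add' := fun x y => by
        ext i
        exact map_add (φ i) x y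
      map_smul' := fun z x => by
        ext i
        exact map_smul (φ i) z x }
  refine ⟨Φ, ?_, OperatorSystem.levelNorm_le fun M hM => ?_, fun _ _ => rfl⟩
  · ext i
    exact hφ i
  · refine lp.norm_le_of_forall_norm_map_piCoord_le _ hC fun i => ?_
    have := norm_map_le_of_levelNorm_le hC (hle i) M
    exact this.trans (mul_le_of_le_one_right hC hM)

/-- Unital maps from operator systems to different algebras are replaced by maps into the product
of these algebras, which are given by a state in the remaining coordinates. -/
theorem exists_pi_update [Nontrivial B] {I : Type w} {A : I → Type v} [∀ i, CStarAlgebra (A i)]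
    [∀ i, Nontrivial (A i)] {i : I} [FiniteDimensional ℂ X.toSubmodule]
    (φ : X.toSubmodule →ₗ[ℂ] A i) (hφ : IsUnital φ) {k : ℕ} (hk : 0 < k) {C : ℝ}
    (hC : 1 ≤ C) (hle : levelNorm k φ ≤ ENNReal.ofReal C) :
    ∃ Φ : X.toSubmodule →ₗ[ℂ] lp A ∞, IsUnital Φ ∧ levelNorm k Φ ≤ ENNReal.ofReal C ∧
      ∀ x, lp.piCoord A i (Φ x) = φ x := by
  classical
  obtain ⟨f, c, hf⟩ := exists_isFaithfulState X
  let θ : ∀ j, X.toSubmodule →ₗ[ℂ] A j := Function.update (fun j => f.smulRight 1) i φ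
  have hθi : θ i = φ := Function.update_self ..
  have hθ (j) (hj : j ≠ i) : θ j = f.smulRight 1 := Function.update_of_ne hj ..
  obtain ⟨Φ, h1, h2, h3⟩ := exists_pi θ (fun j => by
    by_cases hj : j = i
    · subst hj
      rwa [hθi]
    · rw [hθ j hj]
      exact hf.isUCP_smulRight.1) hk (zero_le_one.trans hC) (fun j => by
    by_cases hj : j = i
    · subst hj
      rwa [hθi]
    · rw [hθ j hj]
      exact (hf.isUCP_smulRight.levelNorm_le_one k).trans (by simpa using hC))
  exact ⟨Φ, h1, h2, fun x => by rw [h3, hθi]⟩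

/-! ### The lifting properties -/

/-- The subsystem generated by a subsystem `E` and a set `T`. -/
noncomputable def adjoin (E : OperatorSystem B) (T : Set B) : OperatorSystem B where
  toSubmodule := E.toSubmodule ⊔ Submodule.span ℂ (T ∪ star '' T)
  one_mem := Submodule.mem_sup_left E.one_mem
  star_mem x hx := by
    have hspan (s : B) (hs : s ∈ Submodule.span ℂ (T ∪ star '' T)) :
        star s ∈ Submodule.span ℂ (T ∪ star '' T) := by
      induction hs using Submodule.span_induction with
      | mem y hy =>
        refine Submodule.subset_span ?_
        rcases hy with hy | ⟨y, hy, rfl⟩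
        · exact .inr ⟨y, hy, rfl⟩
        · exact .inl (by rwa [star_star])
      | zero => simp
      | add y z _ _ ihy ihz =>
        rw [star_add]
        exact add_mem ihy ihz
      | smul a y _ ihy =>
        rw [star_smul]
        exact Submodule.smul_mem _ _ ihy
    obtain ⟨e, he, s, hs, rfl⟩ := Submodule.mem_sup.1 hx
    rw [star_add]
    exact Submodule.add_mem_sup (E.star_mem e he) (hspan s hs)

theorem le_adjoin (E : OperatorSystem B) (T : Set B) : E.toSubmodule ≤ (adjoin E T).toSubmodule :=
  le_sup_left

theorem subset_adjoin (E : OperatorSystem B) (T : Set B) :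
    T ⊆ ((adjoin E T).toSubmodule : Set B) := fun _ hx =>
  Submodule.mem_sup_right (Submodule.subset_span (.inl hx))

theorem adjoin_le {E : OperatorSystem B} (hE : E.toSubmodule ≤ X.toSubmodule) {T : Set B}
    (hT : T ⊆ X.toSubmodule) : (adjoin E T).toSubmodule ≤ X.toSubmodule := by
  refine sup_le hE (Submodule.span_le.2 (Set.union_subset hT ?_))
  rintro _ ⟨y, hy, rfl⟩
  exact X.star_mem y (hT hy)

theorem finiteDimensional_adjoin (E : OperatorSystem B) [FiniteDimensional ℂ E.toSubmodule]
    {T : Set B} (hT : T.Finite) : FiniteDimensional ℂ (adjoin E T).toSubmodule := by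
  have := FiniteDimensional.span_of_finite ℂ (hT.union (hT.image star))
  exact Submodule.finiteDimensional_sup _ _

/-- The local ultrapower lifting property for one ultrafilter implies CP-stability, if there is a
family of finite subsets of `X` which becomes dense along the ultrafilter. The universe of `B`
contains that of the index set, so that products indexed by it are admissible target algebras. -/
theorem HasLULPAt.isCPStable {B : Type (max u w)} [CStarAlgebra B] [Nontrivial B]
    {X : OperatorSystem B} {I : Type w} {ω : Ultrafilter I} (h : X.HasLULPAt ω) {T : I → Set B}
    (hTf : ∀ i, (T i).Finite) (hTX : ∀ i, T i ⊆ X.toSubmodule)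
    (hT : ∀ x ∈ X.toSubmodule, ∀ η > 0, ∀ᶠ i in (ω : Filter I), ∃ y ∈ T i, dist x y < η)
    {k : I → ℕ} (hk : Filter.Tendsto k ω .atTop) : X.IsCPStable := by
  intro E _ hE δ hδ
  set S : I → OperatorSystem B := fun i => adjoin E (T i) with hS
  have hSf (i) : FiniteDimensional ℂ (S i).toSubmodule := finiteDimensional_adjoin E (hTf i)
  have hES (i) : E.toSubmodule ≤ (S i).toSubmodule := le_adjoin E (T i)
  have hSX (i) : (S i).toSubmodule ≤ X.toSubmodule := adjoin_le hE (hTX i)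
  set ε : I → ℝ := fun i => 1 / ((k i : ℝ) + 1) with hε
  have hε0 (i) : 0 < ε i := by positivity
  by_contra hcon
  have hbad (i : I) : ∃ (A : Type (max u w)) (_ : CStarAlgebra A)
      (φ : (S i).toSubmodule →ₗ[ℂ] A), IsUnital φ ∧
      levelNorm (k i + 1) φ < ENNReal.ofReal (1 + ε i) ∧
      ∀ ψ : E.toSubmodule →ₗ[ℂ] A, IsUCP ψ →
        δ ≤ ‖LinearMap.toContinuousLinearMap (restrict (hES i) φ - ψ)‖ := by
    by_contra! hi
    exact hcon ⟨S i, hES i, k i + 1, ε i, hSf i, hSX i, Nat.succ_pos _, hε0 i,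
      fun A _ φ h1 h2 => hi A _ φ h1 h2⟩
  choose A instA φ hφ1 hφk hφE using hbad
  -- over the zero algebra `φ i` itself is unital completely positive
  have hA (i) : Nontrivial (A i) := by
    by_contra hA
    rw [not_nontrivial_iff_subsingleton] at hA
    have h1 := hφE i (restrict (hES i) (φ i)) ⟨Subsingleton.elim _ _, fun n M _ =>
      le_of_eq (by ext; exact Subsingleton.elim _ _)⟩
    rw [sub_self, map_zero, ContinuousLinearMap.opNorm_zero] at h1
    exact hδ.not_ge h1
  choose Φ hΦ1 hΦk hΦ using fun i => exists_pi_update (φ i) (hφ1 i) (Nat.succ_pos (k i))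
    (by linarith [hε0 i] : 1 ≤ 1 + ε i) (hφk i).le
  obtain ⟨i₀⟩ : Nonempty I := ω.neBot.nonempty
  have : Nontrivial (lp A ∞) := by
    have : Nonempty I := ⟨i₀⟩
    exact NormOneClass.nontrivial
  have hfam : IsAlmostUCPFamily ω X S Φ (fun i => k i + 1) ε :=
    { le := hSX
      infDist := fun x hx => by
        rw [Metric.tendsto_nhds]
        intro η hη
        filter_upwards [hT x hx η hη] with i hi
        obtain ⟨y, hy, hxy⟩ := hi
        rw [Real.dist_0_eq_abs, abs_of_nonneg Metric.infDist_nonneg]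
        exact (Metric.infDist_le_dist_of_mem (subset_adjoin E _ hy)).trans_lt hxy
      unital := hΦ1
      level_pos := fun i => Nat.succ_pos _
      tendsto_level := (Filter.tendsto_add_atTop_nat 1).comp hk
      nonneg := fun i => (hε0 i).le
      le_one := fun i => by
        rw [hε, div_le_one (by positivity)]
        linarith [(k i).cast_nonneg (α := ℝ)]
      tendsto_zero := tendsto_one_div_add_atTop_nhds_zero_nat.comp hk
      levelNorm_le := hΦk }
  obtain ⟨i, ψ, hψ, hlt⟩ := hfam.exists_isUCP_norm_sub_lt h hES hδ
  refine (hφE i _ (hψ.starAlgHom_comp (lp.piCoord A i))).not_gt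
    (LE.le.trans_lt (ContinuousLinearMap.opNorm_le_bound _ (ContinuousLinearMap.opNorm_nonneg _)
      fun x => ?_) hlt)
  refine le_trans ?_ ((LinearMap.toContinuousLinearMap
    (restrict (hES i) (Φ i) - ψ)).le_opNorm x)
  have h1 : LinearMap.toContinuousLinearMap (restrict (hES i) (φ i) -
      (lp.piCoord A i).toAlgHom.toLinearMap ∘ₗ ψ) x =
      lp.piCoord A i ((restrict (hES i) (Φ i) - ψ) x) := by
    change φ i _ - lp.piCoord A i (ψ x) = lp.piCoord A i (Φ i _ - ψ x)
    rw [map_sub, hΦ]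
  rw [h1]
  exact NonUnitalStarAlgHom.norm_apply_le (lp.piCoord A i) _

theorem HasLLP.hasLULPAt {B : Type (max u w)} [CStarAlgebra B] {X : OperatorSystem B} {I : Type w}
    (h : X.HasLLP) (ω : Ultrafilter I) : X.HasLULPAt ω :=
  fun A _ _ φ hφ E _ hE => h (lp (fun _ : I => A) ∞) (ultrapowerIdeal A ω) φ hφ E hE

theorem HasLLP.hasALLP (h : X.HasLLP) : X.HasALLP := by
  intro A _ J _ _ φ hφ E _ hE ε hε
  obtain ⟨ψ, hψ, hψφ⟩ := h A J φ hφ E hE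
  refine ⟨ψ, hψ.cbNorm_le_one.trans_lt (ENNReal.one_lt_ofReal.2 (by linarith)), ?_⟩
  rwa [hψφ, sub_self, map_zero, ContinuousLinearMap.opNorm_zero]

theorem HasALLP.hasLLP [Nontrivial B] (h : X.HasALLP) : X.HasLLP :=
  fun _ _ J _ _ _ hφ _ _ hE =>
    exists_isUCP_lift_of_approx J fun _ hδ => h.exists_isUCP_norm_sub_le J hφ hE hδ

theorem IsCPStable.hasLLP [Nontrivial B] (h : X.IsCPStable) : X.HasLLP :=
  fun _ _ J _ _ _ hφ _ _ hE =>
    exists_isUCP_lift_of_approx J fun _ hδ => h.exists_isUCP_norm_sub_le J hφ hE hδ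

/-- The index set is the set of pairs of a finite subset of `X` and a level, directed by inclusion
and size, with an ultrafilter containing the final segments. -/
theorem HasLULP.isCPStable [Nontrivial B] (h : X.HasLULP) : X.IsCPStable := by
  classical
  let ω : Ultrafilter (Finset X.toSubmodule × ℕ) := .of .atTop
  have hω : (ω : Filter (Finset X.toSubmodule × ℕ)) ≤ .atTop := Ultrafilter.of_le _
  refine HasLULPAt.isCPStable.{u, u} (h _ ω)
    (T := fun i => Subtype.val '' (i.1 : Set X.toSubmodule))
    (k := Prod.snd) (fun i => i.1.finite_toSet.image _) ?_ ?_ ?_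
  · rintro i _ ⟨x, -, rfl⟩
    exact x.2
  · intro x hx η hη
    filter_upwards [hω (Filter.eventually_ge_atTop (({⟨x, hx⟩} : Finset X.toSubmodule), 0))]
      with i hi
    exact ⟨x, ⟨⟨x, hx⟩, hi.1 (Finset.mem_singleton_self _), rfl⟩, by rwa [dist_self]⟩
  · refine Filter.Tendsto.mono_left ?_ hω
    rw [← Filter.prod_atTop_atTop_eq]
    exact Filter.tendsto_snd

/-- The index `n` stands for the first `n + 1` elements of a dense sequence. -/
theorem HasLULPAt.isCPStable_of_separableSpace [Nontrivial B]
    [TopologicalSpace.SeparableSpace X.toSubmodule] {ω : Ultrafilter ℕ}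
    (hω : (ω : Filter ℕ) ≤ Filter.cofinite) (h : X.HasLULPAt ω) : X.IsCPStable := by
  rw [Nat.cofinite_eq_atTop] at hω
  let d := TopologicalSpace.denseSeq X.toSubmodule
  refine HasLULPAt.isCPStable.{u, 0} h (T := fun n => (fun j => (d j : B)) '' Set.Iic n)
    (k := id) (fun n => (Set.finite_Iic n).image _) ?_ ?_ hω
  · rintro n _ ⟨j, -, rfl⟩
    exact (d j).2
  · intro x hx η hη
    obtain ⟨j, hj⟩ := (TopologicalSpace.denseRange_denseSeq X.toSubmodule).exists_dist_lt
      ⟨x, hx⟩ hη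
    filter_upwards [hω (Filter.eventually_ge_atTop j)] with n hn
    exact ⟨d j, ⟨j, hn, rfl⟩, hj⟩

end OperatorSystem

theorem mainTheorem3 {B : Type*} [CStarAlgebra B] [Nontrivial B] (X : OperatorSystem B) :
    [X.HasLLP, X.HasALLP, X.HasLULP, X.IsCPStable].TFAE ∧
    (TopologicalSpace.SeparableSpace X.toSubmodule →
      ∀ ω : Ultrafilter ℕ, (ω : Filter ℕ) ≤ Filter.cofinite →
        (X.HasLULPAt ω ↔ X.IsCPStable)) := by
  refine ⟨?_, fun _ ω hω => ⟨OperatorSystem.HasLULPAt.isCPStable_of_separableSpace hω,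
    fun h => h.hasLLP.hasLULPAt ω⟩⟩
  tfae_have 1 → 2 := OperatorSystem.HasLLP.hasALLP
  tfae_have 2 → 1 := OperatorSystem.HasALLP.hasLLP
  tfae_have 1 → 3 := fun h _ ω => h.hasLULPAt ω
  tfae_have 3 → 4 := OperatorSystem.HasLULP.isCPStable
  tfae_have 4 → 1 := OperatorSystem.IsCPStable.hasLLP
  tfae_finish
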